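/- **Conventions.** A (finitary, one-sorted) *dynamical rule* is an expression $\Gamma \vdash \exists \underline y^1\,\Delta_1 \text{ op } \cdots \text{ op } \exists \underline y^m\,\Delta_m$ with finite lists $\Gamma,\Delta_i$ of atomic formulas; it is a *Horn rule* if its right-hand side is a single list of atomic formulas (no op, no $\exists$, no $\bot$). A *dynamical theory* is a signature with a set of dynamical rules (axioms); it is a *Horn theory* if all axioms are Horn rules. A *dynamical proof* is a finite tree: at a node one substitutes terms in an axiom whose premises are already known, opens one branch for each disjunct, introduces fresh variables for the existential variables and adds the atomic formulas of the disjunct to those known; the proof is complete when, at each leaf, one disjunct of the desired conclusion is satisfied by some terms. If $G$ is a set of generators and $R$ a set of atomic formulas without variables over $\Sigma\cup G$, then $((G,R),\mathcal T)$ is the theory $\mathcal T$ with the constants of $G$ and the axioms $\vdash P$ ($P\in R$) added. Two theories whose signatures contain $\Sigma$ *prove the same Horn rules on* $\Sigma$ if, for each presentation $(G,R)$ on $\Sigma$, the structures $((G,R),\mathcal T_1)$ and $((G,R),\mathcal T_2)$ prove the same Horn rules written on $\Sigma\cup G$. All signatures contain $\cdot=0,\ \cdot\ge 0;\ +,\times,-,0,1$,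 and possibly $\cdot>0$, $\vee$ and a binary function symbol $\mathrm{Fr}$. One writes $x=y$, $x\ge y$, $x>y$ for $x-y=0$, $x-y\ge0$, $x-y>0$; $x\wedge y=-(-x\vee -y)$, $|x|=x\vee -x$, $x^+=x\vee 0$. All theories below contain the axioms $\mathcal Ac$ of *commutative rings*: $\vdash t=0$ for each term $t$ that represents the zero polynomial with integer coefficients (variables and subterms with head symbol $\vee$ or $\mathrm{Fr}$ being the indeterminates), $\vdash 0=0$; $x=0,y=0\vdash x+y=0$; $x=0\vdash xy=0$; and the rules for substitution of equals in the predicates and function symbols of the signature. **Theories.** * $\mathcal Ao$ (ordered rings): $\vdash0\ge0$; $x\ge0,y\ge0\vdash x+y\ge0$; $\vdash x^2\ge0$; $x\ge0,y\ge0\vdash xy\ge0$; $x\ge0,x\le0\vdash x=0$ (**Gao**). * $\mathcal Aonz$ (strictly reduced ordered rings): $\mathcal Ao$ with **Aonz**: $c\ge0,\ x(x^2+c)\ge0\vdash x\ge0$. $\mathcal Atonz$ (reduced linearly ordered rings): $\mathcal Ao$ with **OT**: $\vdash x\ge0\text{ op }x\le0$, and **Anz**: $x^2=0\vdash x=0$.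 * $\mathcal Asonz$ (reduced strictly ordered rings): $\mathcal Aonz$ with **aso**: $\vdash1>0$; $x>0\vdash x\ge0$; $x>0,y\ge0\vdash x+y>0$; $x>0,y>0\vdash xy>0$; **col**: $0>0\vdash1=0$; **Aso1**: $x>0,xy\ge0\vdash y\ge0$; **Aso2**: $x\ge0,xy>0\vdash y>0$. * $\mathcal Cod$ (discrete ordered fields): $\mathcal Ao$, **aso**, **col**, **OT**, **lv**: $xy=1\vdash x^2>0$; $x^2>0\vdash\exists y\,xy=1$; $\vdash x=0\text{ op }x^2>0$. $\mathcal Codsup$: $\mathcal Cod$ with **sup**: $\vdash x\vee y\ge x$; $\vdash x\vee y\ge y$; $z\ge x,z\ge y\vdash z\ge x\vee y$. $\mathcal Crcdsup$ (discrete real closed fields with sup): $\mathcal Codsup$ with, for each $n$ and $P(x)=\sum_{k=0}^na_kx^k$, $a<b,\ P(a)P(b)<0\vdash\exists x\,(P(x)=0,\ a<x<b)$. * $\mathcal Afrnz$ (reduced $f$-rings): $x=0,y=0\vdash(u+x)\vee(v+y)=u\vee v$; $\vdash x\vee x=x$; $\vdash x\vee y=y\vee x$; $\vdash(x\vee y)\vee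 z=x\vee(y\vee z)$; **grl**: $\vdash x+(y\vee z)=(x+y)\vee(x+z)$; **afr**: $\vdash x^+(y\vee z)=(x^+y)\vee(x^+z)$; $x\ge0$ is equivalent to $x\vee0=x$; **Anz**. * $\mathcal Asrnz$ (reduced strict $f$-rings): $\mathcal Afrnz$ with **aso**, **col**, **lv**, **Aso1**, **Aso2**, **sup**. * $\mathcal Co\text{-}$: $\mathcal Asonz$ with **Anz**, **lv**, **sup**, **grl**, **afr**, **IV**: $x>0\vdash\exists y\,xy=1$, and **OTF**: $x+y>0\vdash x>0\text{ op }y>0$. * **fr**: $\vdash\mathrm{Fr}(a,b)\,|b|=(|a|\wedge|b|)^2$ and $\vdash0\le\mathrm{Fr}(a,b)\le|a|\wedge|b|$. $\mathcal Co$ (non discrete ordered fields): $\mathcal Co\text{-}$ with **fr**. $\mathcal Aftr$ (strongly real rings): $\mathcal Afrnz$ with the rules that define $x>0$ as $x\ge0\wedge\exists z\,xz=1$, and **fr**. $\mathcal Codsup_{\mathrm{Fr}}$, $\mathcal Crcdsup_{\mathrm{Fr}}$: $\mathcal Codsup$, $\mathcal Crcdsup$ with **fr**. A theory $\mathcal T'$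 *extends* $\mathcal T$ if its signature contains that of $\mathcal T$ and it proves the axioms of $\mathcal T$. A theory $\mathcal T$ is *intermediate above* $\mathcal W$ if $\mathcal T$ extends $\mathcal W$ and $\mathcal Crcdsup_{\mathrm{Fr}}$ extends $\mathcal T$. **Theorem.** The following dynamical theories prove the same Horn rules. 1. On $(=0,\ge0;+,\times,-,0,1)$: $\mathcal Aonz$, $\mathcal Crcdsup$ and all intermediate theories above $\mathcal Aonz$; in particular $\mathcal Afrnz$, $\mathcal Atonz$, $\mathcal Cod$, $\mathcal Co\text{-}$, which are intermediate. 2. On $(=0,\ge0,>0;+,\times,-,0,1)$: $\mathcal Asonz$, $\mathcal Crcdsup$ and all intermediate theories above $\mathcal Asonz$; in particular $\mathcal Asrnz$, $\mathcal Cod$, $\mathcal Co\text{-}$, which are intermediate. 3. On $(=0,\ge0;+,\times,\vee,-,0,1)$: $\mathcal Afrnz$, $\mathcal Crcdsup$ and all intermediate theories above $\mathcal Afrnz$; in particular $\mathcal Asrnz$, $\mathcal Codsup$, $\mathcal Co\text{-}$, which are intermediate. 4. On $(=0,\ge0,>0;+,\times,\vee,-,0,1)$: $\mathcal Asrnz$,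 $\mathcal Crcdsup$ and all intermediate theories above $\mathcal Asrnz$; in particular $\mathcal Co$, $\mathcal Codsup$, which are intermediate. 5. On $(=0,\ge0,>0;+,\times,\vee,-,\mathrm{Fr},0,1)$: $\mathcal Aftr$, $\mathcal Crcdsup_{\mathrm{Fr}}$ and all intermediate theories above $\mathcal Aftr$; in particular $\mathcal Co$, $\mathcal Codsup_{\mathrm{Fr}}$, which are intermediate. -/

import Mathlib

universe u v

/-! Finitary dynamical theories, dynamical proofs, and the theories of ordered rings, f-rings and
ordered fields written in subsignatures of
`(· = 0, · ≥ 0, · > 0 ; · + ·, · × ·, · ∨ ·, - ·, Fr(·,·), 0, 1)`. -/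

namespace DynTheory

/-- A one-sorted signature that contains `(· = 0, · ≥ 0 ; · + ·, · × ·, - ·, 0, 1)`.
The three fields tell which of `· > 0`, `· ∨ ·` and `Fr(·,·)` it contains besides. -/
structure Signature where
  pos : Bool
  sup : Bool
  frac : Bool

/-- Inclusion of signatures. -/
instance : LE Signature where
  le S S' := (S.pos = true → S'.pos = true) ∧ (S.sup = true → S'.sup = true) ∧
    (S.frac = true → S'.frac = true)

/-- Terms of the signature `S` with variables (or generators) in `V`. -/
inductive Term (S : Signature) (V : Type u) : Type u
  | var (x : V) : Term S V
  | zero : Term S V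
  | one : Term S V
  | add (s t : Term S V) : Term S V
  | mul (s t : Term S V) : Term S V
  | neg (t : Term S V) : Term S V
  | sup (h : S.sup = true) (s t : Term S V) : Term S V
  | frac (h : S.frac = true) (s t : Term S V) : Term S V

/-- Atomic formulas `t = 0`, `t ≥ 0` and, if the signature has the predicate, `t > 0`. -/
inductive Atom (S : Signature) (V : Type u) : Type u
  | isZero (t : Term S V) : Atom S V
  | nonneg (t : Term S V) : Atom S V
  | pos (h : S.pos = true) (t : Term S V) : Atom S V

section Operations

variable {S : Signature} {V : Type u} {W : Type v}

instance : Zero (Term S V) := ⟨Term.zero⟩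

instance : One (Term S V) := ⟨Term.one⟩

instance : Add (Term S V) := ⟨Term.add⟩

instance : Mul (Term S V) := ⟨Term.mul⟩

instance : Neg (Term S V) := ⟨Term.neg⟩

/-- `x - y` abbreviates `x + (-y)`. -/
instance : Sub (Term S V) := ⟨fun s t => s + -t⟩

/-- `t ^ n` abbreviates an iterated product. -/
def Term.pow (t : Term S V) : ℕ → Term S V
  | 0 => 1
  | n + 1 => Term.pow t n * t

instance : Pow (Term S V) ℕ := ⟨Term.pow⟩

/-- `c 0 + c 1 * t + ⋯ + c n * t ^ n` -/
def Term.polyEval (c : ℕ → Term S V) (t : Term S V) : ℕ → Term S V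
  | 0 => c 0
  | n + 1 => Term.polyEval c t n + c (n + 1) * t ^ (n + 1)

/-- `x ∧ y` abbreviates `-(-x ∨ -y)`. -/
def Term.inf (h : S.sup = true) (s t : Term S V) : Term S V := -(Term.sup h (-s) (-t))

/-- `|x|` abbreviates `x ∨ -x`. -/
def Term.abs (h : S.sup = true) (t : Term S V) : Term S V := Term.sup h t (-t)

/-- `x⁺` abbreviates `x ∨ 0`. -/
def Term.posPart (h : S.sup = true) (t : Term S V) : Term S V := Term.sup h t 0

/-- `x = y` abbreviates `x - y = 0`. -/
def Atom.eq (s t : Term S V) : Atom S V := Atom.isZero (s - t)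

/-- `x ≥ y` abbreviates `x - y ≥ 0`. -/
def Atom.ge (s t : Term S V) : Atom S V := Atom.nonneg (s - t)

/-- `x > y` abbreviates `x - y > 0`. -/
def Atom.gt (h : S.pos = true) (s t : Term S V) : Atom S V := Atom.pos h (s - t)

/-- Simultaneous substitution of terms for variables. -/
def Term.subst (σ : V → Term S W) : Term S V → Term S W
  | .var x => σ x
  | .zero => .zero
  | .one => .one
  | .add s t => .add (s.subst σ) (t.subst σ)
  | .mul s t => .mul (s.subst σ) (t.subst σ)
  | .neg t => .neg (t.subst σ)
  | .sup h s t => .sup h (s.subst σ) (t.subst σ)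
  | .frac h s t => .frac h (s.subst σ) (t.subst σ)

/-- Simultaneous substitution in an atomic formula. -/
def Atom.subst (σ : V → Term S W) : Atom S V → Atom S W
  | .isZero t => .isZero (t.subst σ)
  | .nonneg t => .nonneg (t.subst σ)
  | .pos h t => .pos h (t.subst σ)

/-- Renaming of variables. -/
def Atom.rename (f : V → W) : Atom S V → Atom S W := Atom.subst fun x => Term.var (f x)

/-- A term, read in a larger signature. -/
def Term.lift {S' : Signature} (h : S ≤ S') : Term S V → Term S' V
  | .var x => .var x
  | .zero => .zero
  | .one => .one
  | .add s t => .add (s.lift h) (t.lift h)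
  | .mul s t => .mul (s.lift h) (t.lift h)
  | .neg t => .neg (t.lift h)
  | .sup hs s t => .sup (h.2.1 hs) (s.lift h) (t.lift h)
  | .frac hf s t => .frac (h.2.2 hf) (s.lift h) (t.lift h)

/-- An atomic formula, read in a larger signature. -/
def Atom.lift {S' : Signature} (h : S ≤ S') : Atom S V → Atom S' V
  | .isZero t => .isZero (t.lift h)
  | .nonneg t => .nonneg (t.lift h)
  | .pos hp t => .pos (h.1 hp) (t.lift h)

/-- The polynomial with integer coefficients that a term represents; the variables and the subterms
`s ∨ t`, `Fr(s, t)` that are not inside another such subterm are its indeterminates. -/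
noncomputable def Term.toPoly : Term S V → MvPolynomial (Term S V) ℤ
  | .var x => MvPolynomial.X (.var x)
  | .zero => 0
  | .one => 1
  | .add s t => s.toPoly + t.toPoly
  | .mul s t => s.toPoly * t.toPoly
  | .neg t => -t.toPoly
  | .sup h s t => MvPolynomial.X (.sup h s t)
  | .frac h s t => MvPolynomial.X (.frac h s t)

end Operations

/-- `∃ y₁ … y_num, atoms`, with free variables in `V`. -/
structure ExConj (S : Signature) (V : Type u) where
  num : ℕ
  atoms : List (Atom S (V ⊕ Fin num))

/-- A dynamical rule `prem ⊢ concl₁ op ⋯ op concl_m` with free variables in `V`.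
The empty disjunction is `⊥`. -/
structure DynRule (S : Signature) (V : Type u) where
  prem : List (Atom S V)
  concl : List (ExConj S V)

section Rules

variable {S S' : Signature} {V : Type u} {W : Type v}

/-- Renaming of the free variables. -/
def ExConj.rename (f : V → W) (d : ExConj S V) : ExConj S W :=
  ⟨d.num, d.atoms.map (Atom.rename (Sum.map f id))⟩

def ExConj.lift (h : S ≤ S') (d : ExConj S V) : ExConj S' V :=
  ⟨d.num, d.atoms.map (Atom.lift h)⟩

/-- A dynamical rule, read in a larger signature. -/
def DynRule.lift (h : S ≤ S') (r : DynRule S V) : DynRule S' V :=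
  ⟨r.prem.map (Atom.lift h), r.concl.map (ExConj.lift h)⟩

/-- A Horn rule has neither `op` nor `∃` nor `⊥` on the right of `⊢`. -/
def DynRule.IsHorn (r : DynRule S V) : Prop :=
  ∃ Δ : List (Atom S (V ⊕ Fin 0)), r.concl = [⟨0, Δ⟩]

/-- The Horn rule `Γ ⊢ Δ`. -/
def horn (Γ Δ : List (Atom S V)) : DynRule S V := ⟨Γ, [⟨0, Δ.map (Atom.rename Sum.inl)⟩]⟩

/-- The disjunctive rule `Γ ⊢ A op B`. -/
def disj (Γ : List (Atom S V)) (A B : Atom S V) : DynRule S V :=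
  ⟨Γ, [⟨0, [A.rename Sum.inl]⟩, ⟨0, [B.rename Sum.inl]⟩]⟩

/-- The simple existential rule `Γ ⊢ ∃ y, Δ`; in `Δ` the variable `y` is `Sum.inr 0`. -/
def exist (Γ : List (Atom S V)) (Δ : List (Atom S (V ⊕ Fin 1))) : DynRule S V := ⟨Γ, [⟨1, Δ⟩]⟩

end Rules

/-- A dynamical theory on the signature `S`: a set of dynamical rules, its axioms.
The free variables of an axiom are natural numbers. -/
abbrev Theory (S : Signature) := Set (DynRule S ℕ)

/-- Dynamical proofs, as finite computation trees. At each node there is a stock `V` of variables and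
generators and a set `Γ` of known atomic formulas.
A node is a leaf if one of the disjuncts of the conclusion `C` is satisfied there by some terms.
Otherwise one applies an axiom to terms for which its premises are known, and opens one branch for
each disjunct of the axiom; in this branch fresh variables are introduced for the existential
variables, and the atomic formulas of the disjunct become known. -/
inductive Derives {S : Signature} (T : Theory S) :
    {V : Type u} → Set (Atom S V) → List (ExConj S V) → Prop
  | leaf {V : Type u} {Γ : Set (Atom S V)} {C : List (ExConj S V)} (d : ExConj S V) (hd : d ∈ C)
      (τ : Fin d.num → Term S V)
      (h : ∀ a ∈ d.atoms, a.subst (Sum.elim Term.var τ) ∈ Γ) :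
      Derives T Γ C
  | step {V : Type u} {Γ : Set (Atom S V)} {C : List (ExConj S V)} (r : DynRule S ℕ) (hr : r ∈ T)
      (σ : ℕ → Term S V)
      (hprem : ∀ a ∈ r.prem, a.subst σ ∈ Γ)
      (hbranch : ∀ d ∈ r.concl, Derives T (V := V ⊕ Fin d.num)
        (Atom.rename Sum.inl '' Γ ∪
          {b | ∃ a ∈ d.atoms, b = a.subst (Sum.elim
            (fun x => (σ x).subst fun w => Term.var (Sum.inl w))
            (fun y => Term.var (Sum.inr y)))})
        (C.map (ExConj.rename Sum.inl))) :
      Derives T Γ C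

section Validity

variable {S S' : Signature}

/-- The rule `r` is valid in the dynamical theory `T`. -/
def Theory.Proves (T : Theory S) {V : Type u} (r : DynRule S V) : Prop :=
  Derives T {a | a ∈ r.prem} r.concl

/-- The rule `r`, in which generators of `G` may occur as constants, is valid in the dynamic algebraic
structure of type `T` presented by the generators `G` and the relations `R`. -/
def Theory.PresProves (T : Theory S) {G : Type u} (R : Set (Atom S G)) (r : DynRule S (G ⊕ ℕ)) :
    Prop :=
  Derives T (Atom.rename Sum.inl '' R ∪ {a | a ∈ r.prem}) r.concl

/-- `T'` is an extension of `T`: its signature is larger and it proves the axioms of `T`. -/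
def Theory.Extends (T' : Theory S') (T : Theory S) : Prop :=
  ∃ h : S ≤ S', ∀ r ∈ T, T'.Proves (r.lift h)

/-- `T₁` and `T₂` prove the same Horn rules on the signature `S`, which is contained in both of
theirs: for every presentation `(G, R)` on `S`, the dynamic algebraic structures `((G, R), T₁)` and
`((G, R), T₂)` prove the same Horn rules. -/
def SameHorn (S : Signature) {S₁ S₂ : Signature} (T₁ : Theory S₁) (T₂ : Theory S₂) : Prop :=
  ∃ (h₁ : S ≤ S₁) (h₂ : S ≤ S₂), ∀ (G : Type u) (R : Set (Atom S G)) (r : DynRule S (G ⊕ ℕ)),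
    r.IsHorn → (T₁.PresProves (Atom.lift h₁ '' R) (r.lift h₁) ↔
      T₂.PresProves (Atom.lift h₂ '' R) (r.lift h₂))

end Validity

/-! ### Axioms -/

section Axioms

variable (S : Signature)

abbrev vx : Term S ℕ := Term.var 0

abbrev vy : Term S ℕ := Term.var 1

abbrev vz : Term S ℕ := Term.var 2

abbrev vw : Term S ℕ := Term.var 3

/-- The free variable number `i` in the conclusion of an existential rule. -/
abbrev fv (i : ℕ) : Term S (ℕ ⊕ Fin 1) := Term.var (Sum.inl i)

/-- The existential variable of an existential rule. -/
abbrev ev : Term S (ℕ ⊕ Fin 1) := Term.var (Sum.inr 0)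

/-- `⊢ 0 = 0` -/
def ga0 : DynRule S ℕ := horn [] [.isZero 0]

/-- `x = 0, y = 0 ⊢ x + y = 0` -/
def ga1 : DynRule S ℕ := horn [.isZero (vx S), .isZero (vy S)] [.isZero (vx S + vy S)]

/-- `x = 0 ⊢ x y = 0` -/
def ac2 : DynRule S ℕ := horn [.isZero (vx S)] [.isZero (vx S * vy S)]

/-- The computational machinery of commutative rings: `⊢ t = 0` for each term `t` that represents
the zero polynomial. -/
def ringComputation : Theory S := {r | ∃ t : Term S ℕ, t.toPoly = 0 ∧ r = horn [] [.isZero t]}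

/-- Substitution of equals in the predicates and under the function symbols `∨` and `Fr` (for the
ring operations it follows from the other rules). -/
def substitutionRules : Theory S :=
  {horn [.eq (vx S) (vy S), .isZero (vx S)] [.isZero (vy S)],
   horn [.eq (vx S) (vy S), .nonneg (vx S)] [.nonneg (vy S)]} ∪
  {r | ∃ h : S.pos = true, r = horn [.eq (vx S) (vy S), .pos h (vx S)] [.pos h (vy S)]} ∪
  {r | ∃ h : S.sup = true, r = horn [.eq (vx S) (vy S), .eq (vz S) (vw S)]
    [.eq (.sup h (vx S) (vz S)) (.sup h (vy S) (vw S))]} ∪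
  {r | ∃ h : S.frac = true, r = horn [.eq (vx S) (vy S), .eq (vz S) (vw S)]
    [.eq (.frac h (vx S) (vz S)) (.frac h (vy S) (vw S))]}

/-- `⊢ 0 ≥ 0` -/
def gao0 : DynRule S ℕ := horn [] [.nonneg 0]

/-- `x ≥ 0, y ≥ 0 ⊢ x + y ≥ 0` -/
def gao1 : DynRule S ℕ := horn [.nonneg (vx S), .nonneg (vy S)] [.nonneg (vx S + vy S)]

/-- `⊢ x² ≥ 0` -/
def ao1 : DynRule S ℕ := horn [] [.nonneg (vx S * vx S)]

/-- `x ≥ 0, y ≥ 0 ⊢ x y ≥ 0` -/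
def ao2 : DynRule S ℕ := horn [.nonneg (vx S), .nonneg (vy S)] [.nonneg (vx S * vy S)]

/-- `x ≥ 0, x ≤ 0 ⊢ x = 0` -/
def Gao : DynRule S ℕ := horn [.nonneg (vx S), .ge 0 (vx S)] [.isZero (vx S)]

/-- `x² = 0 ⊢ x = 0` -/
def Anz : DynRule S ℕ := horn [.isZero (vx S * vx S)] [.isZero (vx S)]

/-- `c ≥ 0, x (x² + c) ≥ 0 ⊢ x ≥ 0` -/
def AonzRule : DynRule S ℕ :=
  horn [.nonneg (vy S), .nonneg (vx S * (vx S * vx S + vy S))] [.nonneg (vx S)]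

/-- `⊢ x ≥ 0 op x ≤ 0` -/
def OT : DynRule S ℕ := disj [] (.nonneg (vx S)) (.ge 0 (vx S))

variable (hp : S.pos = true)

/-- `⊢ 1 > 0` -/
def aso1 : DynRule S ℕ := horn [] [.pos hp 1]

/-- `x > 0 ⊢ x ≥ 0` -/
def aso2 : DynRule S ℕ := horn [.pos hp (vx S)] [.nonneg (vx S)]

/-- `x > 0, y ≥ 0 ⊢ x + y > 0` -/
def aso3 : DynRule S ℕ := horn [.pos hp (vx S), .nonneg (vy S)] [.pos hp (vx S + vy S)]

/-- `x > 0, y > 0 ⊢ x y > 0` -/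
def aso4 : DynRule S ℕ := horn [.pos hp (vx S), .pos hp (vy S)] [.pos hp (vx S * vy S)]

/-- `0 > 0 ⊢ 1 = 0` -/
def col : DynRule S ℕ := horn [.pos hp 0] [.isZero 1]

/-- `x y = 1 ⊢ x² > 0` -/
def Iv : DynRule S ℕ := horn [.eq (vx S * vy S) 1] [.pos hp (vx S * vx S)]

/-- `x > 0, x y ≥ 0 ⊢ y ≥ 0` -/
def Aso1 : DynRule S ℕ := horn [.pos hp (vx S), .nonneg (vx S * vy S)] [.nonneg (vy S)]

/-- `x ≥ 0, x y > 0 ⊢ y > 0` -/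
def Aso2 : DynRule S ℕ := horn [.nonneg (vx S), .pos hp (vx S * vy S)] [.pos hp (vy S)]

/-- `x² > 0 ⊢ ∃ y, x y = 1` -/
def IVne : DynRule S ℕ := exist [.pos hp (vx S * vx S)] [.eq (fv S 0 * ev S) 1]

/-- `x > 0 ⊢ ∃ y, x y = 1` -/
def IVpos : DynRule S ℕ := exist [.pos hp (vx S)] [.eq (fv S 0 * ev S) 1]

/-- `⊢ x = 0 op x² > 0` -/
def ED : DynRule S ℕ := disj [] (.isZero (vx S)) (.pos hp (vx S * vx S))

/-- `x + y > 0 ⊢ x > 0 op y > 0` -/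
def OTF : DynRule S ℕ := disj [.pos hp (vx S + vy S)] (.pos hp (vx S)) (.pos hp (vy S))

/-- `a < b, P(a) P(b) < 0 ⊢ ∃ x, (P(x) = 0, a < x < b)` where `P(x) = a₀ + a₁ x + ⋯ + aₙ xⁿ`.
The variables `a`, `b`, `aₖ` have the numbers `0`, `1`, `k + 2`. -/
def RCF (n : ℕ) : DynRule S ℕ :=
  exist
    [.gt hp (vy S) (vx S),
     .gt hp 0 (Term.polyEval (fun k => Term.var (k + 2)) (vx S) n *
       Term.polyEval (fun k => Term.var (k + 2)) (vy S) n)]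
    [.isZero (Term.polyEval (fun k => fv S (k + 2)) (ev S) n),
     .gt hp (ev S) (fv S 0), .gt hp (fv S 1) (ev S)]

variable (hs : S.sup = true)

/-- `⊢ x ∨ y ≥ x` -/
def sup1 : DynRule S ℕ := horn [] [.ge (.sup hs (vx S) (vy S)) (vx S)]

/-- `⊢ x ∨ y ≥ y` -/
def sup2 : DynRule S ℕ := horn [] [.ge (.sup hs (vx S) (vy S)) (vy S)]

/-- `z ≥ x, z ≥ y ⊢ z ≥ x ∨ y` -/
def Sup : DynRule S ℕ :=
  horn [.ge (vz S) (vx S), .ge (vz S) (vy S)] [.ge (vz S) (.sup hs (vx S) (vy S))]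

/-- `x = 0, y = 0 ⊢ (z + x) ∨ (w + y) = z ∨ w` -/
def supEq : DynRule S ℕ :=
  horn [.isZero (vx S), .isZero (vy S)]
    [.eq (.sup hs (vz S + vx S) (vw S + vy S)) (.sup hs (vz S) (vw S))]

/-- `⊢ x ∨ x = x` -/
def sdt1 : DynRule S ℕ := horn [] [.eq (.sup hs (vx S) (vx S)) (vx S)]

/-- `⊢ x ∨ y = y ∨ x` -/
def sdt2 : DynRule S ℕ := horn [] [.eq (.sup hs (vx S) (vy S)) (.sup hs (vy S) (vx S))]

/-- `⊢ (x ∨ y) ∨ z = x ∨ (y ∨ z)` -/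
def sdt3 : DynRule S ℕ :=
  horn [] [.eq (.sup hs (.sup hs (vx S) (vy S)) (vz S)) (.sup hs (vx S) (.sup hs (vy S) (vz S)))]

/-- `⊢ x + (y ∨ z) = (x + y) ∨ (x + z)` -/
def grl : DynRule S ℕ :=
  horn [] [.eq (vx S + .sup hs (vy S) (vz S)) (.sup hs (vx S + vy S) (vx S + vz S))]

/-- `⊢ x⁺ (y ∨ z) = (x⁺ y) ∨ (x⁺ z)` -/
def afr : DynRule S ℕ :=
  horn [] [.eq ((vx S).posPart hs * .sup hs (vy S) (vz S))
    (.sup hs ((vx S).posPart hs * vy S) ((vx S).posPart hs * vz S))]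

variable (hf : S.frac = true)

/-- `⊢ Fr(x, y) |y| = (|x| ∧ |y|)²` -/
def fr1 : DynRule S ℕ :=
  horn [] [.eq (.frac hf (vx S) (vy S) * (vy S).abs hs)
    (Term.inf hs ((vx S).abs hs) ((vy S).abs hs) * Term.inf hs ((vx S).abs hs) ((vy S).abs hs))]

/-- `⊢ 0 ≤ Fr(x, y) ≤ |x| ∧ |y|` -/
def fr2 : DynRule S ℕ :=
  horn [] [.ge (.frac hf (vx S) (vy S)) 0,
    .ge (Term.inf hs ((vx S).abs hs) ((vy S).abs hs)) (.frac hf (vx S) (vy S))]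

end Axioms

/-! ### Theories -/

section Theories

variable (S : Signature)

/-- Commutative rings. -/
def Ac : Theory S := ringComputation S ∪ substitutionRules S ∪ {ga0 S, ga1 S, ac2 S}

/-- Preordered rings. -/
def Apo : Theory S := Ac S ∪ {gao0 S, gao1 S, ao1 S, ao2 S}

/-- Ordered rings. -/
def Ao : Theory S := Apo S ∪ {Gao S}

/-- Strictly reduced ordered rings. -/
def Aonz : Theory S := Ao S ∪ {AonzRule S}

/-- Linearly ordered rings. -/
def Ato : Theory S := Ao S ∪ {OT S}

/-- Reduced linearly ordered rings. -/
def Atonz : Theory S := Ato S ∪ {Anz S}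

variable (hp : S.pos = true)

/-- Proto-ordered rings. -/
def Apro : Theory S := Apo S ∪ {aso1 S hp, aso2 S hp, aso3 S hp, aso4 S hp, col S hp}

/-- Strictly ordered rings. -/
def Aso : Theory S := Apro S hp ∪ {Gao S, Aso1 S hp, Aso2 S hp}

/-- Reduced strictly ordered rings. -/
def Asonz : Theory S := Aso S hp ∪ {AonzRule S}

/-- Discrete ordered fields. -/
def Cod : Theory S := Apro S hp ∪ {Gao S, Iv S hp, IVne S hp, OT S, ED S hp}

/-- Discrete real closed fields. -/
def Crcd : Theory S := Cod S hp ∪ {r | ∃ n : ℕ, r = RCF S hp n}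

variable (hs : S.sup = true)

/-- Discrete ordered fields with sup. -/
def Codsup : Theory S := Cod S hp ∪ {sup1 S hs, sup2 S hs, Sup S hs}

/-- Discrete real closed fields with sup. -/
def Crcdsup : Theory S := Crcd S hp ∪ {sup1 S hs, sup2 S hs, Sup S hs}

/-- f-rings. The last two rules define `x ≥ 0` as an abbreviation of `x ∨ 0 = x`. -/
def Afr : Theory S :=
  Ac S ∪ {supEq S hs, sdt1 S hs, sdt2 S hs, sdt3 S hs, grl S hs, afr S hs} ∪
    {horn [.nonneg (vx S)] [.eq (.sup hs (vx S) 0) (vx S)],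
     horn [.eq (.sup hs (vx S) 0) (vx S)] [.nonneg (vx S)]}

/-- Reduced f-rings. -/
def Afrnz : Theory S := Afr S hs ∪ {Anz S}

/-- Strict f-rings. -/
def Asr : Theory S :=
  Afr S hs ∪
    {aso1 S hp, aso2 S hp, aso3 S hp, aso4 S hp, col S hp, Iv S hp, Aso1 S hp, Aso2 S hp} ∪
    {sup1 S hs, sup2 S hs, Sup S hs}

/-- Reduced strict f-rings. -/
def Asrnz : Theory S := Asr S hp hs ∪ {Anz S}

/-- The minimal theory of non discrete ordered fields. -/
def CoMinus : Theory S :=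
  Asonz S hp ∪ {Iv S hp, Anz S, IVpos S hp, OTF S hp} ∪
    {sup1 S hs, sup2 S hs, Sup S hs, grl S hs, afr S hs}

variable (hf : S.frac = true)

/-- Strongly real rings. The three rules in the middle define `x > 0` as an abbreviation of
`x ≥ 0 ∧ ∃ z, x z = 1`. -/
def Aftr : Theory S :=
  Afrnz S hs ∪
    {aso2 S hp, IVpos S hp, horn [.nonneg (vx S), .eq (vx S * vz S) 1] [.pos hp (vx S)]} ∪
    {fr1 S hs hf, fr2 S hs hf}

/-- Non discrete ordered fields. -/
def Co : Theory S := CoMinus S hp hs ∪ {fr1 S hs hf, fr2 S hs hf}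

/-- Discrete ordered fields with sup and with the function symbol `Fr`. -/
def CodsupFr : Theory S := Codsup S hp hs ∪ {fr1 S hs hf, fr2 S hs hf}

/-- Discrete real closed fields with sup and with the function symbol `Fr`. -/
def CrcdsupFr : Theory S := Crcdsup S hp hs ∪ {fr1 S hs hf, fr2 S hs hf}

end Theories

/-! ### The five signatures -/

/-- `(· = 0, · ≥ 0 ; +, ×, -, 0, 1)` -/
abbrev sigAo : Signature := ⟨false, false, false⟩

/-- `(· = 0, · ≥ 0, · > 0 ; +, ×, -, 0, 1)` -/
abbrev sigAso : Signature := ⟨true, false, false⟩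

/-- `(· = 0, · ≥ 0 ; +, ×, ∨, -, 0, 1)` -/
abbrev sigAfr : Signature := ⟨false, true, false⟩

/-- `(· = 0, · ≥ 0, · > 0 ; +, ×, ∨, -, 0, 1)` -/
abbrev sigAsr : Signature := ⟨true, true, false⟩

/-- `(· = 0, · ≥ 0, · > 0 ; +, ×, ∨, -, Fr, 0, 1)` -/
abbrev sigCo : Signature := ⟨true, true, true⟩

/-- `T` is intermediate between `W` and the theory of discrete real closed fields with sup (to which
the function symbol `Fr` has been added, so that the language of `T` may contain `Fr`). -/
def IsIntermediate {S S' : Signature} (W : Theory S) (T : Theory S') : Prop :=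
  T.Extends W ∧ (CrcdsupFr sigCo rfl rfl rfl).Extends T

end DynTheory

open DynTheory

-- Let `W` be one of the five weak theories and `T` intermediate above it. Replacing axioms by their
-- proofs turns a derivation in `W` into one in `T`, and then into one in real closed fields with
-- `∨` and `Fr` (`Derives.lift`). The latter theory is sound in every ordered field with the
-- intermediate value property for polynomials (`Derives.sound`, `realInterp_valid`). So everything
-- reduces to one completeness statement: a Horn rule true in all these fields is derivable in `W`
-- (`Derives.of_real`).
--
-- Suppose the rule is not derivable. By Zorn's lemma the known atoms extend to a maximal stock that
-- still does not derive the conclusion, and maximality closes it under all provable rules without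
-- existential variables (`Derives.exists_saturated`). Terms modulo provable equality form a
-- commutative ring in which the stock is exactly the set of true atoms, so some atom of the
-- conclusion fails there (`Derives.exists_interp`). Existential axioms need not hold in this ring.
-- This matters only for strongly real rings, where `x > 0` means invertibility: their rules for
-- strict inequality are derived inside the theory, after adjoining the inverses involved
-- (`Derives.of_valid_of_inverses`).
--
-- The failing atom is then refuted by a homomorphism to an ordered field, through a formal
-- Positivstellensatz. A cone containing a monoid `M` and disjoint from `-M` lies in a prime cone
-- disjoint from `-M` (`IsCone.exists_isPrimeCone`), and a proper prime cone comes from a map to an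
-- ordered field with the intermediate value property (`IsPrimeCone.exists_hom`). The obstruction to
-- making `t` negative is an identity `t q = s t^(2m) + d`, from which the rule Aonz deduces `t ≥ 0`
-- (`IsCone.mem_of_certificate`). The obstruction to making `t` nonpositive is `q t = s + p`, from
-- which Aso2 deduces `t > 0`. Compatibility with `∨` and `Fr` is automatic: in a reduced f-ring `(x
-- ∨ y - x)(x ∨ y - y) = 0`, which in a field forces `x ∨ y` to be the maximum, and the axioms of
-- `Fr` then determine its value (`Interp.IsGood.isRealPoint`).
--
-- The real closure is a maximal ordered subfield of an algebraic closure. It has the intermediate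
-- value property because an order extends to the root field of an irreducible polynomial that
-- changes sign, by descent on the degree (`not_dvd_one_add_of_mem_weightedSquares`).

universe w

namespace DynTheory

/-! ### Substitution, cut and transfer for dynamical proofs -/

section Substitution

variable {S S' : Signature} {V : Type u} {W : Type v} {X : Type w}

theorem Term.subst_subst (σ : V → Term S W) (τ : W → Term S X) (t : Term S V) :
    (t.subst σ).subst τ = t.subst fun x => (σ x).subst τ := by
  induction t <;> simp_all [Term.subst]

theorem Term.subst_var (t : Term S V) : t.subst Term.var = t := by
  induction t <;> simp_all [Term.subst]

theorem Atom.subst_subst (σ : V → Term S W) (τ : W → Term S X) (a : Atom S V) :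
    (a.subst σ).subst τ = a.subst fun x => (σ x).subst τ := by
  cases a <;> simp [Atom.subst, Term.subst_subst]

theorem Atom.subst_var (a : Atom S V) : a.subst Term.var = a := by
  cases a <;> simp [Atom.subst, Term.subst_var]

theorem Term.lift_subst (h : S ≤ S') (σ : V → Term S W) (t : Term S V) :
    (t.subst σ).lift h = (t.lift h).subst fun x => (σ x).lift h := by
  induction t <;> simp_all [Term.subst, Term.lift]

theorem Atom.lift_subst (h : S ≤ S') (σ : V → Term S W) (a : Atom S V) :
    (a.subst σ).lift h = (a.lift h).subst fun x => (σ x).lift h := by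
  cases a <;> simp [Atom.subst, Atom.lift, Term.lift_subst]

theorem Term.lift_refl (h : S ≤ S) (t : Term S V) : t.lift h = t := by
  induction t <;> simp_all [Term.lift]

theorem Atom.lift_refl (h : S ≤ S) (a : Atom S V) : a.lift h = a := by
  cases a <;> simp [Atom.lift, Term.lift_refl]

/-- A substitution, extended by the identity on fresh variables. -/
def extendSubst (σ : V → Term S W) (n : ℕ) : V ⊕ Fin n → Term S (W ⊕ Fin n) :=
  Sum.elim (fun x => (σ x).subst fun w => Term.var (Sum.inl w)) fun y => Term.var (Sum.inr y)

/-- Simultaneous substitution for the free variables. -/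
def ExConj.subst (σ : V → Term S W) (d : ExConj S V) : ExConj S W :=
  ⟨d.num, d.atoms.map (Atom.subst (extendSubst σ d.num))⟩

theorem extendSubst_subst (σ : V → Term S W) (τ : W → Term S X) (n : ℕ) :
    (fun x => (extendSubst σ n x).subst (extendSubst τ n)) =
      extendSubst (fun x => (σ x).subst τ) n := by
  funext x
  cases x <;> simp [extendSubst, Term.subst_subst, Term.subst]

theorem extendSubst_lift (h : S ≤ S') (σ : V → Term S W) (n : ℕ) :
    (fun x => (extendSubst σ n x).lift h) = extendSubst (fun x => (σ x).lift h) n := by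
  funext x
  cases x
  · simp only [extendSubst, Sum.elim_inl, Term.lift_subst]; rfl
  · rfl

theorem ExConj.rename_eq_subst (f : V → W) (d : ExConj S V) :
    d.rename f = d.subst fun x => Term.var (f x) := by
  simp only [ExConj.rename, ExConj.subst, Atom.rename]
  congr 3
  funext x
  cases x <;> rfl

theorem ExConj.subst_subst (σ : V → Term S W) (τ : W → Term S X) (d : ExConj S V) :
    (d.subst σ).subst τ = d.subst fun x => (σ x).subst τ := by
  simp only [ExConj.subst, List.map_map]
  congr 2
  funext a
  simp only [Function.comp, Atom.subst_subst, extendSubst_subst]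

theorem ExConj.subst_var (d : ExConj S V) : d.subst Term.var = d := by
  have : extendSubst (S := S) (Term.var (V := V)) d.num = Term.var := by
    funext x
    cases x <;> rfl
  obtain ⟨n, l⟩ := d
  simp only [ExConj.subst] at this ⊢
  rw [this, List.map_id'' Atom.subst_var]

theorem ExConj.lift_subst (h : S ≤ S') (σ : V → Term S W) (d : ExConj S V) :
    (d.subst σ).lift h = (d.lift h).subst fun x => (σ x).lift h := by
  simp only [ExConj.subst, ExConj.lift, List.map_map]
  congr 2
  funext a
  simp only [Function.comp, Atom.lift_subst, extendSubst_lift]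

theorem ExConj.lift_refl (h : S ≤ S) (d : ExConj S V) : d.lift h = d := by
  rw [ExConj.lift, List.map_id'' (Atom.lift_refl h)]

end Substitution

/-! ### Weakening, cut, change of theory and saturation of dynamical proofs. -/

section Derivations

variable {S S' : Signature}

/-- The atomic formulas of the stock at the branch opened by the disjunct `d`. -/
theorem Derives.branch_eq {V : Type u} (σ : ℕ → Term S V) (d : ExConj S ℕ) :
    {b | ∃ a ∈ d.atoms, b = a.subst (Sum.elim
            (fun x => (σ x).subst fun w => Term.var (Sum.inl w))
            (fun y => Term.var (Sum.inr y)))} =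
      {b | b ∈ d.atoms.map (Atom.subst (extendSubst σ d.num))} := by
  ext b
  refine ⟨?_, fun h => ?_⟩
  · rintro ⟨a, ha, rfl⟩
    exact List.mem_map_of_mem ha
  · obtain ⟨a, ha, rfl⟩ := List.mem_map.1 h
    exact ⟨a, ha, rfl⟩

/-- Substitution and weakening. -/
theorem Derives.subst {T : Theory S} {V : Type u} {Γ : Set (Atom S V)} {C : List (ExConj S V)}
    (hd : Derives T Γ C) {W : Type v} (σ : V → Term S W) {Γ' : Set (Atom S W)}
    {C' : List (ExConj S W)} (hΓ : ∀ a ∈ Γ, a.subst σ ∈ Γ') (hC : ∀ d ∈ C, d.subst σ ∈ C') :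
    Derives T Γ' C' := by
  induction hd generalizing W with
  | leaf d hd τ h =>
    refine .leaf (d.subst σ) (hC d hd) (fun i : Fin d.num => (τ i).subst σ) fun b hb => ?_
    obtain ⟨a, ha, rfl⟩ := List.mem_map.1 hb
    have := hΓ _ (h a ha)
    rw [Atom.subst_subst] at this
    change Atom.subst (Sum.elim Term.var fun i : Fin d.num => (τ i).subst σ)
      (a.subst (extendSubst σ d.num)) ∈ Γ'
    rw [Atom.subst_subst]
    convert this using 2
    funext x
    cases x
    · simp only [extendSubst, Sum.elim_inl, Term.subst_subst, Term.subst]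
      exact Term.subst_var _
    · rfl
  | step r hr τ hprem hbranch ih =>
    refine .step r hr (fun n => (τ n).subst σ) (fun a ha => ?_) fun d hd => ?_
    · rw [← Atom.subst_subst]
      exact hΓ _ (hprem a ha)
    · refine ih d hd (extendSubst σ d.num) ?_ ?_
      · rw [Derives.branch_eq, Derives.branch_eq]
        rintro a (⟨a, ha, rfl⟩ | ha)
        · refine .inl ⟨_, hΓ a ha, ?_⟩
          simp only [Atom.rename, Atom.subst_subst]
          rfl
        · refine .inr ?_
          obtain ⟨b, hb, rfl⟩ := List.mem_map.1 ha
          refine List.mem_map.2 ⟨b, hb, ?_⟩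
          rw [Atom.subst_subst, extendSubst_subst]
      · intro c' hc'
        obtain ⟨c, hc, rfl⟩ := List.mem_map.1 hc'
        refine List.mem_map.2 ⟨_, hC c hc, ?_⟩
        simp only [ExConj.rename_eq_subst, ExConj.subst_subst]
        rfl

theorem Derives.mono {T : Theory S} {V : Type u} {Γ Γ' : Set (Atom S V)} {C C' : List (ExConj S V)}
    (hd : Derives T Γ C) (hΓ : Γ ⊆ Γ') (hC : C ⊆ C') : Derives T Γ' C' :=
  hd.subst Term.var (fun a ha => by rw [Atom.subst_var]; exact hΓ ha)
    fun d hd => by rw [ExConj.subst_var]; exact hC hd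

/-- The cut rule. -/
theorem Derives.cut {T : Theory S} {V : Type u} {Γ : Set (Atom S V)} {D : List (ExConj S V)}
    (hD : Derives T Γ D) {C : List (ExConj S V)}
    (h : ∀ d ∈ D, Derives T (Atom.rename Sum.inl '' Γ ∪ {b | b ∈ d.atoms})
      (C.map (ExConj.rename Sum.inl))) : Derives T Γ C := by
  induction hD with
  | leaf d hd τ hτ =>
    -- At a leaf the cut is a substitution: the terms that satisfy `d` replace its existential
    -- variables in the proof of `C`.
    refine (h d hd).subst (Sum.elim Term.var τ) ?_ ?_
    · rintro a (⟨a, ha, rfl⟩ | ha)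
      · rw [Atom.rename, Atom.subst_subst]
        simp only [Term.subst, Sum.elim_inl]
        rwa [Atom.subst_var]
      · exact hτ a ha
    · intro c' hc'
      obtain ⟨c, hc, rfl⟩ := List.mem_map.1 hc'
      rw [ExConj.rename_eq_subst, ExConj.subst_subst]
      simp only [Term.subst, Sum.elim_inl]
      rwa [ExConj.subst_var]
  | step r hr σ hprem hbranch ih =>
    refine .step r hr σ hprem fun d hd => ih d hd fun e' he' => ?_
    obtain ⟨e, he, rfl⟩ := List.mem_map.1 he'
    refine (h e he).subst (fun x => Term.var (Sum.map Sum.inl id x)) ?_ ?_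
    · rintro a (⟨a, ha, rfl⟩ | ha)
      · refine .inl ⟨_, .inl ⟨a, ha, rfl⟩, ?_⟩
        simp only [Atom.rename, Atom.subst_subst]
        rfl
      · exact .inr (List.mem_map_of_mem (f := Atom.rename (Sum.map Sum.inl id)) ha)
    · intro c' hc'
      obtain ⟨c, hc, rfl⟩ := List.mem_map.1 hc'
      rw [List.map_map]
      refine List.mem_map.2 ⟨c, hc, ?_⟩
      simp only [Function.comp, ExConj.rename_eq_subst, ExConj.subst_subst]
      rfl

/-- A dynamical proof in `T` is one in any theory that proves the axioms of `T`. -/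
theorem Derives.lift {T : Theory S} {T' : Theory S'} (hS : S ≤ S')
    (hT : ∀ r ∈ T, T'.Proves (r.lift hS)) {V : Type u} {Γ : Set (Atom S V)}
    {C : List (ExConj S V)} (hd : Derives T Γ C) :
    Derives T' (Atom.lift hS '' Γ) (C.map (ExConj.lift hS)) := by
  induction hd with
  | leaf d hd τ h =>
    refine .leaf (d.lift hS) (List.mem_map_of_mem hd) (fun i : Fin d.num => (τ i).lift hS)
      fun b hb => ?_
    obtain ⟨a, ha, rfl⟩ := List.mem_map.1 hb
    refine ⟨_, h a ha, ?_⟩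
    rw [Atom.lift_subst]
    congr 1
    funext x
    cases x <;> rfl
  | @step V Γ C r hr σ hprem hbranch ih =>
    -- The axiom is replaced by an instance of its `T'`-proof; a cut against that instance opens the
    -- same branches as the original step.
    have key : Derives T' (Atom.lift hS '' Γ)
        ((r.lift hS).concl.map (ExConj.subst fun n => (σ n).lift hS)) := by
      refine (hT r hr).subst (fun n => (σ n).lift hS) ?_ fun d hd => List.mem_map_of_mem hd
      intro b hb
      obtain ⟨a, ha, rfl⟩ := List.mem_map.1 hb
      exact ⟨_, hprem a ha, Atom.lift_subst hS σ a⟩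
    refine key.cut fun d₂ hd₂ => ?_
    obtain ⟨d₁, hd₁, rfl⟩ := List.mem_map.1 hd₂
    obtain ⟨d, hd, rfl⟩ := List.mem_map.1 hd₁
    refine (ih d hd).mono ?_ ?_
    · rw [Derives.branch_eq]
      rintro a ⟨a, ⟨a, ha, rfl⟩ | ha, rfl⟩
      · refine .inl ⟨_, ⟨a, ha, rfl⟩, ?_⟩
        rw [Atom.rename, Atom.rename, Atom.lift_subst]
        rfl
      · obtain ⟨b, hb, rfl⟩ := List.mem_map.1 ha
        refine .inr (List.mem_map.2 ⟨_, List.mem_map_of_mem hb, ?_⟩)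
        rw [Atom.lift_subst, extendSubst_lift]
        rfl
    · intro c' hc'
      rw [List.map_map] at hc'
      obtain ⟨c, hc, rfl⟩ := List.mem_map.1 hc'
      refine List.mem_map.2 ⟨_, List.mem_map_of_mem hc, ?_⟩
      simp only [Function.comp, ExConj.rename_eq_subst, ExConj.lift_subst]
      rfl

theorem Theory.proves_of_mem {T : Theory S} {r : DynRule S ℕ} (hr : r ∈ T) : T.Proves r := by
  refine .step r hr Term.var (fun a ha => by rwa [Atom.subst_var]) fun d hd => ?_
  refine .leaf (d.rename Sum.inl) (List.mem_map_of_mem hd)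
    (fun y : Fin d.num => Term.var (Sum.inr y)) fun b hb => ?_
  rw [Derives.branch_eq]
  obtain ⟨a, ha, rfl⟩ := List.mem_map.1 hb
  refine .inr (List.mem_map.2 ⟨a, ha, ?_⟩)
  change _ = (a.rename (Sum.map Sum.inl id)).subst
    (Sum.elim Term.var fun y : Fin d.num => Term.var (Sum.inr y))
  rw [Atom.rename, Atom.subst_subst]
  congr 1
  funext x
  cases x <;> rfl

/-- A proof tree is finite and uses finitely many known atoms. This is what lets underivability pass
to unions of chains in Zorn's lemma. -/
theorem Derives.finite_support {T : Theory S} {V : Type u} {Γ : Set (Atom S V)}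
    {C : List (ExConj S V)} (hd : Derives T Γ C) : ∃ Γ₀ ⊆ Γ, Γ₀.Finite ∧ Derives T Γ₀ C := by
  induction hd with
  | leaf d hd τ h =>
    refine ⟨{b | ∃ a ∈ d.atoms, a.subst (Sum.elim Term.var τ) = b}, ?_, ?_,
      .leaf d hd τ fun a ha => ⟨a, ha, rfl⟩⟩
    · rintro _ ⟨a, ha, rfl⟩
      exact h a ha
    · exact (List.finite_toSet d.atoms).image _
  | @step V Γ C r hr σ hprem hbranch ih =>
    choose! f hsub hfin hder using ih
    have hpre : ∀ d ∈ r.concl, ∃ Δ ⊆ Γ, Δ.Finite ∧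
        f d ⊆ Atom.rename Sum.inl '' Δ ∪ 
          {b | b ∈ d.atoms.map (Atom.subst (extendSubst σ d.num))} := by
      intro d hd
      have h1 := hsub d hd
      rw [Derives.branch_eq] at h1
      -- The support of a branch mixes renamed old atoms with the new atoms of `d`; only the former
      -- have to be traced back to `Γ`.
      obtain ⟨Δ, hΔ, hfinΔ, he⟩ := Set.exists_subset_image_finite_and
        (p := fun s => s = f d ∩ Atom.rename Sum.inl '' Γ).1
        ⟨_, Set.inter_subset_right, (hfin d hd).subset Set.inter_subset_left, rfl⟩
      refine ⟨Δ, hΔ, hfinΔ, fun a ha => ?_⟩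
      rcases h1 ha with h2 | h2
      · left
        rw [he]
        exact ⟨ha, h2⟩
      · exact .inr h2
    choose! g hg hgfin hfg using hpre
    refine ⟨(Atom.subst σ '' {a | a ∈ r.prem}) ∪ ⋃ d ∈ {d | d ∈ r.concl}, g d, ?_, ?_, ?_⟩
    · refine Set.union_subset ?_ (Set.iUnion₂_subset fun d hd => hg d hd)
      rintro _ ⟨a, ha, rfl⟩
      exact hprem a ha
    · refine Set.Finite.union ((List.finite_toSet r.prem).image _) ?_
      exact (List.finite_toSet r.concl).biUnion fun d hd => hgfin d hd
    · refine .step r hr σ (fun a ha => .inl ⟨a, ha, rfl⟩) fun d hd => ?_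
      refine (hder d hd).mono ?_ (List.Subset.refl _)
      rw [Derives.branch_eq]
      refine (hfg d hd).trans (Set.union_subset_union_left _ (Set.image_mono ?_))
      exact (Set.subset_biUnion_of_mem (u := g) (show d ∈ {d | d ∈ r.concl} from hd)).trans
        Set.subset_union_right

/-- The rule has no existential variables. -/
def DynRule.ExistFree {V : Type u} (r : DynRule S V) : Prop := ∀ d ∈ r.concl, d.num = 0

/-- A stock of atomic formulas that does not derive `C` extends to a maximal one, which is closed
under all rules without existential variables that the theory proves. -/
theorem Derives.exists_saturated {T : Theory S} {V : Type u} {Γ : Set (Atom S V)}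
    {C : List (ExConj S V)} (hd : ¬ Derives T Γ C) :
    ∃ Δ : Set (Atom S V), Γ ⊆ Δ ∧ ¬ Derives T Δ C ∧
      ∀ r : DynRule S ℕ, T.Proves r → r.ExistFree → ∀ σ : ℕ → Term S V,
        (∀ a ∈ r.prem, a.subst σ ∈ Δ) →
        ∃ d ∈ r.concl, ∀ a ∈ d.atoms, ∀ τ, a.subst (Sum.elim σ τ) ∈ Δ := by
  obtain ⟨Δ, hΓΔ, hmax⟩ := zorn_subset_nonempty {Δ : Set (Atom S V) | ¬ Derives T Δ C} (by
    intro c hc hchain hne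
    refine ⟨⋃₀ c, fun hder => ?_, fun s hs => Set.subset_sUnion_of_mem hs⟩
    obtain ⟨Γ₀, hsub, hfin, hder⟩ := hder.finite_support
    obtain ⟨s, hs, hsub⟩ := DirectedOn.exists_mem_subset_of_finite_of_subset_sUnion
      hne hchain.directedOn hfin hsub
    exact hc hs (hder.mono hsub (List.Subset.refl _))) Γ hd
  refine ⟨Δ, hΓΔ, hmax.prop, fun r hr hfree σ hprem => ?_⟩
  -- If each disjunct had an atom missing from `Δ`, then by maximality adding that atom would derive
  -- `C`. A cut against the instantiated rule would then derive `C` from `Δ` itself.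
  by_contra! hcon
  apply hmax.prop
  have key : Derives T Δ (r.concl.map (ExConj.subst σ)) :=
    Derives.subst hr σ hprem fun d hd => List.mem_map_of_mem hd
  refine key.cut fun d' hd' => ?_
  obtain ⟨d, hd, rfl⟩ := List.mem_map.1 hd'
  obtain ⟨a, ha, τ, hτ⟩ := hcon d hd
  have hnum := hfree d hd
  have hder : Derives T (insert (a.subst (Sum.elim σ τ)) Δ) C := by
    by_contra hn
    exact hτ (hmax.le_of_ge hn (Set.subset_insert _ _) (Set.mem_insert _ _))
  refine hder.subst (fun x => Term.var (Sum.inl x)) ?_ ?_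
  · rintro b (rfl | hb)
    · refine .inr (List.mem_map.2 ⟨a, ha, ?_⟩)
      rw [Atom.subst_subst]
      congr 1
      funext x
      rcases x with x | y
      · rfl
      · exact absurd y.2 (by omega)
    · exact .inl ⟨b, hb, rfl⟩
  · intro c hc
    exact List.mem_map.2 ⟨c, hc, ExConj.rename_eq_subst _ _⟩

end Derivations

/-! ### Interpretations in commutative rings -/

/-- An interpretation, in a commutative ring, of the symbols `∨`, `Fr`, `≥ 0`, `> 0`. -/
structure Interp (A : Type v) where
  sup : A → A → A
  frac : A → A → A
  nonneg : Set A
  pos : Set A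

section Semantics

variable {S S' : Signature} {V : Type u} {W : Type w} {A : Type v} [CommRing A] (I : Interp A)

/-- The value of a term. -/
def Term.eval (ν : V → A) : Term S V → A
  | .var x => ν x
  | .zero => 0
  | .one => 1
  | .add s t => s.eval ν + t.eval ν
  | .mul s t => s.eval ν * t.eval ν
  | .neg t => -t.eval ν
  | .sup _ s t => I.sup (s.eval ν) (t.eval ν)
  | .frac _ s t => I.frac (s.eval ν) (t.eval ν)

/-- Truth of an atomic formula. -/
def Atom.Holds (ν : V → A) : Atom S V → Prop
  | .isZero t => t.eval I ν = 0
  | .nonneg t => t.eval I ν ∈ I.nonneg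
  | .pos _ t => t.eval I ν ∈ I.pos

/-- Truth of an existential formula. -/
def ExConj.Holds (ν : V → A) (d : ExConj S V) : Prop :=
  ∃ τ : Fin d.num → A, ∀ a ∈ d.atoms, a.Holds I (Sum.elim ν τ)

/-- Validity of a dynamical rule. -/
def DynRule.Valid (r : DynRule S V) : Prop :=
  ∀ ν : V → A, (∀ a ∈ r.prem, a.Holds I ν) → ∃ d ∈ r.concl, d.Holds I ν

/-- The axioms without existential variables are valid. -/
def Interp.Models (T : Theory S) : Prop := ∀ r ∈ T, r.ExistFree → r.Valid I

variable {I}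

@[simp] theorem Term.eval_var (ν : V → A) (x : V) :
    (Term.var x : Term S V).eval I ν = ν x := rfl
@[simp] theorem Term.eval_zero (ν : V → A) : (0 : Term S V).eval I ν = 0 := rfl
@[simp] theorem Term.eval_one (ν : V → A) : (1 : Term S V).eval I ν = 1 := rfl
@[simp] theorem Term.eval_add (ν : V → A) (s t : Term S V) :
    (s + t).eval I ν = s.eval I ν + t.eval I ν := rfl
@[simp] theorem Term.eval_mul (ν : V → A) (s t : Term S V) :
    (s * t).eval I ν = s.eval I ν * t.eval I ν := rfl
@[simp] theorem Term.eval_neg (ν : V → A) (t : Term S V) :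
    (-t).eval I ν = -t.eval I ν := rfl
@[simp] theorem Term.eval_sub (ν : V → A) (s t : Term S V) :
    (s - t).eval I ν = s.eval I ν - t.eval I ν := (sub_eq_add_neg _ _).symm
@[simp] theorem Term.eval_sup (ν : V → A) (h : S.sup = true) (s t : Term S V) :
    (Term.sup h s t).eval I ν = I.sup (s.eval I ν) (t.eval I ν) := rfl
@[simp] theorem Term.eval_frac (ν : V → A) (h : S.frac = true) (s t : Term S V) :
    (Term.frac h s t).eval I ν = I.frac (s.eval I ν) (t.eval I ν) := rfl

@[simp] theorem Term.eval_pow (ν : V → A) (t : Term S V) (n : ℕ) :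
    (t ^ n).eval I ν = t.eval I ν ^ n := by
  induction n with
  | zero => rw [pow_zero]; rfl
  | succ n ih => rw [pow_succ, ← ih]; rfl

theorem Term.eval_polyEval (ν : V → A) (c : ℕ → Term S V) (t : Term S V) (n : ℕ) :
    (Term.polyEval c t n).eval I ν =
      ∑ k ∈ Finset.range (n + 1), (c k).eval I ν * t.eval I ν ^ k := by
  induction n with
  | zero => simp [Term.polyEval]
  | succ n ih => rw [Finset.sum_range_succ, ← ih, Term.polyEval]; simp

@[simp] theorem Atom.holds_isZero (ν : V → A) (t : Term S V) :
    (Atom.isZero t).Holds I ν ↔ t.eval I ν = 0 := Iff.rfl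
@[simp] theorem Atom.holds_nonneg (ν : V → A) (t : Term S V) :
    (Atom.nonneg t).Holds I ν ↔ t.eval I ν ∈ I.nonneg := Iff.rfl
@[simp] theorem Atom.holds_pos (ν : V → A) (h : S.pos = true) (t : Term S V) :
    (Atom.pos h t).Holds I ν ↔ t.eval I ν ∈ I.pos := Iff.rfl
@[simp] theorem Atom.holds_eq (ν : V → A) (s t : Term S V) :
    (Atom.eq s t).Holds I ν ↔ s.eval I ν = t.eval I ν := by simp [Atom.eq, sub_eq_zero]
@[simp] theorem Atom.holds_ge (ν : V → A) (s t : Term S V) :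
    (Atom.ge s t).Holds I ν ↔ s.eval I ν - t.eval I ν ∈ I.nonneg := by simp [Atom.ge]
@[simp] theorem Atom.holds_gt (ν : V → A) (h : S.pos = true) (s t : Term S V) :
    (Atom.gt h s t).Holds I ν ↔ s.eval I ν - t.eval I ν ∈ I.pos := by simp [Atom.gt]

theorem Term.eval_subst (σ : V → Term S W) (ν : W → A) (t : Term S V) :
    (t.subst σ).eval I ν = t.eval I fun x => (σ x).eval I ν := by
  induction t <;> simp_all [Term.subst, Term.eval]

theorem Atom.holds_subst (σ : V → Term S W) (ν : W → A) (a : Atom S V) :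
    (a.subst σ).Holds I ν ↔ a.Holds I fun x => (σ x).eval I ν := by
  cases a <;> simp [Atom.subst, Term.eval_subst]

@[simp] theorem Atom.holds_rename (f : V → W) (ν : W → A) (a : Atom S V) :
    (a.rename f).Holds I ν ↔ a.Holds I (ν ∘ f) := by
  rw [Atom.rename, Atom.holds_subst]; rfl

theorem Term.eval_lift (h : S ≤ S') (ν : V → A) (t : Term S V) :
    (t.lift h).eval I ν = t.eval I ν := by
  induction t <;> simp_all [Term.lift, Term.eval]

theorem Atom.holds_lift (h : S ≤ S') (ν : V → A) (a : Atom S V) :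
    (a.lift h).Holds I ν ↔ a.Holds I ν := by
  cases a <;> simp [Atom.lift, Term.eval_lift]

theorem ExConj.holds_lift (h : S ≤ S') (ν : V → A) (d : ExConj S V) :
    (d.lift h).Holds I ν ↔ d.Holds I ν := by
  refine exists_congr fun τ => List.forall_mem_map.trans ?_
  exact forall₂_congr fun a _ => Atom.holds_lift h _ a

theorem ExConj.holds_rename (f : V → W) (ν : W → A) (d : ExConj S V) :
    (d.rename f).Holds I ν ↔ d.Holds I (ν ∘ f) := by
  obtain ⟨n, l⟩ := d
  have key : ∀ τ : Fin n → A, Sum.elim ν τ ∘ Sum.map f id = Sum.elim (ν ∘ f) τ := by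
    intro τ
    funext x
    cases x <;> rfl
  refine exists_congr fun τ => List.forall_mem_map.trans (forall₂_congr fun a _ => ?_)
  refine (Atom.holds_rename (Sum.map f id) (Sum.elim ν τ) a).trans ?_
  exact iff_of_eq (congrArg (fun ν' => Atom.Holds I ν' a) (key τ))

theorem DynRule.valid_lift (h : S ≤ S') (r : DynRule S V) :
    (r.lift h).Valid I ↔ r.Valid I := by
  simp [DynRule.Valid, DynRule.lift, Atom.holds_lift, ExConj.holds_lift]

theorem ExConj.holds_of_eq_zero (ν : V → A) (d : ExConj S V) (hd : d.num = 0) :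
    d.Holds I ν ↔ ∀ τ, ∀ a ∈ d.atoms, a.Holds I (Sum.elim ν τ) := by
  obtain ⟨n, l⟩ := d
  obtain rfl : n = 0 := hd
  refine ⟨?_, fun h => ⟨_, h Fin.elim0⟩⟩
  rintro ⟨τ, h⟩ τ'
  rwa [Subsingleton.elim τ' τ]

/-- Dynamical proofs are sound. -/
theorem Derives.sound {T : Theory S} (hT : ∀ r ∈ T, r.Valid I) {Γ : Set (Atom S V)}
    {C : List (ExConj S V)} (hd : Derives T Γ C) (ν : V → A) (hΓ : ∀ a ∈ Γ, a.Holds I ν) :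
    ∃ d ∈ C, d.Holds I ν := by
  induction hd with
  | leaf d hd τ h =>
    refine ⟨d, hd, fun i => (τ i).eval I ν, fun a ha => ?_⟩
    have := (Atom.holds_subst _ _ _).1 (hΓ _ (h a ha))
    convert this using 1
    funext x
    cases x <;> rfl
  | step r hr σ hprem hbranch ih =>
    obtain ⟨d, hd, τ, hτ⟩ := hT r hr (fun n => (σ n).eval I ν) fun a ha =>
      (Atom.holds_subst _ _ _).1 (hΓ _ (hprem a ha))
    obtain ⟨c', hc', hcν⟩ := ih d hd (Sum.elim ν τ) (by
      rintro _ (⟨a, ha, rfl⟩ | ⟨a, ha, rfl⟩)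
      · rw [Atom.holds_rename]
        exact hΓ a ha
      · rw [Atom.holds_subst]
        convert hτ a ha using 1
        funext x
        cases x
        · simp only [Sum.elim_inl, Term.eval_subst]; rfl
        · rfl)
    obtain ⟨c, hc, rfl⟩ := List.mem_map.1 hc'
    exact ⟨c, hc, (ExConj.holds_rename Sum.inl (Sum.elim ν τ) c).1 hcν⟩

/-- Evaluation factors through the represented polynomial, because the outermost subterms `s ∨ t`
and `Fr(s, t)` are indeterminates that are sent to their own values. Hence the axioms of ring
computation hold under every interpretation. -/
theorem Term.eval_eq_eval₂_toPoly (ν : V → A) (t : Term S V) :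
    t.eval I ν = MvPolynomial.eval₂ (Int.castRingHom A) (fun s => s.eval I ν) t.toPoly := by
  induction t <;> simp_all [Term.toPoly, Term.eval]

end Semantics

section ToPoly

variable {S : Signature} {V : Type u}

@[simp] theorem Term.toPoly_zero : (0 : Term S V).toPoly = 0 := rfl
@[simp] theorem Term.toPoly_one : (1 : Term S V).toPoly = 1 := rfl
@[simp] theorem Term.toPoly_add (s t : Term S V) : (s + t).toPoly = s.toPoly + t.toPoly := rfl
@[simp] theorem Term.toPoly_mul (s t : Term S V) : (s * t).toPoly = s.toPoly * t.toPoly := rfl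
@[simp] theorem Term.toPoly_neg (t : Term S V) : (-t).toPoly = -t.toPoly := rfl
@[simp] theorem Term.toPoly_sub (s t : Term S V) : (s - t).toPoly = s.toPoly - t.toPoly :=
  (sub_eq_add_neg _ _).symm

end ToPoly

/-! ### The term model of a saturated stock of atomic formulas -/

section TermModel

variable {S : Signature} {V : Type u}

/-- Closure under the rules of the theory of commutative rings. -/
structure IsRingStock (Δ : Set (Atom S V)) : Prop where
  ring : ∀ t : Term S ℕ, t.toPoly = 0 → ∀ σ : ℕ → Term S V, .isZero (t.subst σ) ∈ Δ
  add : ∀ s t, .isZero s ∈ Δ → .isZero t ∈ Δ → .isZero (s + t) ∈ Δ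
  mul : ∀ s t, .isZero s ∈ Δ → .isZero (s * t) ∈ Δ
  isZero : ∀ s t, .isZero (s - t) ∈ Δ → .isZero s ∈ Δ → .isZero t ∈ Δ
  nonneg : ∀ s t, .isZero (s - t) ∈ Δ → .nonneg s ∈ Δ → .nonneg t ∈ Δ
  pos : ∀ h s t, .isZero (s - t) ∈ Δ → .pos h s ∈ Δ → .pos h t ∈ Δ
  sup : ∀ h s t s' t', .isZero (s - s') ∈ Δ → .isZero (t - t') ∈ Δ →
    .isZero (Term.sup h s t - Term.sup h s' t') ∈ Δ
  frac : ∀ h s t s' t', .isZero (s - s') ∈ Δ → .isZero (t - t') ∈ Δ →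
    .isZero (Term.frac h s t - Term.frac h s' t') ∈ Δ

/-- The sequence with the given first values. -/
def seq4 {α : Type u} (a b c d : α) : ℕ → α
  | 0 => a
  | 1 => b
  | 2 => c
  | _ => d

variable {Δ : Set (Atom S V)} (hΔ : IsRingStock Δ)

/-- Terms with the same polynomial are provably equal, so every polynomial identity is a rewriting
rule inside the stock. -/
theorem IsRingStock.of_ring (hΔ : IsRingStock Δ) (t u : Term S ℕ) (h : t.toPoly = u.toPoly)
    (σ : ℕ → Term S V)
    (ht : .isZero (t.subst σ) ∈ Δ) : .isZero (u.subst σ) ∈ Δ :=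
  hΔ.isZero _ _ (hΔ.ring (t - u) (by simp [h]) σ) ht

theorem IsRingStock.isZero_sub_zero (hΔ : IsRingStock Δ) (t : Term S V) :
    .isZero (t - 0) ∈ Δ ↔ .isZero t ∈ Δ :=
  ⟨hΔ.of_ring (vx S - 0) (vx S) (by simp) fun _ => t,
    hΔ.of_ring (vx S) (vx S - 0) (by simp) fun _ => t⟩

/-- Provable equality. -/
def IsRingStock.setoid : Setoid (Term S V) where
  r s t := .isZero (s - t) ∈ Δ
  iseqv :=
    { refl := fun t => hΔ.ring (vx S - vx S) (by simp) fun _ => t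
      symm := fun {s t} h => hΔ.of_ring ((vx S - vy S) * -1) (vy S - vx S) (by simp)
        (seq4 s t s s) (hΔ.mul _ _ h)
      trans := fun {s t u} h h' => hΔ.of_ring ((vx S - vy S) + (vy S - vz S)) (vx S - vz S)
        (by simp) (seq4 s t u u) (hΔ.add _ _ h h') }

/-- The quotient of the terms by provable equality. -/
def IsRingStock.Carrier : Type u := Quotient hΔ.setoid

/-- The class of a term. -/
def IsRingStock.cls (t : Term S V) : hΔ.Carrier := Quotient.mk hΔ.setoid t

theorem IsRingStock.cls_eq_cls {s t : Term S V} : hΔ.cls s = hΔ.cls t ↔ .isZero (s - t) ∈ Δ :=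
  Quotient.eq (r := hΔ.setoid)

theorem IsRingStock.cls_eq_of_ring (s t : Term S ℕ) (h : s.toPoly = t.toPoly)
    (σ : ℕ → Term S V) : hΔ.cls (s.subst σ) = hΔ.cls (t.subst σ) :=
  hΔ.cls_eq_cls.2 (hΔ.ring (s - t) (by simp [h]) σ)

instance : Zero hΔ.Carrier := ⟨hΔ.cls 0⟩
instance : One hΔ.Carrier := ⟨hΔ.cls 1⟩
instance : Add hΔ.Carrier :=
  ⟨Quotient.map₂ (· + ·) fun s s' h t t' h' =>
    hΔ.of_ring ((vx S - vy S) + (vz S - vw S)) ((vx S + vz S) - (vy S + vw S))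
      (by simp only [Term.toPoly_sub, Term.toPoly_add]; ring) (seq4 s s' t t') (hΔ.add _ _ h h')⟩
instance : Mul hΔ.Carrier :=
  ⟨Quotient.map₂ (· * ·) fun s s' h t t' h' =>
    hΔ.of_ring ((vx S - vy S) * vz S + (vz S - vw S) * vy S) ((vx S * vz S) - (vy S * vw S))
      (by simp only [Term.toPoly_sub, Term.toPoly_add, Term.toPoly_mul]; ring) (seq4 s s' t t')
      (hΔ.add _ _ (hΔ.mul _ _ h) (hΔ.mul _ _ h'))⟩
instance : Neg hΔ.Carrier :=
  ⟨Quotient.map (- ·) fun s s' h =>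
    hΔ.of_ring ((vx S - vy S) * -1) ((-vx S) - (-vy S))
      (by simp only [Term.toPoly_sub, Term.toPoly_neg, Term.toPoly_mul, Term.toPoly_one]; ring)
      (seq4 s s' s s) (hΔ.mul _ _ h)⟩

/-- Each ring law is an identity between integer polynomials, hence an instance of the axioms of
ring computation. -/
noncomputable instance : CommRing hΔ.Carrier where
  add_assoc := by
    rintro ⟨a⟩ ⟨b⟩ ⟨c⟩
    exact hΔ.cls_eq_of_ring (vx S + vy S + vz S) (vx S + (vy S + vz S))
      (by simp only [Term.toPoly_add]; ring) (seq4 a b c c)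
  zero_add := by
    rintro ⟨a⟩
    exact hΔ.cls_eq_of_ring (0 + vx S) (vx S) (by simp) (seq4 a a a a)
  add_zero := by
    rintro ⟨a⟩
    exact hΔ.cls_eq_of_ring (vx S + 0) (vx S) (by simp) (seq4 a a a a)
  nsmul := nsmulRec
  zsmul := zsmulRec
  neg_add_cancel := by
    rintro ⟨a⟩
    exact hΔ.cls_eq_of_ring (-vx S + vx S) 0 (by simp) (seq4 a a a a)
  add_comm := by
    rintro ⟨a⟩ ⟨b⟩
    exact hΔ.cls_eq_of_ring (vx S + vy S) (vy S + vx S)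
      (by simp only [Term.toPoly_add]; ring) (seq4 a b b b)
  left_distrib := by
    rintro ⟨a⟩ ⟨b⟩ ⟨c⟩
    exact hΔ.cls_eq_of_ring (vx S * (vy S + vz S)) (vx S * vy S + vx S * vz S)
      (by simp only [Term.toPoly_add, Term.toPoly_mul]; ring) (seq4 a b c c)
  right_distrib := by
    rintro ⟨a⟩ ⟨b⟩ ⟨c⟩
    exact hΔ.cls_eq_of_ring ((vx S + vy S) * vz S) (vx S * vz S + vy S * vz S)
      (by simp only [Term.toPoly_add, Term.toPoly_mul]; ring) (seq4 a b c c)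
  zero_mul := by
    rintro ⟨a⟩
    exact hΔ.cls_eq_of_ring (0 * vx S) 0 (by simp) (seq4 a a a a)
  mul_zero := by
    rintro ⟨a⟩
    exact hΔ.cls_eq_of_ring (vx S * 0) 0 (by simp) (seq4 a a a a)
  mul_assoc := by
    rintro ⟨a⟩ ⟨b⟩ ⟨c⟩
    exact hΔ.cls_eq_of_ring (vx S * vy S * vz S) (vx S * (vy S * vz S))
      (by simp only [Term.toPoly_mul]; ring) (seq4 a b c c)
  one_mul := by
    rintro ⟨a⟩
    exact hΔ.cls_eq_of_ring (1 * vx S) (vx S) (by simp) (seq4 a a a a)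
  mul_one := by
    rintro ⟨a⟩
    exact hΔ.cls_eq_of_ring (vx S * 1) (vx S) (by simp) (seq4 a a a a)
  mul_comm := by
    rintro ⟨a⟩ ⟨b⟩
    exact hΔ.cls_eq_of_ring (vx S * vy S) (vy S * vx S)
      (by simp only [Term.toPoly_mul]; ring) (seq4 a b b b)

/-- The interpretation of the symbols in the term model. -/
noncomputable def IsRingStock.interp : Interp hΔ.Carrier where
  sup x y := if h : S.sup = true then hΔ.cls (Term.sup h x.out y.out) else 0
  frac x y := if h : S.frac = true then hΔ.cls (Term.frac h x.out y.out) else 0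
  nonneg := {x | .nonneg x.out ∈ Δ}
  pos := {x | ∃ h, .pos h x.out ∈ Δ}

theorem IsRingStock.cls_out (x : hΔ.Carrier) : hΔ.cls x.out = x := Quotient.out_eq x

theorem IsRingStock.isZero_out_sub (t : Term S V) : .isZero ((hΔ.cls t).out - t) ∈ Δ :=
  hΔ.cls_eq_cls.1 (hΔ.cls_out _)

theorem IsRingStock.isZero_sub_out (t : Term S V) : .isZero (t - (hΔ.cls t).out) ∈ Δ :=
  hΔ.cls_eq_cls.1 (hΔ.cls_out _).symm

/-- The assignment of its class to each variable. -/
def IsRingStock.val (x : V) : hΔ.Carrier := hΔ.cls (.var x)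

theorem IsRingStock.eval_eq (t : Term S V) : t.eval hΔ.interp hΔ.val = hΔ.cls t := by
  induction t with
  | var x => rfl
  | zero => rfl
  | one => rfl
  | add s t hs ht => exact congrArg₂ (· + ·) hs ht
  | mul s t hs ht => exact congrArg₂ (· * ·) hs ht
  | neg t ht => exact congrArg (- ·) ht
  | sup h s t hs ht =>
    rw [Term.eval_sup, hs, ht]
    exact (dif_pos h).trans
      (hΔ.cls_eq_cls.2 (hΔ.sup h _ _ _ _ (hΔ.isZero_out_sub s) (hΔ.isZero_out_sub t)))
  | frac h s t hs ht =>
    rw [Term.eval_frac, hs, ht]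
    exact (dif_pos h).trans
      (hΔ.cls_eq_cls.2 (hΔ.frac h _ _ _ _ (hΔ.isZero_out_sub s) (hΔ.isZero_out_sub t)))

/-- The truth lemma of the term model. Predicates are defined through chosen representatives, which
is harmless because the stock is closed under substitution of equals. -/
theorem IsRingStock.holds_iff (a : Atom S V) : a.Holds hΔ.interp hΔ.val ↔ a ∈ Δ := by
  cases a with
  | isZero t =>
    rw [Atom.holds_isZero, hΔ.eval_eq]
    exact hΔ.cls_eq_cls.trans (hΔ.isZero_sub_zero t)
  | nonneg t =>
    rw [Atom.holds_nonneg, hΔ.eval_eq]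
    exact ⟨hΔ.nonneg _ _ (hΔ.isZero_out_sub t), hΔ.nonneg _ _ (hΔ.isZero_sub_out t)⟩
  | pos h t =>
    rw [Atom.holds_pos, hΔ.eval_eq]
    exact ⟨fun ⟨h, ht⟩ => hΔ.pos h _ _ (hΔ.isZero_out_sub t) ht,
      fun ht => ⟨h, hΔ.pos h _ _ (hΔ.isZero_sub_out t) ht⟩⟩

end TermModel

theorem horn_existFree {S : Signature} {V : Type u} (Γ Θ : List (Atom S V)) :
    (horn Γ Θ).ExistFree := by
  intro d hd
  simp only [horn, List.mem_singleton] at hd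
  rw [hd]

/-- Classical completeness, up to the existential axioms: a stock of atomic formulas that does not
derive `C` is true in an interpretation where `C` is false, and where all rules without existential
variables that the theory proves are valid. -/
theorem Derives.exists_interp {S : Signature} {T : Theory S} (hAc : Ac S ⊆ T) {V : Type u}
    {Γ : Set (Atom S V)} {C : List (ExConj S V)} (hd : ¬ Derives T Γ C) :
    ∃ (A : Type u) (_ : CommRing A) (I : Interp A) (ν : V → A), (∀ a ∈ Γ, a.Holds I ν) ∧
      (∀ d ∈ C, ¬ d.Holds I ν) ∧ ∀ r : DynRule S ℕ, T.Proves r → r.ExistFree → r.Valid I := by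
  obtain ⟨Δ, hΓ, hC, hcl⟩ := Derives.exists_saturated hd
  have hhorn : ∀ Γ Θ : List (Atom S ℕ), horn Γ Θ ∈ Ac S → ∀ σ : ℕ → Term S V,
      (∀ a ∈ Γ, a.subst σ ∈ Δ) → ∀ a ∈ Θ, a.subst σ ∈ Δ := by
    intro Γ Θ hmem σ hΓ a ha
    obtain ⟨d, hd, h⟩ := hcl _ (Theory.proves_of_mem (hAc hmem)) (horn_existFree Γ Θ) σ hΓ
    simp only [horn, List.mem_singleton] at hd
    subst hd
    have := h _ (List.mem_map_of_mem ha) Fin.elim0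
    rwa [Atom.rename, Atom.subst_subst] at this
  have hΔ : IsRingStock Δ :=
    { ring := fun t ht σ => hhorn [] [.isZero t] (.inl (.inl ⟨t, ht, rfl⟩)) σ (by simp)
        (.isZero t) (List.mem_singleton_self _)
      add := fun s t hs ht => hhorn _ _ (.inr (.inr (.inl rfl))) (seq4 s t t t)
        (by simpa using ⟨hs, ht⟩) _ (List.mem_singleton_self _)
      mul := fun s t hs => hhorn _ _ (.inr (.inr (.inr rfl))) (seq4 s t t t)
        (List.forall_mem_singleton.2 hs) _ (List.mem_singleton_self _)
      isZero := fun s t h hs => hhorn _ _ (.inl (.inr (.inl (.inl (.inl (.inl rfl))))))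
        (seq4 s t t t) (by simpa using ⟨h, hs⟩) _ (List.mem_singleton_self _)
      nonneg := fun s t h hs => hhorn _ _ (.inl (.inr (.inl (.inl (.inl (.inr rfl))))))
        (seq4 s t t t) (by simpa using ⟨h, hs⟩) _ (List.mem_singleton_self _)
      pos := fun hp s t h hs => hhorn _ _ (.inl (.inr (.inl (.inl (.inr ⟨hp, rfl⟩)))))
        (seq4 s t t t) (by simpa using ⟨h, hs⟩) _ (List.mem_singleton_self _)
      sup := fun h s t s' t' hs ht => hhorn _ _ (.inl (.inr (.inl (.inr ⟨h, rfl⟩))))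
        (seq4 s s' t t') (by simpa using ⟨hs, ht⟩) _ (List.mem_singleton_self _)
      frac := fun h s t s' t' hs ht => hhorn _ _ (.inl (.inr (.inr ⟨h, rfl⟩)))
        (seq4 s s' t t') (by simpa using ⟨hs, ht⟩) _ (List.mem_singleton_self _) }
  refine ⟨hΔ.Carrier, inferInstance, hΔ.interp, hΔ.val,
    fun a ha => (hΔ.holds_iff a).2 (hΓ ha), ?_, ?_⟩
  · rintro d hd ⟨τ, hτ⟩
    refine hC (.leaf d hd (fun i => (τ i).out) fun a ha => ?_)
    rw [← hΔ.holds_iff, Atom.holds_subst]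
    convert hτ a ha using 1
    funext x
    rcases x with x | i
    · rfl
    · exact (hΔ.eval_eq _).trans (hΔ.cls_out _)
  · intro r hr hfree ν hν
    -- An arbitrary assignment in the quotient is realized by substituting representatives, so
    -- validity of a rule is closure of `Δ` under its instances.
    have hval : ∀ n : ℕ, (ν n).out.eval hΔ.interp hΔ.val = ν n := fun n =>
      (hΔ.eval_eq _).trans (hΔ.cls_out _)
    obtain ⟨d, hd, h⟩ := hcl r hr hfree (fun n => (ν n).out) fun a ha => by
      rw [← hΔ.holds_iff, Atom.holds_subst]
      simpa only [hval] using hν a ha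
    refine ⟨d, hd, (ExConj.holds_of_eq_zero ν d (hfree d hd)).2 fun τ a ha => ?_⟩
    have := h a ha fun i => (τ i).out
    rw [← hΔ.holds_iff, Atom.holds_subst] at this
    convert this using 1
    funext x
    rcases x with x | i
    · exact (hval x).symm
    · exact ((hΔ.eval_eq _).trans (hΔ.cls_out _)).symm

/-- A rule that is valid in all interpretations of the axioms without existential variables is
valid in the theory. -/
theorem Theory.proves_of_valid {S : Signature} {T : Theory S} (hAc : Ac S ⊆ T) {V : Type u}
    {r : DynRule S V}
    (h : ∀ (A : Type u) [CommRing A] (I : Interp A), I.Models T → r.Valid I) : T.Proves r := by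
  by_contra hn
  obtain ⟨A, _, I, ν, hΓ, hC, hI⟩ := Derives.exists_interp hAc hn
  obtain ⟨d, hd, hdν⟩ := h A I (fun r hr hfree => hI r (proves_of_mem hr) hfree) ν hΓ
  exact hC d hd hdν

/-! ### Validity of the axioms -/

section AxiomValidity

variable {S : Signature} {A : Type v} [CommRing A] {I : Interp A}

@[simp] theorem seq4_zero {α : Type u} (a b c d : α) : seq4 a b c d 0 = a := rfl
@[simp] theorem seq4_one {α : Type u} (a b c d : α) : seq4 a b c d 1 = b := rfl
@[simp] theorem seq4_two {α : Type u} (a b c d : α) : seq4 a b c d 2 = c := rfl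

theorem Interp.models_union (T T' : Theory S) : I.Models (T ∪ T') ↔ I.Models T ∧ I.Models T' := by
  simp [Interp.Models, or_imp, forall_and]

theorem Interp.models_insert (r : DynRule S ℕ) (T : Theory S) :
    I.Models (insert r T) ↔ (r.ExistFree → r.Valid I) ∧ I.Models T := by
  simp [Interp.Models]

theorem Interp.models_singleton (r : DynRule S ℕ) :
    I.Models {r} ↔ (r.ExistFree → r.Valid I) := by
  simp [Interp.Models]

theorem valid_horn {V : Type u} (Γ Θ : List (Atom S V)) :
    (horn Γ Θ).Valid I ↔ ∀ ν : V → A, (∀ a ∈ Γ, a.Holds I ν) → ∀ a ∈ Θ, a.Holds I ν := by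
  refine forall_congr' fun ν => imp_congr_right fun _ => ?_
  simp [horn, ExConj.Holds]

theorem valid_disj {V : Type u} (Γ : List (Atom S V)) (a b : Atom S V) :
    (disj Γ a b).Valid I ↔
      ∀ ν : V → A, (∀ c ∈ Γ, c.Holds I ν) → a.Holds I ν ∨ b.Holds I ν := by
  refine forall_congr' fun ν => imp_congr_right fun _ => ?_
  simp [disj, ExConj.Holds]

theorem disj_existFree {V : Type u} (Γ : List (Atom S V)) (a b : Atom S V) :
    (disj Γ a b).ExistFree := by
  intro d hd
  simp only [disj, List.mem_cons, List.not_mem_nil, or_false] at hd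
  rcases hd with rfl | rfl <;> rfl

theorem models_horn {V : Type u} (Γ Θ : List (Atom S V)) :
    ((horn Γ Θ).ExistFree → (horn Γ Θ).Valid I) ↔
      ∀ ν : V → A, (∀ a ∈ Γ, a.Holds I ν) → ∀ a ∈ Θ, a.Holds I ν := by
  simp only [horn_existFree, true_imp_iff, valid_horn]

theorem models_disj {V : Type u} (Γ : List (Atom S V)) (a b : Atom S V) :
    ((disj Γ a b).ExistFree → (disj Γ a b).Valid I) ↔
      ∀ ν : V → A, (∀ c ∈ Γ, c.Holds I ν) → a.Holds I ν ∨ b.Holds I ν := by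
  simp only [disj_existFree, true_imp_iff, valid_disj]

theorem not_existFree_exist {V : Type u} (Γ : List (Atom S V)) (Θ : List (Atom S (V ⊕ Fin 1))) :
    ¬ (exist Γ Θ).ExistFree :=
  fun h => one_ne_zero (h ⟨1, Θ⟩ (List.mem_singleton_self _))

theorem models_exist {V : Type u} (Γ : List (Atom S V)) (Θ : List (Atom S (V ⊕ Fin 1))) :
    ((exist Γ Θ).ExistFree → (exist Γ Θ).Valid I) ↔ True := by
  simp [not_existFree_exist]

theorem valid_exist {V : Type u} (Γ : List (Atom S V)) (Θ : List (Atom S (V ⊕ Fin 1))) :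
    (exist Γ Θ).Valid I ↔ ∀ ν : V → A, (∀ c ∈ Γ, c.Holds I ν) →
      ∃ x : A, ∀ a ∈ Θ, a.Holds I (Sum.elim ν fun _ => x) := by
  refine forall_congr' fun ν => imp_congr_right fun _ => ?_
  simp only [exist, ExConj.Holds, List.mem_singleton, exists_eq_left]
  refine ⟨fun ⟨τ, hτ⟩ => ⟨τ 0, ?_⟩, fun ⟨x, hx⟩ => ⟨_, hx⟩⟩
  rwa [show (fun _ => τ 0) = τ from funext fun i => congrArg τ (Subsingleton.elim _ _)]

/-- Provable equality is interpreted by true equality in a commutative ring, so no condition on `I`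
is needed. -/
theorem models_Ac : I.Models (Ac S) := by
  rintro r (((⟨t, ht, rfl⟩ | hr)) | hr) -
  · rw [valid_horn]
    intro ν _
    simp only [List.mem_singleton, forall_eq, Atom.holds_isZero]
    rw [Term.eval_eq_eval₂_toPoly, ht, MvPolynomial.eval₂_zero]
  · rcases hr with ((((rfl | rfl) | ⟨h, rfl⟩) | ⟨h, rfl⟩) | ⟨h, rfl⟩) <;> rw [valid_horn] <;>
      intro ν <;> simp +contextual
  · rcases hr with (rfl | rfl | rfl)
    · exact (valid_horn _ _).2 fun ν => by simp
    · exact (valid_horn _ _).2 fun ν => by simp +contextual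
    · exact (valid_horn _ _).2 fun ν => by simp +contextual

theorem models_gao0 : ((gao0 S).ExistFree → (gao0 S).Valid I) ↔
    0 ∈ I.nonneg := by
  simp only [gao0, models_horn]
  simp

theorem models_gao1 : ((gao1 S).ExistFree → (gao1 S).Valid I) ↔
    ∀ x y : A, x ∈ I.nonneg → y ∈ I.nonneg → x + y ∈ I.nonneg := by
  simp only [gao1, models_horn]
  exact ⟨fun h x y => by simpa using h (seq4 x y 0 0),
    fun h ν => by simpa using h (ν 0) (ν 1)⟩

theorem models_ao1 : ((ao1 S).ExistFree → (ao1 S).Valid I) ↔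
    ∀ x : A, x * x ∈ I.nonneg := by
  simp only [ao1, models_horn]
  exact ⟨fun h x => by simpa using h (seq4 x 0 0 0),
    fun h ν => by simpa using h (ν 0)⟩

theorem models_ao2 : ((ao2 S).ExistFree → (ao2 S).Valid I) ↔
    ∀ x y : A, x ∈ I.nonneg → y ∈ I.nonneg → x * y ∈ I.nonneg := by
  simp only [ao2, models_horn]
  exact ⟨fun h x y => by simpa using h (seq4 x y 0 0),
    fun h ν => by simpa using h (ν 0) (ν 1)⟩

theorem models_Gao : ((Gao S).ExistFree → (Gao S).Valid I) ↔
    ∀ x : A, x ∈ I.nonneg → -x ∈ I.nonneg → x = 0 := by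
  simp only [Gao, models_horn]
  exact ⟨fun h x => by simpa using h (seq4 x 0 0 0),
    fun h ν => by simpa using h (ν 0)⟩

theorem models_Anz : ((Anz S).ExistFree → (Anz S).Valid I) ↔
    ∀ x : A, x * x = 0 → x = 0 := by
  simp only [Anz, models_horn]
  exact ⟨fun h x => by simpa using h (seq4 x 0 0 0),
    fun h ν => by simpa using h (ν 0)⟩

theorem models_AonzRule : ((AonzRule S).ExistFree → (AonzRule S).Valid I) ↔
    ∀ x y : A, y ∈ I.nonneg → x * (x * x + y) ∈ I.nonneg → x ∈ I.nonneg := by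
  simp only [AonzRule, models_horn]
  exact ⟨fun h x y => by simpa using h (seq4 x y 0 0),
    fun h ν => by simpa using h (ν 0) (ν 1)⟩

theorem models_OT : ((OT S).ExistFree → (OT S).Valid I) ↔
    ∀ x : A, x ∈ I.nonneg ∨ -x ∈ I.nonneg := by
  simp only [OT, models_disj]
  exact ⟨fun h x => by simpa using h (seq4 x 0 0 0),
    fun h ν => by simpa using h (ν 0)⟩

theorem models_aso1 (hp : S.pos = true) : ((aso1 S hp).ExistFree → (aso1 S hp).Valid I) ↔
    1 ∈ I.pos := by
  simp only [aso1, models_horn]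
  simp

theorem models_aso2 (hp : S.pos = true) : ((aso2 S hp).ExistFree → (aso2 S hp).Valid I) ↔
    ∀ x : A, x ∈ I.pos → x ∈ I.nonneg := by
  simp only [aso2, models_horn]
  exact ⟨fun h x => by simpa using h (seq4 x 0 0 0),
    fun h ν => by simpa using h (ν 0)⟩

theorem models_aso3 (hp : S.pos = true) : ((aso3 S hp).ExistFree → (aso3 S hp).Valid I) ↔
    ∀ x y : A, x ∈ I.pos → y ∈ I.nonneg → x + y ∈ I.pos := by
  simp only [aso3, models_horn]
  exact ⟨fun h x y => by simpa using h (seq4 x y 0 0),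
    fun h ν => by simpa using h (ν 0) (ν 1)⟩

theorem models_aso4 (hp : S.pos = true) : ((aso4 S hp).ExistFree → (aso4 S hp).Valid I) ↔
    ∀ x y : A, x ∈ I.pos → y ∈ I.pos → x * y ∈ I.pos := by
  simp only [aso4, models_horn]
  exact ⟨fun h x y => by simpa using h (seq4 x y 0 0),
    fun h ν => by simpa using h (ν 0) (ν 1)⟩

theorem models_col (hp : S.pos = true) : ((col S hp).ExistFree → (col S hp).Valid I) ↔
    0 ∈ I.pos → (1 : A) = 0 := by
  simp only [col, models_horn]
  simp

theorem models_Iv (hp : S.pos = true) : ((Iv S hp).ExistFree → (Iv S hp).Valid I) ↔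
    ∀ x y : A, x * y = 1 → x * x ∈ I.pos := by
  simp only [Iv, models_horn]
  exact ⟨fun h x y => by simpa using h (seq4 x y 0 0),
    fun h ν => by simpa using h (ν 0) (ν 1)⟩

theorem models_Aso1 (hp : S.pos = true) : ((Aso1 S hp).ExistFree → (Aso1 S hp).Valid I) ↔
    ∀ x y : A, x ∈ I.pos → x * y ∈ I.nonneg → y ∈ I.nonneg := by
  simp only [Aso1, models_horn]
  exact ⟨fun h x y => by simpa using h (seq4 x y 0 0),
    fun h ν => by simpa using h (ν 0) (ν 1)⟩

theorem models_Aso2 (hp : S.pos = true) : ((Aso2 S hp).ExistFree → (Aso2 S hp).Valid I) ↔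
    ∀ x y : A, x ∈ I.nonneg → x * y ∈ I.pos → y ∈ I.pos := by
  simp only [Aso2, models_horn]
  exact ⟨fun h x y => by simpa using h (seq4 x y 0 0),
    fun h ν => by simpa using h (ν 0) (ν 1)⟩

theorem models_ED (hp : S.pos = true) : ((ED S hp).ExistFree → (ED S hp).Valid I) ↔
    ∀ x : A, x = 0 ∨ x * x ∈ I.pos := by
  simp only [ED, models_disj]
  exact ⟨fun h x => by simpa using h (seq4 x 0 0 0),
    fun h ν => by simpa using h (ν 0)⟩

theorem models_OTF (hp : S.pos = true) : ((OTF S hp).ExistFree → (OTF S hp).Valid I) ↔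
    ∀ x y : A, x + y ∈ I.pos → x ∈ I.pos ∨ y ∈ I.pos := by
  simp only [OTF, models_disj]
  exact ⟨fun h x y => by simpa using h (seq4 x y 0 0),
    fun h ν => by simpa using h (ν 0) (ν 1)⟩

theorem models_sup1 (hs : S.sup = true) : ((sup1 S hs).ExistFree → (sup1 S hs).Valid I) ↔
    ∀ x y : A, I.sup x y - x ∈ I.nonneg := by
  simp only [sup1, models_horn]
  exact ⟨fun h x y => by simpa using h (seq4 x y 0 0),
    fun h ν => by simpa using h (ν 0) (ν 1)⟩

theorem models_sup2 (hs : S.sup = true) : ((sup2 S hs).ExistFree → (sup2 S hs).Valid I) ↔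
    ∀ x y : A, I.sup x y - y ∈ I.nonneg := by
  simp only [sup2, models_horn]
  exact ⟨fun h x y => by simpa using h (seq4 x y 0 0),
    fun h ν => by simpa using h (ν 0) (ν 1)⟩

theorem models_Sup (hs : S.sup = true) : ((Sup S hs).ExistFree → (Sup S hs).Valid I) ↔
    ∀ x y z : A, z - x ∈ I.nonneg → z - y ∈ I.nonneg → z - I.sup x y ∈ I.nonneg := by
  simp only [Sup, models_horn]
  exact ⟨fun h x y z => by simpa using h (seq4 x y z 0),
    fun h ν => by simpa using h (ν 0) (ν 1) (ν 2)⟩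

theorem models_sdt1 (hs : S.sup = true) : ((sdt1 S hs).ExistFree → (sdt1 S hs).Valid I) ↔
    ∀ x : A, I.sup x x = x := by
  simp only [sdt1, models_horn]
  exact ⟨fun h x => by simpa using h (seq4 x 0 0 0),
    fun h ν => by simpa using h (ν 0)⟩

theorem models_sdt2 (hs : S.sup = true) : ((sdt2 S hs).ExistFree → (sdt2 S hs).Valid I) ↔
    ∀ x y : A, I.sup x y = I.sup y x := by
  simp only [sdt2, models_horn]
  exact ⟨fun h x y => by simpa using h (seq4 x y 0 0),
    fun h ν => by simpa using h (ν 0) (ν 1)⟩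

theorem models_sdt3 (hs : S.sup = true) : ((sdt3 S hs).ExistFree → (sdt3 S hs).Valid I) ↔
    ∀ x y z : A, I.sup (I.sup x y) z = I.sup x (I.sup y z) := by
  simp only [sdt3, models_horn]
  exact ⟨fun h x y z => by simpa using h (seq4 x y z 0),
    fun h ν => by simpa using h (ν 0) (ν 1) (ν 2)⟩

theorem models_grl (hs : S.sup = true) : ((grl S hs).ExistFree → (grl S hs).Valid I) ↔
    ∀ x y z : A, x + I.sup y z = I.sup (x + y) (x + z) := by
  simp only [grl, models_horn]
  exact ⟨fun h x y z => by simpa using h (seq4 x y z 0),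
    fun h ν => by simpa using h (ν 0) (ν 1) (ν 2)⟩

theorem models_afr (hs : S.sup = true) : ((afr S hs).ExistFree → (afr S hs).Valid I) ↔
    ∀ x y z : A, I.sup x 0 * I.sup y z = I.sup (I.sup x 0 * y) (I.sup x 0 * z) := by
  simp only [afr, models_horn]
  exact ⟨fun h x y z => by simpa [Term.posPart] using h (seq4 x y z 0),
    fun h ν => by simpa [Term.posPart] using h (ν 0) (ν 1) (ν 2)⟩

theorem models_fr1 (hs : S.sup = true) (hf : S.frac = true) :
    ((fr1 S hs hf).ExistFree → (fr1 S hs hf).Valid I) ↔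
    ∀ x y : A, I.frac x y * I.sup y (-y) = -I.sup (-I.sup x (-x)) (-I.sup y (-y)) *
      -I.sup (-I.sup x (-x)) (-I.sup y (-y)) := by
  simp only [fr1, models_horn]
  exact ⟨fun h x y => by simpa [Term.abs, Term.inf] using h (seq4 x y 0 0),
    fun h ν => by simpa [Term.abs, Term.inf] using h (ν 0) (ν 1)⟩

theorem models_fr2 (hs : S.sup = true) (hf : S.frac = true) :
    ((fr2 S hs hf).ExistFree → (fr2 S hs hf).Valid I) ↔
    ∀ x y : A, I.frac x y ∈ I.nonneg ∧
      -I.sup (-I.sup x (-x)) (-I.sup y (-y)) - I.frac x y ∈ I.nonneg := by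
  simp only [fr2, models_horn]
  exact ⟨fun h x y => by simpa [Term.abs, Term.inf] using h (seq4 x y 0 0),
    fun h ν => by simpa [Term.abs, Term.inf] using h (ν 0) (ν 1)⟩

theorem models_supEq (hs : S.sup = true) :
    ((supEq S hs).ExistFree → (supEq S hs).Valid I) ↔ True := by
  simp only [supEq, models_horn, iff_true]
  intro ν
  simp +contextual

theorem models_supNonneg (hs : S.sup = true) :
    ((horn [.nonneg (vx S)] [.eq (.sup hs (vx S) 0) (vx S)]).ExistFree →
      (horn [.nonneg (vx S)] [.eq (.sup hs (vx S) 0) (vx S)]).Valid I) ↔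
      ∀ x : A, x ∈ I.nonneg → I.sup x 0 = x := by
  simp only [models_horn]
  exact ⟨fun h x => by simpa using h fun _ => x, fun h ν => by simpa using h (ν 0)⟩

theorem models_nonnegSup (hs : S.sup = true) :
    ((horn [.eq (.sup hs (vx S) 0) (vx S)] [.nonneg (vx S)]).ExistFree →
      (horn [.eq (.sup hs (vx S) 0) (vx S)] [.nonneg (vx S)]).Valid I) ↔
      ∀ x : A, I.sup x 0 = x → x ∈ I.nonneg := by
  simp only [models_horn]
  exact ⟨fun h x => by simpa using h fun _ => x, fun h ν => by simpa using h (ν 0)⟩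

theorem models_posOfUnit (hp : S.pos = true) :
    ((horn [.nonneg (vx S), .eq (vx S * vz S) 1] [.pos hp (vx S)]).ExistFree →
      (horn [.nonneg (vx S), .eq (vx S * vz S) 1] [.pos hp (vx S)]).Valid I) ↔
      ∀ x z : A, x ∈ I.nonneg → x * z = 1 → x ∈ I.pos := by
  simp only [models_horn]
  exact ⟨fun h x z => by simpa using h (seq4 x 0 z 0), fun h ν => by simpa using h (ν 0) (ν 2)⟩

theorem models_IVne (hp : S.pos = true) :
    ((IVne S hp).ExistFree → (IVne S hp).Valid I) ↔ True := models_exist _ _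

theorem models_IVpos (hp : S.pos = true) :
    ((IVpos S hp).ExistFree → (IVpos S hp).Valid I) ↔ True := models_exist _ _

/-- Vacuous, since `Interp.Models` tests only the axioms without existential variables. -/
theorem models_RCF (hp : S.pos = true) : I.Models {r | ∃ n : ℕ, r = RCF S hp n} := by
  rintro r ⟨n, rfl⟩ h
  exact absurd h (not_existFree_exist _ _)

theorem valid_IVne (hp : S.pos = true) :
    (IVne S hp).Valid I ↔ ∀ x : A, x * x ∈ I.pos → ∃ y, x * y = 1 := by
  simp only [IVne, valid_exist]
  exact ⟨fun h x => by simpa using h fun _ => x, fun h ν => by simpa using h (ν 0)⟩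

theorem valid_RCF (hp : S.pos = true) (n : ℕ)
    (h : ∀ (c : ℕ → A) (a b : A), b - a ∈ I.pos →
      -((∑ k ∈ Finset.range (n + 1), c k * a ^ k) * ∑ k ∈ Finset.range (n + 1), c k * b ^ k) ∈
        I.pos →
      ∃ x, ∑ k ∈ Finset.range (n + 1), c k * x ^ k = 0 ∧ x - a ∈ I.pos ∧ b - x ∈ I.pos) :
    (RCF S hp n).Valid I := by
  simp only [RCF, valid_exist]
  intro ν
  simpa [Term.eval_polyEval] using h (fun k => ν (k + 2)) (ν 0) (ν 1)

end AxiomValidity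

/-! ### Reduced f-rings -/

section FRing

variable {A : Type v} [CommRing A] [Lattice A]

/-- Multiplication by a nonnegative element distributes over `⊔`, and there is no nonzero nilpotent
element. -/
structure IsReducedFRing (A : Type v) [CommRing A] [Lattice A] : Prop where
  mul_sup' : ∀ x y z : A, (x ⊔ 0) * (y ⊔ z) = (x ⊔ 0) * y ⊔ (x ⊔ 0) * z
  reduced : ∀ x : A, x * x = 0 → x = 0

namespace IsReducedFRing

theorem mul_sup (h : IsReducedFRing A) {c : A} (hc : 0 ≤ c) (y z : A) :
    c * (y ⊔ z) = c * y ⊔ c * z := by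
  have := h.mul_sup' c y z
  rwa [sup_eq_left.2 hc] at this

theorem mul_nonneg (h : IsReducedFRing A) {c y : A} (hc : 0 ≤ c) (hy : 0 ≤ y) : 0 ≤ c * y := by
  have := h.mul_sup hc y 0
  rw [sup_eq_left.2 hy, mul_zero] at this
  exact sup_eq_left.1 this.symm

variable [IsOrderedAddMonoid A]

theorem mul_le_mul_left (h : IsReducedFRing A) {c y z : A} (hc : 0 ≤ c) (hyz : y ≤ z) :
    c * y ≤ c * z := by
  have := h.mul_nonneg hc (sub_nonneg.2 hyz)
  rwa [mul_sub, sub_nonneg] at this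

theorem mul_inf (h : IsReducedFRing A) {c : A} (hc : 0 ≤ c) (y z : A) :
    c * (y ⊓ z) = c * y ⊓ c * z := by
  have := h.mul_sup hc (-y) (-z)
  rw [← neg_inf, mul_neg, mul_neg, mul_neg, ← neg_inf] at this
  exact neg_injective this

/-- Positivity of `1` is not among the axioms. For `u = 1 ⊔ 0`, distributing `u` over `1 ⊔ 0` gives
`u² = u`. Hence `(u - 1)² = -(u - 1)`, and the nonnegative element `u - 1` is also nonpositive. -/
theorem one_nonneg (h : IsReducedFRing A) : (0 : A) ≤ 1 := by
  set u : A := 1 ⊔ 0 with hu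
  have hu0 : 0 ≤ u := le_sup_right
  have huu : u * u = u := by
    have := h.mul_sup hu0 1 0
    rwa [mul_one, mul_zero, sup_eq_left.2 hu0] at this
  have hv0 : 0 ≤ u - 1 := sub_nonneg.2 le_sup_left
  have hv : u - 1 = 0 := by
    refine le_antisymm ?_ hv0
    have := h.mul_nonneg hv0 hv0
    have e : (u - 1) * (u - 1) = -(u - 1) := by linear_combination huu
    rw [e] at this
    exact neg_nonneg.1 this
  rw [← sub_eq_zero.1 hv]
  exact hu0

/-- The element `1` is a weak order unit. Disjointness gives `y ⊔ 1 = y + 1`; multiplying this by `y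
+ 1` and distributing yields `y = -(y² ⊓ 1) ≤ 0`. -/
theorem eq_zero_of_inf_one (h : IsReducedFRing A) {y : A} (hy : 0 ≤ y) (hy1 : y ⊓ 1 = 0) :
    y = 0 := by
  have h1 := h.one_nonneg
  have e1 : y ⊔ 1 = y + 1 := by
    have := inf_add_sup y 1
    rw [hy1, zero_add] at this
    exact this
  have e2 : (y + 1) * (y + 1) = (y + 1) * y ⊔ (y + 1) * 1 := by
    have := h.mul_sup (add_nonneg hy h1) y 1
    rwa [e1] at this
  have e3 : (y + 1) * y ⊔ (y + 1) * 1 = y + (y * y ⊔ 1) := by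
    rw [add_sup]
    congr 1 <;> ring
  have e4 : (y * y ⊓ 1) + (y * y ⊔ 1) = y * y + 1 := inf_add_sup _ _
  have e5 : y = -(y * y ⊓ 1) := by linear_combination e2 + e3 + e4
  refine le_antisymm ?_ hy
  rw [e5]
  exact neg_nonpos.2 (le_inf (h.mul_nonneg hy hy) h1)

/-- Truncating `b` at `1` makes `y = a (b ⊓ 1)` smaller than both `a` and `ab`. Then `y² ⊓ y ≤ a² ⊓
ab = a (a ⊓ b) = 0`, so `y (y ⊓ 1) = 0`. Reducedness now kills `y ⊓ 1`, and with it `y`. -/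
theorem mul_inf_one_eq_zero (h : IsReducedFRing A) {a b : A} (ha : 0 ≤ a) (hb : 0 ≤ b)
    (hab : a ⊓ b = 0) : a * (b ⊓ 1) = 0 := by
  have h1 := h.one_nonneg
  have hb1 : 0 ≤ b ⊓ 1 := le_inf hb h1
  set y := a * (b ⊓ 1) with hy
  have hy0 : 0 ≤ y := h.mul_nonneg ha hb1
  have e1 : a * a ⊓ a * b = 0 := by rw [← h.mul_inf ha, hab, mul_zero]
  have hyab : y ≤ a * b := h.mul_le_mul_left ha inf_le_left
  have hya : y ≤ a := by simpa using h.mul_le_mul_left ha (inf_le_right : b ⊓ 1 ≤ 1)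
  have hyy : y * y ≤ a * a := by
    refine (h.mul_le_mul_left hy0 hya).trans ?_
    rw [mul_comm]
    exact h.mul_le_mul_left ha hya
  have e2 : y * y ⊓ y = 0 := by
    refine le_antisymm ?_ (le_inf (h.mul_nonneg hy0 hy0) hy0)
    rw [← e1]
    exact inf_le_inf hyy hyab
  have e3 : y * (y ⊓ 1) = 0 := by rw [h.mul_inf hy0, mul_one, e2]
  have hy1 : 0 ≤ y ⊓ 1 := le_inf hy0 h1
  refine h.eq_zero_of_inf_one hy0 (h.reduced _ (le_antisymm ?_ (h.mul_nonneg hy1 hy1)))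
  rw [← e3, mul_comm y]
  exact h.mul_le_mul_left hy1 inf_le_left

/-- Disjoint elements have product zero. -/
theorem mul_eq_zero_of_inf_eq_zero (h : IsReducedFRing A) {a b : A} (ha : 0 ≤ a) (hb : 0 ≤ b)
    (hab : a ⊓ b = 0) : a * b = 0 := by
  have h1 := h.one_nonneg
  set p := a * b with hp
  have hp0 : 0 ≤ p := h.mul_nonneg ha hb
  have hp1 : 0 ≤ p ⊓ 1 := le_inf hp0 h1
  -- The truncation is removed by applying the previous lemma to the disjoint pair `a²`, `ab`. From
  -- `a² (p ⊓ 1) = 0` reducedness gives `a (p ⊓ 1) = 0`, and then `(p ⊓ 1)² ≤ p (p ⊓ 1) = 0`.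
  have e1 : a * a ⊓ p = 0 := by rw [hp, ← h.mul_inf ha, hab, mul_zero]
  have e2 : a * a * (p ⊓ 1) = 0 := h.mul_inf_one_eq_zero (h.mul_nonneg ha ha) hp0 e1
  have e3 : a * (p ⊓ 1) = 0 := h.reduced _ (by linear_combination (p ⊓ 1) * e2)
  have e4 : p * (p ⊓ 1) = 0 := by rw [hp]; linear_combination b * e3
  refine h.eq_zero_of_inf_one hp0 (h.reduced _ (le_antisymm ?_ (h.mul_nonneg hp1 hp1)))
  rw [← e4, mul_comm p]
  exact h.mul_le_mul_left hp1 inf_le_left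

/-- The two factors are disjoint: their infimum is `x ⊔ y - (x ⊔ y)`. In a field this equation says
that `x ⊔ y` is one of `x`, `y`, so homomorphisms to ordered fields that preserve `≥ 0` must
preserve `∨`. -/
theorem sup_sub_mul_sup_sub (h : IsReducedFRing A) (x y : A) :
    (x ⊔ y - x) * (x ⊔ y - y) = 0 := by
  refine h.mul_eq_zero_of_inf_eq_zero (sub_nonneg.2 le_sup_left) (sub_nonneg.2 le_sup_right) ?_
  have : x ⊔ y - x ⊓ y ≥ 0 := sub_nonneg.2 inf_le_sup
  rw [sub_eq_add_neg, sub_eq_add_neg, ← add_inf, ← neg_sup, add_neg_cancel]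

theorem posPart_mul_negPart (h : IsReducedFRing A) (x : A) : (x ⊔ 0) * (x ⊔ 0 - x) = 0 := by
  have := h.sup_sub_mul_sup_sub x 0
  linear_combination this

/-- The positive and negative parts are orthogonal, so `x²` is the sum of their squares. -/
theorem mul_self_nonneg (h : IsReducedFRing A) (x : A) : 0 ≤ x * x := by
  have e := h.posPart_mul_negPart x
  have h0 : (0 : A) ≤ x ⊔ 0 := le_sup_right
  have h1 : 0 ≤ x ⊔ 0 - x := sub_nonneg.2 le_sup_left
  have : x * x = (x ⊔ 0) * (x ⊔ 0) + (x ⊔ 0 - x) * (x ⊔ 0 - x) := by linear_combination -2 * e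
  rw [this]
  exact add_nonneg (h.mul_nonneg h0 h0) (h.mul_nonneg h1 h1)

/-- Multiply by the negative part `m`. Since `m x = -m²`, the product `m x (x² + c)` equals `-(m⁴ +
m² c)`. As it is nonnegative, `m⁴ = 0`, hence `m = 0`. -/
theorem nonneg_of_mul (h : IsReducedFRing A) {x c : A} (hc : 0 ≤ c)
    (hx : 0 ≤ x * (x * x + c)) : 0 ≤ x := by
  set m := x ⊔ 0 - x with hm
  have h0 : 0 ≤ m := sub_nonneg.2 le_sup_left
  have e : (x ⊔ 0) * m = 0 := h.posPart_mul_negPart x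
  have hmx : m * x = -(m * m) := by rw [hm] at e ⊢; linear_combination e
  have h2 : 0 ≤ m * m := h.mul_nonneg h0 h0
  have h3 : m * (x * (x * x + c)) = -(m * m * (m * m) + m * m * c) := by
    linear_combination (x * x + c + m * m - m * x) * hmx
  have h4 : m * m * (m * m) ≤ 0 := by
    have := h.mul_nonneg h0 hx
    rw [h3, neg_nonneg] at this
    exact (le_add_of_nonneg_right (h.mul_nonneg h2 hc)).trans this
  have h5 : m = 0 := h.reduced _ (h.reduced _ (le_antisymm h4 (h.mul_nonneg h2 h2)))
  rw [← sub_eq_zero.1 h5]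
  exact le_sup_right

end IsReducedFRing

end FRing

/-- The lattice order of an abelian group with a semilattice operation that is translation
invariant. -/
abbrev latticeOfSup {A : Type v} [AddCommGroup A] (sup : A → A → A) (idem : ∀ x, sup x x = x)
    (comm : ∀ x y, sup x y = sup y x) (assoc : ∀ x y z, sup (sup x y) z = sup x (sup y z))
    (add : ∀ x y z, x + sup y z = sup (x + y) (x + z)) : Lattice A :=
  -- Translation by `-a - b` shows that negation reverses the order, which makes `-(-a ∨ -b)` an
  -- infimum.
  have neg : ∀ a b, sup a b = b → sup (-b) (-a) = -a := by
    intro a b h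
    have := add (-a - b) a b
    rw [h] at this
    convert this.symm using 2 <;> abel
  have left : ∀ a b, sup a (sup a b) = sup a b := fun a b => by rw [← assoc, idem]
  have right : ∀ a b, sup b (sup a b) = sup a b := fun a b => by rw [comm a b, left]
  { sup := sup
    inf := fun a b => -(sup (-a) (-b))
    le := fun a b => sup a b = b
    lt := fun a b => sup a b = b ∧ ¬ sup b a = a
    lt_iff_le_not_ge := fun _ _ => Iff.rfl
    le_refl := idem
    le_trans := fun a b c hab hbc => by
      rw [← hbc, ← assoc, hab]
    le_antisymm := fun a b hab hba => by rw [← hab, comm, hba]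
    le_sup_left := left
    le_sup_right := right
    sup_le := fun a b c hac hbc => by
      rw [assoc, hbc, hac]
    inf_le_left := fun a b => by
      have := neg _ _ (left (-a) (-b))
      rwa [neg_neg] at this
    inf_le_right := fun a b => by
      have := neg _ _ (right (-a) (-b))
      rwa [neg_neg] at this
    le_inf := fun a b c hab hac => by
      have : sup (sup (-b) (-c)) (-a) = -a := by rw [assoc, neg _ _ hac, neg _ _ hab]
      have := neg _ _ this
      rwa [neg_neg] at this }

/-- The partial order with a given positive cone. -/
abbrev partialOrderOfCone {A : Type v} [CommRing A] (P : Set A) (zero : 0 ∈ P)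
    (add : ∀ x y, x ∈ P → y ∈ P → x + y ∈ P) (anti : ∀ x, x ∈ P → -x ∈ P → x = 0) :
    PartialOrder A where
  le x y := y - x ∈ P
  le_refl x := by rwa [sub_self]
  le_trans x y z hxy hyz := by
    have := add _ _ hyz hxy
    rwa [sub_add_sub_cancel] at this
  le_antisymm x y hxy hyx := by
    refine (sub_eq_zero.1 (anti (y - x) hxy ?_)).symm
    rwa [neg_sub]

/-! ### Interpretations that are reduced f-rings. -/

section Models

variable {S : Signature} {A : Type v} [CommRing A] {I : Interp A}

theorem Interp.models_Apo : I.Models (Apo S) ↔ 0 ∈ I.nonneg ∧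
    (∀ x y : A, x ∈ I.nonneg → y ∈ I.nonneg → x + y ∈ I.nonneg) ∧
    (∀ x : A, x * x ∈ I.nonneg) ∧
    ∀ x y : A, x ∈ I.nonneg → y ∈ I.nonneg → x * y ∈ I.nonneg := by
  simp only [Apo, models_union, models_insert, models_singleton, models_Ac, true_and, models_gao0,
    models_gao1, models_ao1, models_ao2]

theorem Interp.models_Aonz : I.Models (Aonz S) ↔ I.Models (Apo S) ∧
    (∀ x : A, x ∈ I.nonneg → -x ∈ I.nonneg → x = 0) ∧
    ∀ x y : A, y ∈ I.nonneg → x * (x * x + y) ∈ I.nonneg → x ∈ I.nonneg := by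
  simp only [Aonz, Ao, models_union, models_singleton, models_Gao, models_AonzRule, and_assoc]

theorem Interp.models_Afrnz (hs : S.sup = true) : I.Models (Afrnz S hs) ↔
    (∀ x : A, I.sup x x = x) ∧ (∀ x y : A, I.sup x y = I.sup y x) ∧
    (∀ x y z : A, I.sup (I.sup x y) z = I.sup x (I.sup y z)) ∧
    (∀ x y z : A, x + I.sup y z = I.sup (x + y) (x + z)) ∧
    (∀ x y z : A, I.sup x 0 * I.sup y z = I.sup (I.sup x 0 * y) (I.sup x 0 * z)) ∧
    (∀ x : A, x ∈ I.nonneg → I.sup x 0 = x) ∧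
    (∀ x : A, I.sup x 0 = x → x ∈ I.nonneg) ∧
    ∀ x : A, x * x = 0 → x = 0 := by
  simp only [Afrnz, Afr, models_union, models_insert, models_singleton, models_Ac, true_and,
    models_supEq, models_sdt1, models_sdt2, models_sdt3, models_grl, models_afr,
    models_supNonneg, models_nonnegSup, models_Anz, and_assoc]

/-- A model of the theory of reduced f-rings is a reduced f-ring. -/
theorem Interp.Models.exists_lattice {hs : S.sup = true} (h : I.Models (Afrnz S hs)) :
    ∃ (_ : Lattice A) (_ : IsOrderedAddMonoid A), IsReducedFRing A ∧
      (∀ x y : A, I.sup x y = x ⊔ y) ∧ ∀ x : A, x ∈ I.nonneg ↔ 0 ≤ x := by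
  obtain ⟨idem, comm, assoc, add, mul, nonneg, nonneg', red⟩ := (I.models_Afrnz hs).1 h
  let L : Lattice A := latticeOfSup I.sup idem comm assoc add
  have hle : ∀ x y : A, x ≤ y ↔ I.sup x y = y := fun _ _ => Iff.rfl
  have hadd : ∀ a b : A, a ≤ b → ∀ c, c + a ≤ c + b := fun a b hab c => by
    rw [hle] at hab ⊢
    rw [← add, hab]
  have : IsOrderedAddMonoid A :=
    ⟨fun a b hab c => by simpa only [add_comm] using hadd a b hab c, hadd⟩
  refine ⟨L, this, ⟨mul, red⟩, fun _ _ => rfl, fun x => ?_⟩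
  rw [hle, comm]
  exact ⟨nonneg x, nonneg' x⟩

theorem Interp.Models.aonz_of_afrnz {hs : S.sup = true} (h : I.Models (Afrnz S hs))
    (S' : Signature) : I.Models (Aonz S') := by
  obtain ⟨_, _, hf, hsup, hn⟩ := h.exists_lattice
  simp only [models_Aonz, models_Apo, hn]
  exact ⟨⟨le_rfl, fun _ _ => add_nonneg, hf.mul_self_nonneg, fun _ _ => hf.mul_nonneg⟩,
    fun x h1 h2 => le_antisymm (neg_nonneg.1 h2) h1, fun x y => hf.nonneg_of_mul⟩

/-- An ordered ring where `∨` is the least upper bound, with the distributivity axioms, is a reduced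
f-ring. -/
theorem Interp.models_Afrnz_of_sup (hs : S.sup = true) (hpo : I.Models (Apo S))
    (anti : ∀ x : A, x ∈ I.nonneg → -x ∈ I.nonneg → x = 0)
    (sup1 : ∀ x y : A, I.sup x y - x ∈ I.nonneg) (sup2 : ∀ x y : A, I.sup x y - y ∈ I.nonneg)
    (Sup : ∀ x y z : A, z - x ∈ I.nonneg → z - y ∈ I.nonneg → z - I.sup x y ∈ I.nonneg)
    (grl : ∀ x y z : A, x + I.sup y z = I.sup (x + y) (x + z))
    (afr : ∀ x y z : A, I.sup x 0 * I.sup y z = I.sup (I.sup x 0 * y) (I.sup x 0 * z))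
    (anz : ∀ x : A, x * x = 0 → x = 0) : I.Models (Afrnz S hs) := by
  obtain ⟨zero, add, -, -⟩ := I.models_Apo.1 hpo
  let O : PartialOrder A := partialOrderOfCone I.nonneg zero add anti
  let L : SemilatticeSup A :=
    { O with
      sup := I.sup
      le_sup_left := sup1
      le_sup_right := sup2
      sup_le := Sup }
  have hn : ∀ x : A, x ∈ I.nonneg ↔ (0 : A) ≤ x := fun x => by
    change _ ↔ x - 0 ∈ I.nonneg
    rw [sub_zero]
  refine (I.models_Afrnz hs).2 ⟨fun x => sup_idem x, fun x y => sup_comm x y,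
    fun x y z => sup_assoc x y z, grl, afr, fun x hx => sup_eq_left.2 ((hn x).1 hx),
    fun x hx => (hn x).2 (sup_eq_left.1 hx), anz⟩

end Models

/-! ### Prime cones -/

section Cones

variable {A : Type v} [CommRing A]

/-- A set closed under addition and multiplication that contains all squares. -/
structure IsCone (P : Set A) : Prop where
  add : ∀ x y, x ∈ P → y ∈ P → x + y ∈ P
  mul : ∀ x y, x ∈ P → y ∈ P → x * y ∈ P
  sq : ∀ x, x * x ∈ P

namespace IsCone

variable {P : Set A}

theorem zero (h : IsCone P) : 0 ∈ P := by simpa using h.sq 0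

theorem one (h : IsCone P) : 1 ∈ P := by simpa using h.sq 1

/-- The cone generated by a cone and an element. -/
theorem adjoin (h : IsCone P) (a : A) : IsCone {x | ∃ p ∈ P, ∃ q ∈ P, x = p + a * q} where
  add := by
    rintro _ _ ⟨p, hp, q, hq, rfl⟩ ⟨p', hp', q', hq', rfl⟩
    exact ⟨_, h.add _ _ hp hp', _, h.add _ _ hq hq', by ring⟩
  mul := by
    rintro _ _ ⟨p, hp, q, hq, rfl⟩ ⟨p', hp', q', hq', rfl⟩
    exact ⟨p * p' + a * a * (q * q'), h.add _ _ (h.mul _ _ hp hp')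
      (h.mul _ _ (h.sq a) (h.mul _ _ hq hq')), p * q' + q * p',
      h.add _ _ (h.mul _ _ hp hq') (h.mul _ _ hq hp'), by ring⟩
  sq x := ⟨x * x, h.sq x, 0, h.zero, by ring⟩

theorem subset_adjoin (h : IsCone P) (a : A) : P ⊆ {x | ∃ p ∈ P, ∃ q ∈ P, x = p + a * q} :=
  fun x hx => ⟨x, hx, 0, h.zero, by ring⟩

theorem mem_adjoin (h : IsCone P) (a : A) : a ∈ {x | ∃ p ∈ P, ∃ q ∈ P, x = p + a * q} :=
  ⟨0, h.zero, 1, h.one, by ring⟩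

end IsCone

/-- A total cone whose support is prime. -/
structure IsPrimeCone (Q : Set A) : Prop extends IsCone Q where
  total : ∀ x, x ∈ Q ∨ -x ∈ Q
  prime : ∀ x y, x * y ∈ Q → -(x * y) ∈ Q → (x ∈ Q ∧ -x ∈ Q) ∨ (y ∈ Q ∧ -y ∈ Q)

/-- Take a cone `Q` maximal among those containing `P` and missing `-M`. An element `a` outside `Q`
cannot be adjoined, so `-s = p + a q` with `s ∈ M` and `p, q ∈ Q`. Multiplying two such relations
puts `-(s s')` in `Q`, which gives totality and then primality. The inclusion of `M` in `P` keeps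
the mixed terms `s p'` in `Q`. -/
theorem IsCone.exists_isPrimeCone {P : Set A} (hP : IsCone P) (M : Submonoid A)
    (hMP : ∀ s ∈ M, s ∈ P) (hM : ∀ s ∈ M, -s ∉ P) :
    ∃ Q, IsPrimeCone Q ∧ P ⊆ Q ∧ ∀ s ∈ M, -s ∉ Q := by
  obtain ⟨Q, hPQ, hmax⟩ := zorn_subset_nonempty {Q : Set A | IsCone Q ∧ ∀ s ∈ M, -s ∉ Q} (by
    intro c hc hchain ⟨Q₀, hQ₀⟩
    refine ⟨⋃₀ c, ⟨⟨?_, ?_, fun x => ⟨Q₀, hQ₀, (hc hQ₀).1.sq x⟩⟩, ?_⟩,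
      fun s hs => Set.subset_sUnion_of_mem hs⟩
    · rintro x y ⟨Q₁, h₁, hx⟩ ⟨Q₂, h₂, hy⟩
      rcases hchain.total h₁ h₂ with h | h
      · exact ⟨Q₂, h₂, (hc h₂).1.add _ _ (h hx) hy⟩
      · exact ⟨Q₁, h₁, (hc h₁).1.add _ _ hx (h hy)⟩
    · rintro x y ⟨Q₁, h₁, hx⟩ ⟨Q₂, h₂, hy⟩
      rcases hchain.total h₁ h₂ with h | h
      · exact ⟨Q₂, h₂, (hc h₂).1.mul _ _ (h hx) hy⟩
      · exact ⟨Q₁, h₁, (hc h₁).1.mul _ _ hx (h hy)⟩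
    · rintro s hs ⟨Q₁, h₁, h⟩
      exact (hc h₁).2 s hs h) P ⟨hP, hM⟩
  obtain ⟨hQ, hMQ⟩ := hmax.prop
  have key : ∀ a, a ∉ Q → ∃ s ∈ M, ∃ p ∈ Q, ∃ q ∈ Q, -s = p + a * q := by
    intro a ha
    by_contra! hn
    refine ha (hmax.le_of_ge ⟨hQ.adjoin a, ?_⟩ (hQ.subset_adjoin a) (hQ.mem_adjoin a))
    rintro s hs ⟨p, hp, q, hq, h⟩
    exact hn s hs p hp q hq h
  have total : ∀ x, x ∈ Q ∨ -x ∈ Q := by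
    intro x
    by_contra! hx
    obtain ⟨s, hs, p, hp, q, hq, h⟩ := key _ hx.1
    obtain ⟨s', hs', p', hp', q', hq', h'⟩ := key _ hx.2
    refine hMQ _ (M.mul_mem hs hs') ?_
    -- This expands `(s + p)(s' + p') = (-x q)(x q')`.
    have : -(s * s') = x * x * (q * q') + (s * p' + p * s' + p * p') := by
      linear_combination (s' + p') * h - x * q * h'
    rw [this]
    exact hQ.add _ _ (hQ.mul _ _ (hQ.sq x) (hQ.mul _ _ hq hq'))
      (hQ.add _ _ (hQ.add _ _ (hQ.mul _ _ (hPQ (hMP s hs)) hp')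
        (hQ.mul _ _ hp (hPQ (hMP s' hs')))) (hQ.mul _ _ hp hp'))
  have prime : ∀ x y, x * y ∈ Q → -(x * y) ∈ Q → -x ∉ Q → -y ∉ Q → False := by
    intro x y _ hxy hx hy
    obtain ⟨s, hs, p, hp, q, hq, h⟩ := key _ hx
    obtain ⟨s', hs', p', hp', q', hq', h'⟩ := key _ hy
    refine hMQ _ (M.mul_mem hs hs') ?_
    have : -(s * s') = -(x * y) * (q * q') + (s * p' + p * s' + p * p') := by
      linear_combination (s' + p') * h + x * q * h'
    rw [this]
    exact hQ.add _ _ (hQ.mul _ _ hxy (hQ.mul _ _ hq hq'))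
      (hQ.add _ _ (hQ.add _ _ (hQ.mul _ _ (hPQ (hMP s hs)) hp')
        (hQ.mul _ _ hp (hPQ (hMP s' hs')))) (hQ.mul _ _ hp hp'))
  refine ⟨Q, ⟨hQ, total, fun x y h h' => ?_⟩, hPQ, hMQ⟩
  by_contra! hn
  obtain ⟨hx, hy⟩ := hn
  -- Changing the signs of `x` and `y` where necessary reduces all cases to `-x ∉ Q` and `-y ∉ Q`.
  by_cases hx1 : x ∈ Q <;> by_cases hy1 : y ∈ Q
  · exact prime x y h h' (hx hx1) (hy hy1)
  · exact prime x (-y) (by simpa using h') (by simpa using h) (hx hx1) (by simpa using hy1)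
  · exact prime (-x) y (by simpa using h') (by simpa using h) (by simpa using hx1) (hy hy1)
  · exact prime (-x) (-y) (by simpa using h) (by simpa using h') (by simpa using hx1)
      (by simpa using hy1)

end Cones

/-! ### Extension of orderings to root fields -/

section RootField

open Polynomial

variable {K : Type v} [Field K] [LinearOrder K]

/-- The sums of nonnegative multiples of squares of polynomials. -/
noncomputable def weightedSquares (K : Type v) [Field K] [LinearOrder K] : AddSubmonoid K[X] :=
  AddSubmonoid.closure {s | ∃ p : K, 0 ≤ p ∧ ∃ g : K[X], s = C p * (g * g)}

/-- Reduction modulo a polynomial. -/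
theorem exists_reduced_of_mem_weightedSquares {f : K[X]} (hf : 0 < f.natDegree) {s : K[X]}
    (hs : s ∈ weightedSquares K) :
    ∃ t ∈ weightedSquares K, f ∣ s - t ∧ t.natDegree ≤ 2 * (f.natDegree - 1) := by
  induction hs using AddSubmonoid.closure_induction with
  | mem s h =>
    obtain ⟨p, hp, g, rfl⟩ := h
    refine ⟨C p * ((g % f) * (g % f)), AddSubmonoid.subset_closure ⟨p, hp, _, rfl⟩, ?_, ?_⟩
    · have h1 : f ∣ g - g % f := ⟨g / f, by linear_combination -EuclideanDomain.mod_add_div g f⟩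
      have : C p * (g * g) - C p * ((g % f) * (g % f)) = (g - g % f) * (C p * (g + g % f)) := by
        ring
      rw [this]
      exact h1.mul_right _
    · have h1 : (g % f).natDegree < f.natDegree := natDegree_mod_lt g hf.ne'
      calc (C p * ((g % f) * (g % f))).natDegree ≤ ((g % f) * (g % f)).natDegree :=
            natDegree_C_mul_le _ _
        _ ≤ (g % f).natDegree + (g % f).natDegree := natDegree_mul_le
        _ ≤ _ := by omega
  | zero => exact ⟨0, zero_mem _, by simp, by simp⟩
  | add s s' _ _ hs hs' =>
    obtain ⟨t, ht, h1, h2⟩ := hs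
    obtain ⟨t', ht', h1', h2'⟩ := hs'
    refine ⟨t + t', add_mem ht ht', ?_, (natDegree_add_le _ _).trans (max_le h2 h2')⟩
    rw [add_sub_add_comm]
    exact dvd_add h1 h1'

variable [IsStrictOrderedRing K]

theorem eval_nonneg_of_mem_weightedSquares {s : K[X]} (hs : s ∈ weightedSquares K) (x : K) :
    0 ≤ s.eval x := by
  induction hs using AddSubmonoid.closure_induction with
  | mem s h =>
    obtain ⟨p, hp, g, rfl⟩ := h
    simpa using mul_nonneg hp (mul_self_nonneg (g.eval x))
  | zero => simp
  | add s t _ _ hs ht => simpa using add_nonneg hs ht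

theorem mul_mem_weightedSquares {s t : K[X]} (hs : s ∈ weightedSquares K)
    (ht : t ∈ weightedSquares K) : s * t ∈ weightedSquares K := by
  induction hs using AddSubmonoid.closure_induction with
  | mem s h =>
    obtain ⟨p, hp, g, rfl⟩ := h
    induction ht using AddSubmonoid.closure_induction with
    | mem t h =>
      obtain ⟨q, hq, k, rfl⟩ := h
      exact AddSubmonoid.subset_closure ⟨p * q, mul_nonneg hp hq, g * k, by rw [C_mul]; ring⟩
    | zero => rw [mul_zero]; exact zero_mem _
    | add t t' _ _ ht ht' => rw [mul_add]; exact add_mem ht ht'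
  | zero => rw [zero_mul]; exact zero_mem _
  | add s s' _ _ hs hs' => rw [add_mul]; exact add_mem hs hs'

/-- Descent on the degree. If `f ∣ 1 + s`, reduce `s` modulo `f` and write `1 + t = f h`. The left
side is positive at `a` and `b`, so `h` changes sign as `f` does, and `h` divides `1 + t` too. The
degree bound makes `h` smaller than `f`, and constants do not change sign. -/
theorem not_dvd_one_add_of_mem_weightedSquares {a b : K} (n : ℕ) :
    ∀ f : K[X], f.natDegree = n → f.eval a * f.eval b < 0 → ∀ s ∈ weightedSquares K,
      ¬ f ∣ 1 + s := by
  induction n using Nat.strong_induction_on with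
  | _ n ih =>
    intro f hfn hf s hs hdvd
    have hpos : 0 < f.natDegree := by
      rw [pos_iff_ne_zero]
      intro h0
      rw [eq_C_of_natDegree_eq_zero h0, eval_C, eval_C] at hf
      exact absurd hf (not_lt.2 (mul_self_nonneg _))
    obtain ⟨t, ht, h1, h2⟩ := exists_reduced_of_mem_weightedSquares hpos hs
    have hdvd' : f ∣ 1 + t := by
      have := dvd_sub hdvd h1
      rwa [show 1 + s - (s - t) = 1 + t by ring] at this
    obtain ⟨h, hh⟩ := hdvd'
    have ev : ∀ x, 0 < f.eval x * h.eval x := by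
      intro x
      rw [← eval_mul, ← hh, eval_add, eval_one]
      exact add_pos_of_pos_of_nonneg one_pos (eval_nonneg_of_mem_weightedSquares ht x)
    have hf0 : f ≠ 0 := by rintro rfl; simp at hf
    have hh0 : h ≠ 0 := by rintro rfl; simpa using ev a
    -- The remainders have degree below that of `f`, hence the factor `2 * (f.natDegree - 1)`; the
    -- cofactor loses at least two degrees.
    have hdeg : f.natDegree + h.natDegree ≤ 2 * (f.natDegree - 1) := by
      rw [← natDegree_mul hf0 hh0, ← hh]
      refine (natDegree_add_le _ _).trans (max_le ?_ h2)
      simp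
    refine ih h.natDegree (by omega) h rfl ?_ t ht ⟨f, by rw [hh, mul_comm]⟩
    have h3 := mul_pos (ev a) (ev b)
    rw [mul_mul_mul_comm] at h3
    exact neg_of_mul_pos_right h3 hf.le

/-- The order of a field extends to the root field of an irreducible polynomial that changes
sign. -/
theorem exists_ordering_adjoinRoot {f : K[X]} [Fact (Irreducible f)] {a b : K}
    (hf : f.eval a * f.eval b < 0) :
    ∃ R : Set (AdjoinRoot f), IsPrimeCone R ∧ (∀ p : K, 0 ≤ p → AdjoinRoot.of f p ∈ R) ∧
      ∀ x, x ∈ R → -x ∈ R → x = 0 := by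
  have hP : IsCone {x : AdjoinRoot f | ∃ s ∈ weightedSquares K, x = AdjoinRoot.mk f s} :=
    { add := by
        rintro _ _ ⟨s, hs, rfl⟩ ⟨t, ht, rfl⟩
        exact ⟨_, add_mem hs ht, (map_add _ _ _).symm⟩
      mul := by
        rintro _ _ ⟨s, hs, rfl⟩ ⟨t, ht, rfl⟩
        exact ⟨_, mul_mem_weightedSquares hs ht, (map_mul _ _ _).symm⟩
      sq := by
        intro x
        obtain ⟨g, rfl⟩ := AdjoinRoot.mk_surjective x
        exact ⟨g * g, AddSubmonoid.subset_closure ⟨1, zero_le_one, g, by simp⟩,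
          (map_mul _ _ _).symm⟩ }
  -- The monoid is trivial: only `-1` has to be avoided. It would lie in the cone exactly if `f`
  -- divided some `1 + t` with `t` a weighted sum of squares.
  obtain ⟨R, hR, hPR, hone⟩ := hP.exists_isPrimeCone ⊥ (by
    intro s hs
    rw [Submonoid.mem_bot.1 hs]
    exact hP.one) (by
    rintro s hs ⟨t, ht, h⟩
    rw [Submonoid.mem_bot.1 hs] at h
    refine not_dvd_one_add_of_mem_weightedSquares _ f rfl hf t ht ?_
    rw [← AdjoinRoot.mk_eq_zero, map_add, map_one, ← h, add_neg_cancel])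
  refine ⟨R, hR, fun p hp => hPR ⟨C p, ?_, rfl⟩, fun x hx hx' => ?_⟩
  · exact AddSubmonoid.subset_closure ⟨p, hp, 1, by simp⟩
  -- In a field a nonzero `x` with `x` and `-x` both in `R` would give `-1 = x (-x) (x⁻¹)² ∈ R`.
  · by_contra h0
    refine hone 1 (one_mem _) ?_
    have := hR.mul _ _ (hR.mul _ _ hx hx') (hR.sq x⁻¹)
    rwa [show x * -x * (x⁻¹ * x⁻¹) = -1 by field_simp] at this

/-- The values `f(a) f(b)` are multiplicative in `f`, so a negative one forces a negative one on
some irreducible factor. -/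
theorem exists_irreducible_factor_of_sign_change {a b : K} (f : K[X])
    (hf : f.eval a * f.eval b < 0) :
    ∃ g, Irreducible g ∧ g ∣ f ∧ g.eval a * g.eval b < 0 := by
  induction f using WfDvdMonoid.induction_on_irreducible with
  | zero => simp at hf
  | unit u hu =>
    obtain ⟨c, -, rfl⟩ := Polynomial.isUnit_iff.1 hu
    rw [eval_C, eval_C] at hf
    exact absurd hf (not_lt.2 (mul_self_nonneg _))
  | mul f p hf0 hp ih =>
    by_cases hpab : p.eval a * p.eval b < 0
    · exact ⟨p, hp, dvd_mul_right _ _, hpab⟩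
    · rw [eval_mul, eval_mul, mul_mul_mul_comm] at hf
      obtain ⟨g, hg, hgf, hgab⟩ := ih (by
        by_contra hn
        exact absurd hf (not_lt.2 (mul_nonneg (not_lt.1 hpab) (not_lt.1 hn))))
      exact ⟨g, hg, hgf.mul_left _, hgab⟩

/-- The intermediate value property for polynomials. -/
def PolynomialIVT (K : Type v) [Field K] [LinearOrder K] : Prop :=
  ∀ (f : K[X]) (a b : K), a < b → f.eval a * f.eval b < 0 → ∃ x, f.eval x = 0 ∧ a < x ∧ x < b

/-- An irreducible factor with a root `x` is a constant times `X - x`, and its change of sign places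
`x` strictly between `a` and `b`. So the position of the root need not be controlled beforehand. -/
theorem polynomialIVT_of_irreducible
    (h : ∀ (f : K[X]) (a b : K), Irreducible f → f.eval a * f.eval b < 0 → ∃ x, f.eval x = 0) :
    PolynomialIVT K := by
  intro f a b hab hf
  obtain ⟨g, hg, hgf, hgab⟩ := exists_irreducible_factor_of_sign_change f hf
  obtain ⟨x, hx⟩ := h g a b hg hgab
  obtain ⟨c, hc⟩ := dvd_iff_isRoot.2 hx
  have hcu : IsUnit c := (hg.isUnit_or_isUnit hc).resolve_left (not_isUnit_X_sub_C x)
  obtain ⟨k, -, rfl⟩ := Polynomial.isUnit_iff.1 hcu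
  refine ⟨x, eval_eq_zero_of_dvd_of_eval_eq_zero hgf hx, ?_⟩
  rw [hc] at hgab
  simp only [eval_mul, eval_sub, eval_X, eval_C] at hgab
  have hk : 0 ≤ k * k := mul_self_nonneg k
  have h1 : (a - x) * (b - x) < 0 := by
    by_contra hn
    have := mul_nonneg hk (not_lt.1 hn)
    linarith [show (a - x) * k * ((b - x) * k) = k * k * ((a - x) * (b - x)) by ring]
  rcases mul_neg_iff.1 h1 with ⟨h2, h3⟩ | ⟨h2, h3⟩
  · exact absurd hab (not_lt.2 (by linarith))
  · exact ⟨by linarith, by linarith⟩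

end RootField

/-! ### Real closure -/

section RealClosure

open Polynomial

variable {Ω : Type v} [Field Ω]

/-- The positive cone of an ordering of a subfield. -/
structure IsSubfieldOrdering (Q : Set Ω) : Prop where
  add : ∀ x y, x ∈ Q → y ∈ Q → x + y ∈ Q
  mul : ∀ x y, x ∈ Q → y ∈ Q → x * y ∈ Q
  inv : ∀ x, x ∈ Q → x⁻¹ ∈ Q
  zero : 0 ∈ Q
  one : 1 ∈ Q
  anti : ∀ x, x ∈ Q → -x ∈ Q → x = 0
  total : ∀ x y, x ∈ Q → y ∈ Q → x - y ∈ Q ∨ y - x ∈ Q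

namespace IsSubfieldOrdering

variable {Q : Set Ω} (hQ : IsSubfieldOrdering Q)

/-- The ordered subfield. -/
def subfield : Subfield Ω where
  carrier := {x | x ∈ Q ∨ -x ∈ Q}
  zero_mem' := .inl hQ.zero
  one_mem' := .inl hQ.one
  neg_mem' := by
    rintro x (hx | hx)
    · exact .inr (by simpa using hx)
    · exact .inl hx
  add_mem' := by
    rintro x y (hx | hx) (hy | hy)
    · exact .inl (hQ.add _ _ hx hy)
    · simpa [add_comm, sub_eq_add_neg] using hQ.total _ _ hx hy
    · simpa [add_comm, sub_eq_add_neg] using hQ.total _ _ hy hx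
    · exact .inr (by simpa [add_comm] using hQ.add _ _ hx hy)
  mul_mem' := by
    rintro x y (hx | hx) (hy | hy)
    · exact .inl (hQ.mul _ _ hx hy)
    · exact .inr (by simpa using hQ.mul _ _ hx hy)
    · exact .inr (by simpa using hQ.mul _ _ hx hy)
    · exact .inl (by simpa using hQ.mul _ _ hx hy)
  inv_mem' := by
    rintro x (hx | hx)
    · exact .inl (hQ.inv _ hx)
    · exact .inr (by simpa [inv_neg] using hQ.inv _ hx)

open Classical in
/-- The order of the subfield. -/
noncomputable abbrev linearOrder : LinearOrder hQ.subfield where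
  le x y := (y : Ω) - x ∈ Q
  le_refl x := by simpa using hQ.zero
  le_trans x y z hxy hyz := by simpa using hQ.add _ _ hyz hxy
  le_antisymm x y hxy hyx := by
    refine Subtype.ext (sub_eq_zero.1 (hQ.anti _ hyx ?_))
    rwa [neg_sub]
  le_total x y := by
    have := (y - x).2
    rcases this with h | h
    · exact .inl h
    · exact .inr (by simpa using h)
  toDecidableLE := _

theorem isStrictOrderedRing :
    letI := hQ.linearOrder
    IsStrictOrderedRing hQ.subfield := by
  let := hQ.linearOrder
  have hle : ∀ x y : hQ.subfield, x ≤ y ↔ (y : Ω) - x ∈ Q := fun _ _ => Iff.rfl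
  have : IsOrderedAddMonoid hQ.subfield :=
    { add_le_add_left := fun a b hab c => by simpa [hle] using hab
      add_le_add_right := fun a b hab c => by simpa [hle] using hab }
  have : ZeroLEOneClass hQ.subfield := ⟨by simpa [hle] using hQ.one⟩
  have : IsOrderedRing hQ.subfield := .of_mul_nonneg fun x y hx hy => by
    simp only [hle, ZeroMemClass.coe_zero, sub_zero, MulMemClass.coe_mul] at hx hy ⊢
    exact hQ.mul _ _ hx hy
  exact IsOrderedRing.toIsStrictOrderedRing _

theorem nonneg_iff (x : hQ.subfield) :
    letI := hQ.linearOrder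
    0 ≤ x ↔ (x : Ω) ∈ Q := by
  let := hQ.linearOrder
  change (x : Ω) - (0 : hQ.subfield) ∈ Q ↔ _
  simp

end IsSubfieldOrdering

/-- Every ordering of a subfield of an algebraically closed field extends to an ordering of a
subfield with the intermediate value property. -/
theorem IsSubfieldOrdering.exists_realClosed [IsAlgClosed Ω] {Q₀ : Set Ω}
    (hQ₀ : IsSubfieldOrdering Q₀) :
    ∃ (Q : Set Ω) (hQ : IsSubfieldOrdering Q), Q₀ ⊆ Q ∧
      letI := hQ.linearOrder
      PolynomialIVT hQ.subfield := by
  -- A cone `Q` determines its subfield `Q ∪ -Q`, so inclusion of cones is extension of ordered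
  -- subfields and chains are bounded by their unions.
  obtain ⟨Q, hQ₀Q, hmax⟩ := zorn_subset_nonempty {Q : Set Ω | IsSubfieldOrdering Q} (by
    intro c hc hchain ⟨Q₁, hQ₁⟩
    have two : ∀ x y, x ∈ ⋃₀ c → y ∈ ⋃₀ c → ∃ s ∈ c, x ∈ s ∧ y ∈ s := by
      rintro x y ⟨s, hs, hx⟩ ⟨t, ht, hy⟩
      rcases hchain.total hs ht with h | h
      · exact ⟨t, ht, h hx, hy⟩
      · exact ⟨s, hs, hx, h hy⟩
    refine ⟨⋃₀ c, ⟨?_, ?_, ?_, ⟨Q₁, hQ₁, (hc hQ₁).zero⟩, ⟨Q₁, hQ₁, (hc hQ₁).one⟩, ?_, ?_⟩,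
      fun s hs => Set.subset_sUnion_of_mem hs⟩
    · intro x y hx hy
      obtain ⟨s, hs, hx, hy⟩ := two x y hx hy
      exact ⟨s, hs, (hc hs).add _ _ hx hy⟩
    · intro x y hx hy
      obtain ⟨s, hs, hx, hy⟩ := two x y hx hy
      exact ⟨s, hs, (hc hs).mul _ _ hx hy⟩
    · rintro x ⟨s, hs, hx⟩
      exact ⟨s, hs, (hc hs).inv _ hx⟩
    · intro x hx hy
      obtain ⟨s, hs, hx, hy⟩ := two x _ hx hy
      exact (hc hs).anti _ hx hy
    · intro x y hx hy
      obtain ⟨s, hs, hx, hy⟩ := two x y hx hy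
      exact ((hc hs).total _ _ hx hy).imp (fun h => ⟨s, hs, h⟩) fun h => ⟨s, hs, h⟩) Q₀ hQ₀
  have hQ : IsSubfieldOrdering Q := hmax.prop
  refine ⟨Q, hQ, hQ₀Q, ?_⟩
  let := hQ.linearOrder
  have := hQ.isStrictOrderedRing
  refine polynomialIVT_of_irreducible fun f a b hf hab => ?_
  have : Fact (Irreducible f) := ⟨hf⟩
  obtain ⟨R, hR, hKR, hanti⟩ := exists_ordering_adjoinRoot hab
  obtain ⟨α, hα⟩ := IsAlgClosed.exists_aeval_eq_zero Ω f hf.degree_pos.ne'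
  let ψ : AdjoinRoot f →+* Ω := AdjoinRoot.lift (algebraMap hQ.subfield Ω) α hα
  have hψ : Function.Injective ψ := ψ.injective
  have hQR : IsSubfieldOrdering (ψ '' R) :=
    { add := by
        rintro _ _ ⟨x, hx, rfl⟩ ⟨y, hy, rfl⟩
        exact ⟨_, hR.add _ _ hx hy, map_add _ _ _⟩
      mul := by
        rintro _ _ ⟨x, hx, rfl⟩ ⟨y, hy, rfl⟩
        exact ⟨_, hR.mul _ _ hx hy, map_mul _ _ _⟩
      inv := by
        rintro _ ⟨x, hx, rfl⟩
        refine ⟨x⁻¹, ?_, map_inv₀ _ _⟩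
        have := hR.mul _ _ hx (hR.sq x⁻¹)
        by_cases h0 : x = 0
        · rwa [h0, inv_zero, ← h0]
        · rwa [← mul_assoc, mul_inv_cancel₀ h0, one_mul] at this
      zero := ⟨0, hR.zero, map_zero _⟩
      one := ⟨1, hR.one, map_one _⟩
      anti := by
        rintro _ ⟨x, hx, rfl⟩ ⟨y, hy, hxy⟩
        rw [← map_neg] at hxy
        rw [hanti x hx (hψ hxy ▸ hy), map_zero]
      total := by
        rintro _ _ ⟨x, hx, rfl⟩ ⟨y, hy, rfl⟩
        rcases hR.total (x - y) with h | h
        · exact .inl ⟨_, h, map_sub _ _ _⟩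
        · exact .inr ⟨_, h, by rw [neg_sub, map_sub]⟩ }
  -- The embedded root field extends the ordering `Q`, so by maximality it adds nothing and the root
  -- `α` already lies in the subfield.
  have hle : ψ '' R ⊆ Q := hmax.le_of_ge hQR fun x hx =>
    ⟨AdjoinRoot.of f ⟨x, .inl hx⟩, hKR _ ((hQ.nonneg_iff _).2 hx), AdjoinRoot.lift_of _⟩
  have hαQ : α ∈ hQ.subfield := by
    rcases hR.total (AdjoinRoot.root f) with h | h
    · exact .inl (hle ⟨_, h, AdjoinRoot.lift_root _⟩)
    · exact .inr (hle ⟨_, h, (map_neg _ _).trans (congrArg _ (AdjoinRoot.lift_root _))⟩)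
  refine ⟨⟨α, hαQ⟩, Subtype.ext ?_⟩
  have : algebraMap hQ.subfield Ω (f.eval ⟨α, hαQ⟩) = 0 := by
    rw [← eval₂_at_apply]
    exact hα
  exact this

/-- A ring with a prime cone maps to an ordered field with the intermediate value property, so that
the cone is the inverse image of the nonnegative elements. -/
theorem IsPrimeCone.exists_hom {A : Type v} [CommRing A] {Q : Set A} (hQ : IsPrimeCone Q)
    (h1 : -1 ∉ Q) :
    ∃ (K : Type v) (_ : Field K) (_ : LinearOrder K) (_ : IsStrictOrderedRing K) (φ : A →+* K),
      PolynomialIVT K ∧ ∀ x, 0 ≤ φ x ↔ x ∈ Q := by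
  -- The support of the cone: totality makes it an ideal, and the primality condition makes the
  -- ideal prime.
  let p : Ideal A :=
    { carrier := {x | x ∈ Q ∧ -x ∈ Q}
      zero_mem' := ⟨hQ.zero, by simpa using hQ.zero⟩
      add_mem' := fun {x y} hx hy => ⟨hQ.add _ _ hx.1 hy.1, by
        rw [neg_add]; exact hQ.add _ _ hx.2 hy.2⟩
      smul_mem' := fun c x hx => by
        rcases hQ.total c with hc | hc
        · exact ⟨hQ.mul _ _ hc hx.1, by simpa using hQ.mul _ _ hc hx.2⟩
        · exact ⟨by simpa using hQ.mul _ _ hc hx.2, by simpa using hQ.mul _ _ hc hx.1⟩ }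
  have hp : p.IsPrime := ⟨fun h => h1 ((p.eq_top_iff_one.1 h).2), fun {x y} h =>
    hQ.prime x y h.1 h.2⟩
  let Ω := AlgebraicClosure (FractionRing (A ⧸ p))
  let φ : A →+* Ω := (algebraMap (FractionRing (A ⧸ p)) Ω).comp
    ((algebraMap (A ⧸ p) (FractionRing (A ⧸ p))).comp (Ideal.Quotient.mk p))
  have hφ : ∀ x, φ x = 0 ↔ x ∈ Q ∧ -x ∈ Q := by
    intro x
    have : φ x = 0 ↔ Ideal.Quotient.mk p x = 0 := by
      simp [φ]
    rw [this, Ideal.Quotient.eq_zero_iff_mem]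
    rfl
  -- Nonnegative fractions are written with squared denominators, so that the sign of a denominator
  -- never matters.
  let Q₀ : Set Ω := {x | ∃ a ∈ Q, ∃ b, φ b ≠ 0 ∧ x * (φ b * φ b) = φ a}
  have mem_of : ∀ a, φ a ∈ Q₀ → a ∈ Q := by
    rintro a ⟨c, hc, b, hb, h⟩
    by_contra ha
    have ha' := (hQ.total a).resolve_left ha
    have h2 : φ (a * (b * b) - c) = 0 := by simp [h]
    have h3 := ((hφ _).1 h2).1
    have h4 : a * (b * b) ∈ Q := by simpa using hQ.add _ _ h3 hc
    have h5 : -(a * (b * b)) ∈ Q := by simpa using hQ.mul _ _ ha' (hQ.sq b)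
    rcases hQ.prime _ _ h4 h5 with h6 | h6
    · exact ha h6.1
    · rcases hQ.prime _ _ h6.1 h6.2 with h7 | h7 <;> exact hb ((hφ b).2 h7)
  have hQ₀ : IsSubfieldOrdering Q₀ :=
    { add := by
        rintro x y ⟨a, ha, b, hb, h⟩ ⟨a', ha', b', hb', h'⟩
        refine ⟨a * (b' * b') + a' * (b * b), hQ.add _ _ (hQ.mul _ _ ha (hQ.sq b'))
          (hQ.mul _ _ ha' (hQ.sq b)), b * b', by simp [hb, hb'], ?_⟩
        simp only [map_mul, map_add]
        linear_combination φ b' * φ b' * h + φ b * φ b * h'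
      mul := by
        rintro x y ⟨a, ha, b, hb, h⟩ ⟨a', ha', b', hb', h'⟩
        refine ⟨a * a', hQ.mul _ _ ha ha', b * b', by simp [hb, hb'], ?_⟩
        simp only [map_mul]
        rw [← h, ← h']
        ring
      inv := by
        rintro x ⟨a, ha, b, hb, h⟩
        by_cases hx : x = 0
        · exact ⟨0, hQ.zero, 1, by simp, by simp [hx]⟩
        · have ha0 : φ a ≠ 0 := by rw [← h]; simp [hx, hb]
          refine ⟨a * (b * b), hQ.mul _ _ ha (hQ.sq b), a, ha0, ?_⟩
          rw [inv_mul_eq_iff_eq_mul₀ hx]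
          simp only [map_mul]
          linear_combination -φ a * h
      zero := ⟨0, hQ.zero, 1, by simp, by simp⟩
      one := ⟨1, hQ.one, 1, by simp, by simp⟩
      anti := by
        rintro x ⟨a, ha, b, hb, h⟩ ⟨a', ha', b', hb', h'⟩
        have h2 : φ (a * (b' * b') + a' * (b * b)) = 0 := by
          simp only [map_mul, map_add]
          linear_combination -φ b' * φ b' * h - φ b * φ b * h'
        have h3 : φ (a * (b' * b')) = 0 := by
          refine (hφ _).2 ⟨hQ.mul _ _ ha (hQ.sq b'), ?_⟩
          have := hQ.add _ _ ((hφ _).1 h2).2 (hQ.mul _ _ ha' (hQ.sq b))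
          simpa using this
        have h4 : φ a = 0 := by simpa [hb'] using h3
        rw [h4] at h
        simpa [hb] using h
      total := by
        rintro x y ⟨a, ha, b, hb, h⟩ ⟨a', ha', b', hb', h'⟩
        have hbb : φ (b * b') ≠ 0 := by simp [hb, hb']
        rcases hQ.total (a * (b' * b') - a' * (b * b)) with h2 | h2
        · refine .inl ⟨_, h2, b * b', hbb, ?_⟩
          simp only [map_mul, map_sub]
          linear_combination φ b' * φ b' * h - φ b * φ b * h'
        · refine .inr ⟨_, h2, b * b', hbb, ?_⟩
          simp only [map_mul, map_sub, map_neg]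
          linear_combination -φ b' * φ b' * h + φ b * φ b * h' }
  obtain ⟨Q', hQ', hsub, hIVT⟩ := hQ₀.exists_realClosed
  have hmem : ∀ a ∈ Q, φ a ∈ Q' := fun a ha => hsub ⟨a, ha, 1, by simp, by simp⟩
  let ψ : A →+* hQ'.subfield := φ.codRestrict hQ'.subfield fun a =>
    (hQ.total a).imp (hmem a) fun h => by simpa using hmem _ h
  refine ⟨hQ'.subfield, inferInstance, hQ'.linearOrder, hQ'.isStrictOrderedRing, ψ, hIVT,
    fun x => ?_⟩
  rw [hQ'.nonneg_iff]
  refine ⟨fun hx => ?_, hmem x⟩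
  -- If `x ∉ Q` then `-x ∈ Q`, so `φ x` has both signs and vanishes; but then `x` lies in the
  -- support of `Q`.
  by_contra hn
  have h2 := (hQ.total x).resolve_left hn
  have h3 : φ x = 0 := hQ'.anti _ hx (by simpa using hmem _ h2)
  exact hn ((hφ x).1 h3).1

end RealClosure

/-! ### Points of strictly reduced ordered rings in real closed fields -/

section Points

variable {A : Type v} [CommRing A] {P : Set A}

/-- With `y = 0` the hypothesis extracts cube roots, hence `3^k`-th roots. Any odd power can be
raised to the exponent `3^m` by multiplying it with a square. -/
theorem IsCone.mem_of_odd_pow (hP : IsCone P)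
    (aonz : ∀ x y, y ∈ P → x * (x * x + y) ∈ P → x ∈ P) {t : A} (m : ℕ)
    (h : t ^ (2 * m + 1) ∈ P) : t ∈ P := by
  have key : ∀ k : ℕ, t ^ 3 ^ k ∈ P → t ∈ P := by
    intro k
    induction k with
    | zero => simp
    | succ k ih =>
      intro hk
      refine ih (aonz _ 0 hP.zero ?_)
      rw [add_zero]
      convert hk using 1
      ring
  obtain ⟨j, hj⟩ : Odd (3 ^ m) := Odd.pow (by decide)
  -- Bernoulli's inequality `1 + 2m ≤ 3^m`.
  have hmj : m ≤ j := by
    have := one_add_mul_le_pow (show (-2 : ℤ) ≤ 2 by norm_num) m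
    norm_num at this
    have h3 : ((3 ^ m : ℕ) : ℤ) = 2 * j + 1 := by exact_mod_cast hj
    push_cast at h3
    lia
  obtain ⟨i, rfl⟩ := Nat.exists_eq_add_of_le hmj
  refine key m ?_
  rw [hj]
  convert hP.mul _ _ h (hP.sq (t ^ i)) using 1
  ring

/-- The certificate of the formal Positivstellensatz. -/
theorem IsCone.mem_of_certificate (hP : IsCone P)
    (aonz : ∀ x y, y ∈ P → x * (x * x + y) ∈ P → x ∈ P) {t q s d : A} (m : ℕ) (hq : q ∈ P)
    (hs : s ∈ P) (hd : d ∈ P) (aso1 : ∀ y, s * y ∈ P → y ∈ P)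
    (h : t * q = s * (t * t) ^ m + d) : t ∈ P := by
  -- Aonz is applied to `X = s t^(2m+1)`, with `c` chosen so that `X² + c = t² (s t^(2m) + d)²`. One
  -- factor `s t^(2m) + d` is then replaced by `t q`, so that `X (X² + c)` becomes a product of
  -- elements of `P`.
  refine hP.mem_of_odd_pow aonz m (aso1 _ (aonz _
    (t * t * ((s + s) * d * (t ^ m * t ^ m) + d * d)) ?_ ?_))
  · exact hP.mul _ _ (hP.sq t) (hP.add _ _ (hP.mul _ _ (hP.mul _ _ (hP.add _ _ hs hs) hd)
      (hP.sq _)) (hP.mul _ _ hd hd))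
  · have hu : (t * t) ^ m = t ^ m * t ^ m := mul_pow t t m
    have hX : t ^ (2 * m + 1) = t ^ m * t ^ m * t := by ring
    rw [hu] at h
    rw [hX]
    generalize t ^ m = u at *
    have e : s * (u * u * t) * (s * (u * u * t) * (s * (u * u * t)) +
        t * t * ((s + s) * d * (u * u) + d * d)) =
        s * (u * u) * (t * t * (t * t)) * q * (s * (u * u) + d) := by
      linear_combination (-s * u * u * t * t * (s * u * u + d) * t) * h
    rw [e]
    exact hP.mul _ _ (hP.mul _ _ (hP.mul _ _ (hP.mul _ _ hs (hP.sq u)) (hP.sq _)) hq)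
      (hP.add _ _ (hP.mul _ _ hs (hP.sq u)) hd)

/-- An order-preserving map to an ordered field with the intermediate value property, where the
elements of `M` become positive. -/
theorem IsCone.exists_hom (hP : IsCone P) (M : Submonoid A) (hMP : ∀ s ∈ M, s ∈ P)
    (hM : ∀ s ∈ M, -s ∉ P) :
    ∃ (K : Type v) (_ : Field K) (_ : LinearOrder K) (_ : IsStrictOrderedRing K) (φ : A →+* K),
      PolynomialIVT K ∧ (∀ x ∈ P, 0 ≤ φ x) ∧ ∀ s ∈ M, 0 < φ s := by
  obtain ⟨Q, hQ, hPQ, hMQ⟩ := hP.exists_isPrimeCone M hMP hM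
  obtain ⟨K, _, _, _, φ, hK, hφ⟩ := hQ.exists_hom (hMQ 1 M.one_mem)
  refine ⟨K, _, _, inferInstance, φ, hK, fun x hx => (hφ x).2 (hPQ hx), fun s hs => ?_⟩
  by_contra hn
  refine hMQ s hs ((hφ _).1 ?_)
  rw [map_neg]
  exact neg_nonneg.2 (not_lt.1 hn)

/-- Adjoin `-t` to the cone and the powers of `t²` to the monoid. The first gives `φ t ≤ 0`, the
second excludes `φ t = 0`. A conflict between the two is precisely the certificate that puts `t` in
`P`. -/
theorem IsCone.exists_hom_neg (hP : IsCone P)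
    (aonz : ∀ x y, y ∈ P → x * (x * x + y) ∈ P → x ∈ P) (M : Submonoid A) (hMP : ∀ s ∈ M, s ∈ P)
    (aso1 : ∀ s ∈ M, ∀ y, s * y ∈ P → y ∈ P) {t : A} (ht : t ∉ P) :
    ∃ (K : Type v) (_ : Field K) (_ : LinearOrder K) (_ : IsStrictOrderedRing K) (φ : A →+* K),
      PolynomialIVT K ∧ (∀ x ∈ P, 0 ≤ φ x) ∧ (∀ s ∈ M, 0 < φ s) ∧ φ t < 0 := by
  obtain ⟨K, _, _, _, φ, hK, h1, h2⟩ := (hP.adjoin (-t)).exists_hom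
    (M ⊔ Submonoid.powers (t * t)) (by
      intro x hx
      obtain ⟨s, hs, _, ⟨m, rfl⟩, rfl⟩ := Submonoid.mem_sup.1 hx
      refine hP.subset_adjoin _ (hP.mul _ _ (hMP s hs) ?_)
      change (t * t) ^ m ∈ P
      rw [mul_pow]
      exact hP.sq _) (by
      rintro x hx ⟨p, hp, q, hq, h⟩
      obtain ⟨s, hs, _, ⟨m, rfl⟩, rfl⟩ := Submonoid.mem_sup.1 hx
      refine ht (hP.mem_of_certificate aonz m hq (hMP s hs) hp (aso1 s hs) ?_)
      linear_combination h)
  refine ⟨K, _, _, inferInstance, φ, hK, fun x hx => h1 x (hP.subset_adjoin _ hx),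
    fun s hs => h2 s (Submonoid.mem_sup_left hs), ?_⟩
  have h3 := h1 _ (hP.mem_adjoin (-t))
  have h4 := h2 _ (Submonoid.mem_sup_right (Submonoid.mem_powers (t * t)))
  rw [map_neg, neg_nonneg] at h3
  refine lt_of_le_of_ne h3 fun h0 => ?_
  rw [map_mul, h0, mul_zero] at h4
  exact h4.false

/-- To refute `t > 0` it suffices to make `t` nonpositive. So the monoid is not enlarged, and the
only obstruction is `q t = s + p`. -/
theorem IsCone.exists_hom_nonpos (hP : IsCone P) (M : Submonoid A) (hMP : ∀ s ∈ M, s ∈ P) {t : A}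
    (ht : ∀ s ∈ M, ∀ p ∈ P, ∀ q ∈ P, q * t ≠ s + p) :
    ∃ (K : Type v) (_ : Field K) (_ : LinearOrder K) (_ : IsStrictOrderedRing K) (φ : A →+* K),
      PolynomialIVT K ∧ (∀ x ∈ P, 0 ≤ φ x) ∧ (∀ s ∈ M, 0 < φ s) ∧ φ t ≤ 0 := by
  obtain ⟨K, _, _, _, φ, hK, h1, h2⟩ := (hP.adjoin (-t)).exists_hom M
    (fun s hs => hP.subset_adjoin _ (hMP s hs)) (by
      rintro s hs ⟨p, hp, q, hq, h⟩
      exact ht s hs p hp q hq (by linear_combination h))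
  refine ⟨K, _, _, inferInstance, φ, hK, fun x hx => h1 x (hP.subset_adjoin _ hx), h2, ?_⟩
  have h3 := h1 _ (hP.mem_adjoin (-t))
  rwa [map_neg, neg_nonneg] at h3

end Points

/-! ### The standard interpretation in an ordered field -/

section RealInterp

/-- The standard interpretation in an ordered field. -/
def realInterp (K : Type v) [Field K] [LinearOrder K] : Interp K where
  sup := max
  frac x y := min |x| |y| * min |x| |y| / |y|
  nonneg := {x | 0 ≤ x}
  pos := {x | 0 < x}

/-- The properties of the interpretation that allow one to refute atomic formulas in real closed
fields. -/
structure Interp.IsGood {A : Type v} [CommRing A] (S : Signature) (I : Interp A) : Prop where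
  cone : IsCone I.nonneg
  anti : ∀ x, x ∈ I.nonneg → -x ∈ I.nonneg → x = 0
  aonz : ∀ x y, y ∈ I.nonneg → x * (x * x + y) ∈ I.nonneg → x ∈ I.nonneg
  le_sup_left : S.sup = true → ∀ x y, I.sup x y - x ∈ I.nonneg
  le_sup_right : S.sup = true → ∀ x y, I.sup x y - y ∈ I.nonneg
  sup_sub_mul : S.sup = true → ∀ x y, (I.sup x y - x) * (I.sup x y - y) = 0
  sup_of_frac : S.frac = true → S.sup = true
  frac_mul : S.frac = true → ∀ x y, I.frac x y * I.sup y (-y) =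
    -I.sup (-I.sup x (-x)) (-I.sup y (-y)) * -I.sup (-I.sup x (-x)) (-I.sup y (-y))
  frac_nonneg : S.frac = true → ∀ x y, I.frac x y ∈ I.nonneg
  frac_le : S.frac = true → ∀ x y,
    -I.sup (-I.sup x (-x)) (-I.sup y (-y)) - I.frac x y ∈ I.nonneg
  one_pos : S.pos = true → 1 ∈ I.pos
  mul_pos : S.pos = true → ∀ x y, x ∈ I.pos → y ∈ I.pos → x * y ∈ I.pos
  nonneg_of_pos : S.pos = true → ∀ x, x ∈ I.pos → x ∈ I.nonneg
  add_pos : S.pos = true → ∀ x y, x ∈ I.pos → y ∈ I.nonneg → x + y ∈ I.pos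
  aso1 : S.pos = true → ∀ x y, x ∈ I.pos → x * y ∈ I.nonneg → y ∈ I.nonneg
  aso2 : S.pos = true → ∀ x y, x ∈ I.nonneg → x * y ∈ I.pos → y ∈ I.pos

/-- A homomorphism to an ordered field compatible with the symbols of the signature. -/
structure IsRealPoint {A : Type v} [CommRing A] (S : Signature) (I : Interp A) {K : Type w}
    [Field K] [LinearOrder K] (φ : A →+* K) : Prop where
  nonneg : ∀ x ∈ I.nonneg, 0 ≤ φ x
  pos : S.pos = true → ∀ x ∈ I.pos, 0 < φ x
  sup : S.sup = true → ∀ x y, φ (I.sup x y) = max (φ x) (φ y)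
  frac : S.frac = true → ∀ x y,
    φ (I.frac x y) = min |φ x| |φ y| * min |φ x| |φ y| / |φ y|

variable {S : Signature} {V : Type u} {A : Type v} [CommRing A] {I : Interp A}

section

variable {K : Type w} [Field K] [LinearOrder K] {φ : A →+* K}

theorem IsRealPoint.eval_eq (h : IsRealPoint S I φ) (ν : V → A) (t : Term S V) :
    t.eval (realInterp K) (φ ∘ ν) = φ (t.eval I ν) := by
  induction t with
  | var x => rfl
  | zero => exact (map_zero φ).symm
  | one => exact (map_one φ).symm
  | add s t hs ht => simp_all [Term.eval]
  | mul s t hs ht => simp_all [Term.eval]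
  | neg t ht => simp_all [Term.eval]
  | sup hS s t hs ht => rw [Term.eval_sup, Term.eval_sup, h.sup hS, hs, ht]; rfl
  | frac hS s t hs ht => rw [Term.eval_frac, Term.eval_frac, h.frac hS, hs, ht]; rfl

theorem IsRealPoint.holds (h : IsRealPoint S I φ) (ν : V → A) {a : Atom S V} (ha : a.Holds I ν) :
    a.Holds (realInterp K) (φ ∘ ν) := by
  cases a with
  | isZero t => rw [Atom.holds_isZero, h.eval_eq, (Atom.holds_isZero _ _).1 ha, map_zero]
  | nonneg t => rw [Atom.holds_nonneg, h.eval_eq]; exact h.nonneg _ ha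
  | pos hS t => rw [Atom.holds_pos, h.eval_eq]; exact h.pos hS _ ha

end

theorem max_neg_max_neg {K : Type w} [AddCommGroup K] [LinearOrder K] [IsOrderedAddMonoid K]
    (x y : K) : -max (-max x (-x)) (-max y (-y)) = min |x| |y| := by
  rw [max_neg_neg, neg_neg]
  rfl

/-- Order-preserving maps are automatically compatible with `∨` and `Fr`. -/
theorem Interp.IsGood.isRealPoint (hI : I.IsGood S) {K : Type w} [Field K] [LinearOrder K]
    [IsStrictOrderedRing K] {φ : A →+* K} (h : ∀ x ∈ I.nonneg, 0 ≤ φ x)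
    (hpos : S.pos = true → ∀ x ∈ I.pos, 0 < φ x) : IsRealPoint S I φ := by
  have hsup : S.sup = true → ∀ x y, φ (I.sup x y) = max (φ x) (φ y) := by
    intro hS x y
    have h1 := h _ (hI.le_sup_left hS x y)
    have h2 := h _ (hI.le_sup_right hS x y)
    have h3 := congrArg φ (hI.sup_sub_mul hS x y)
    rw [map_mul, map_zero, map_sub, map_sub] at h3
    rw [map_sub, sub_nonneg] at h1 h2
    -- The target is a field, so `φ (x ∨ y)` equals `φ x` or `φ y`, and it bounds the other one.
    rcases mul_eq_zero.1 h3 with h4 | h4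
    · rw [sub_eq_zero.1 h4] at h2 ⊢
      rw [max_eq_left h2]
    · rw [sub_eq_zero.1 h4] at h1 ⊢
      rw [max_eq_right h1]
  refine ⟨h, hpos, hsup, fun hF x y => ?_⟩
  have hS := hI.sup_of_frac hF
  have h1 := congrArg φ (hI.frac_mul hF x y)
  have h2 := h _ (hI.frac_nonneg hF x y)
  have h3 := h _ (hI.frac_le hF x y)
  have e1 : φ (I.sup y (-y)) = |φ y| := by rw [hsup hS, map_neg]; rfl
  have e2 : φ (-I.sup (-I.sup x (-x)) (-I.sup y (-y))) = min |φ x| |φ y| := by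
    rw [map_neg, hsup hS, map_neg, map_neg, hsup hS, hsup hS, map_neg, map_neg, max_neg_max_neg]
  rw [map_mul, map_mul, e1, e2] at h1
  rw [map_sub, e2] at h3
  -- Where `φ y = 0` the product axiom says nothing, but the bounds on `Fr` force the value `0`, in
  -- agreement with division by zero in `realInterp`.
  by_cases hy : φ y = 0
  · rw [hy, abs_zero, min_eq_right (abs_nonneg _)] at h3
    rw [hy, abs_zero, div_zero]
    exact le_antisymm (by linarith) h2
  · rw [eq_div_iff (abs_ne_zero.2 hy), h1]

/-- The Positivstellensatz for atoms: failure in `A` is witnessed at a point of a real closed field.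
The cone is the set of nonnegative elements, and the monoid consists of what must become positive.
-/
theorem Interp.IsGood.exists_isRealPoint (hI : I.IsGood S) (ν : V → A) {a : Atom S V}
    (ha : ¬ a.Holds I ν) :
    ∃ (K : Type v) (_ : Field K) (_ : LinearOrder K) (_ : IsStrictOrderedRing K) (φ : A →+* K),
      PolynomialIVT K ∧ IsRealPoint S I φ ∧ ¬ a.Holds (realInterp K) (φ ∘ ν) := by
  -- Without a predicate `> 0` the trivial monoid serves; with it, Aso1 provides the cancellation
  -- property that the certificate needs.
  obtain ⟨M, hMP, hM1, hM2⟩ : ∃ M : Submonoid A, (∀ s ∈ M, s ∈ I.nonneg) ∧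
      (∀ s ∈ M, ∀ y, s * y ∈ I.nonneg → y ∈ I.nonneg) ∧
      (S.pos = true → ∀ x, x ∈ M ↔ x ∈ I.pos) := by
    by_cases hS : S.pos = true
    · exact ⟨⟨⟨I.pos, fun {x y} => hI.mul_pos hS x y⟩, hI.one_pos hS⟩, hI.nonneg_of_pos hS,
        fun s hs y => hI.aso1 hS s y hs, fun _ _ => Iff.rfl⟩
    · refine ⟨⊥, ?_, ?_, fun h => absurd h hS⟩
      · intro s hs
        rw [Submonoid.mem_bot.1 hs]
        exact hI.cone.one
      · intro s hs y hy
        rwa [Submonoid.mem_bot.1 hs, one_mul] at hy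
  have key : ∀ t, t ∉ I.nonneg → ∃ (K : Type v) (_ : Field K) (_ : LinearOrder K)
      (_ : IsStrictOrderedRing K) (φ : A →+* K),
      PolynomialIVT K ∧ IsRealPoint S I φ ∧ φ t < 0 := by
    intro t ht
    obtain ⟨K, _, _, _, φ, hK, h1, h2, h3⟩ := hI.cone.exists_hom_neg hI.aonz M hMP hM1 ht
    exact ⟨K, _, _, inferInstance, φ, hK,
      hI.isRealPoint h1 fun hS x hx => h2 x ((hM2 hS x).2 hx), h3⟩
  cases a with
  | isZero t =>
    -- By antisymmetry an equation is two inequalities, one of which fails.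
    have : t.eval I ν ∉ I.nonneg ∨ -t.eval I ν ∉ I.nonneg := by
      by_contra! h
      exact ha (hI.anti _ h.1 h.2)
    rcases this with h | h <;> obtain ⟨K, _, _, _, φ, hK, hφ, h3⟩ := key _ h <;>
      refine ⟨K, _, _, inferInstance, φ, hK, hφ, ?_⟩ <;> rw [Atom.holds_isZero, hφ.eval_eq]
    · exact h3.ne
    · rw [map_neg, neg_lt_zero] at h3
      exact h3.ne'
  | nonneg t =>
    obtain ⟨K, _, _, _, φ, hK, hφ, h3⟩ := key _ ha
    refine ⟨K, _, _, inferInstance, φ, hK, hφ, ?_⟩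
    rw [Atom.holds_nonneg, hφ.eval_eq]
    exact not_le.2 h3
  | pos hS t =>
    obtain ⟨K, _, _, _, φ, hK, h1, h2, h3⟩ := hI.cone.exists_hom_nonpos (t := t.eval I ν) M hMP (by
      intro s hs p hp q hq h
      refine ha (hI.aso2 hS q _ hq ?_)
      rw [h]
      exact hI.add_pos hS _ _ ((hM2 hS s).1 hs) hp)
    have hφ := hI.isRealPoint h1 fun hS x hx => h2 x ((hM2 hS x).2 hx)
    refine ⟨K, _, _, inferInstance, φ, hK, hφ, ?_⟩
    rw [Atom.holds_pos, hφ.eval_eq]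
    exact not_lt.2 h3

/-- A theory whose models are good proves the Horn rules that are true in ordered fields with the
intermediate value property. -/
theorem Derives.of_real {T : Theory S} (hAc : Ac S ⊆ T)
    (hT : ∀ (A : Type u) [CommRing A] (I : Interp A),
      (∀ r : DynRule S ℕ, T.Proves r → r.ExistFree → r.Valid I) → I.IsGood S)
    {Γ : Set (Atom S V)} {Δ : List (Atom S (V ⊕ Fin 0))}
    (h : ∀ (K : Type u) [Field K] [LinearOrder K] [IsStrictOrderedRing K] (μ : V → K),
      PolynomialIVT K → (∀ a ∈ Γ, a.Holds (realInterp K) μ) →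
        (⟨0, Δ⟩ : ExConj S V).Holds (realInterp K) μ) : Derives T Γ [⟨0, Δ⟩] := by
  by_contra hn
  obtain ⟨A, _, I, ν, hΓ, hC, hI⟩ := Derives.exists_interp hAc hn
  have hC' := hC _ (List.mem_singleton_self _)
  rw [ExConj.holds_of_eq_zero _ _ rfl] at hC'
  push Not at hC'
  -- Here the Horn form is essential: the conclusion is a single conjunction, so one false atom
  -- refutes it.
  obtain ⟨τ, a, ha, hτ⟩ := hC'
  obtain ⟨K, _, _, _, φ, hK, hφ, hna⟩ := (hT A I hI).exists_isRealPoint _ hτ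
  have h1 := h K (φ ∘ ν) hK fun a ha => hφ.holds ν (hΓ a ha)
  rw [ExConj.holds_of_eq_zero _ _ rfl] at h1
  refine hna ?_
  have h2 := h1 (φ ∘ τ) a ha
  rwa [← Sum.comp_elim] at h2

end RealInterp

/-! ### Models of the theories -/

section TheoryModels

variable {S S' : Signature} {A : Type v} [CommRing A] {I : Interp A}

theorem Interp.models_Apro (hp : S.pos = true) : I.Models (Apro S hp) ↔ I.Models (Apo S) ∧
    1 ∈ I.pos ∧ (∀ x : A, x ∈ I.pos → x ∈ I.nonneg) ∧
    (∀ x y : A, x ∈ I.pos → y ∈ I.nonneg → x + y ∈ I.pos) ∧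
    (∀ x y : A, x ∈ I.pos → y ∈ I.pos → x * y ∈ I.pos) ∧ (0 ∈ I.pos → (1 : A) = 0) := by
  simp only [Apro, models_union, models_insert, models_singleton, models_aso1, models_aso2,
    models_aso3, models_aso4, models_col]

theorem Interp.models_Asonz (hp : S.pos = true) : I.Models (Asonz S hp) ↔ I.Models (Apro S hp) ∧
    (∀ x : A, x ∈ I.nonneg → -x ∈ I.nonneg → x = 0) ∧
    (∀ x y : A, x ∈ I.pos → x * y ∈ I.nonneg → y ∈ I.nonneg) ∧
    (∀ x y : A, x ∈ I.nonneg → x * y ∈ I.pos → y ∈ I.pos) ∧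
    ∀ x y : A, y ∈ I.nonneg → x * (x * x + y) ∈ I.nonneg → x ∈ I.nonneg := by
  simp only [Asonz, Aso, models_union, models_insert, models_singleton, models_Gao,
    models_Aso1, models_Aso2, models_AonzRule, and_assoc]

theorem Interp.models_Atonz : I.Models (Atonz S) ↔ I.Models (Apo S) ∧
    (∀ x : A, x ∈ I.nonneg → -x ∈ I.nonneg → x = 0) ∧
    (∀ x : A, x ∈ I.nonneg ∨ -x ∈ I.nonneg) ∧ ∀ x : A, x * x = 0 → x = 0 := by
  simp only [Atonz, Ato, Ao, models_union, models_singleton, models_Gao, models_OT, models_Anz,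
    and_assoc]

theorem Interp.models_Cod (hp : S.pos = true) : I.Models (Cod S hp) ↔ I.Models (Apro S hp) ∧
    (∀ x : A, x ∈ I.nonneg → -x ∈ I.nonneg → x = 0) ∧
    (∀ x y : A, x * y = 1 → x * x ∈ I.pos) ∧ (∀ x : A, x ∈ I.nonneg ∨ -x ∈ I.nonneg) ∧
    ∀ x : A, x = 0 ∨ x * x ∈ I.pos := by
  simp only [Cod, models_union, models_insert, models_singleton, models_Gao, models_Iv,
    models_IVne, models_OT, models_ED, true_and]

/-- `∨` is the least upper bound. -/
def Interp.IsSup (I : Interp A) : Prop :=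
  (∀ x y : A, I.sup x y - x ∈ I.nonneg) ∧ (∀ x y : A, I.sup x y - y ∈ I.nonneg) ∧
    ∀ x y z : A, z - x ∈ I.nonneg → z - y ∈ I.nonneg → z - I.sup x y ∈ I.nonneg

/-- The two axioms for `Fr`. -/
def Interp.IsFrac (I : Interp A) : Prop :=
  (∀ x y : A, I.frac x y * I.sup y (-y) =
    -I.sup (-I.sup x (-x)) (-I.sup y (-y)) * -I.sup (-I.sup x (-x)) (-I.sup y (-y))) ∧
  ∀ x y : A, I.frac x y ∈ I.nonneg ∧
    -I.sup (-I.sup x (-x)) (-I.sup y (-y)) - I.frac x y ∈ I.nonneg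

theorem Interp.models_sup (hs : S.sup = true) :
    I.Models {sup1 S hs, sup2 S hs, Sup S hs} ↔ I.IsSup := by
  simp only [models_insert, models_singleton, models_sup1, models_sup2, models_Sup, IsSup]

theorem Interp.models_fr (hs : S.sup = true) (hf : S.frac = true) :
    I.Models {fr1 S hs hf, fr2 S hs hf} ↔ I.IsFrac := by
  simp only [models_insert, models_singleton, models_fr1, models_fr2, IsFrac]

theorem Interp.models_Codsup (hp : S.pos = true) (hs : S.sup = true) :
    I.Models (Codsup S hp hs) ↔ I.Models (Cod S hp) ∧ I.IsSup := by
  rw [Codsup, models_union, models_sup]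

theorem Interp.models_Crcdsup (hp : S.pos = true) (hs : S.sup = true) :
    I.Models (Crcdsup S hp hs) ↔ I.Models (Cod S hp) ∧ I.IsSup := by
  rw [Crcdsup, Crcd, models_union, models_union, models_sup, iff_true_intro (models_RCF hp),
    and_true]

theorem Interp.models_CodsupFr (hp : S.pos = true) (hs : S.sup = true) (hf : S.frac = true) :
    I.Models (CodsupFr S hp hs hf) ↔ I.Models (Cod S hp) ∧ I.IsSup ∧ I.IsFrac := by
  rw [CodsupFr, models_union, models_Codsup, models_fr, and_assoc]

theorem Interp.models_CrcdsupFr (hp : S.pos = true) (hs : S.sup = true) (hf : S.frac = true) :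
    I.Models (CrcdsupFr S hp hs hf) ↔ I.Models (Cod S hp) ∧ I.IsSup ∧ I.IsFrac := by
  rw [CrcdsupFr, models_union, models_Crcdsup, models_fr, and_assoc]

theorem Interp.models_Asrnz (hp : S.pos = true) (hs : S.sup = true) :
    I.Models (Asrnz S hp hs) ↔ I.Models (Afrnz S hs) ∧
      (1 ∈ I.pos ∧ (∀ x : A, x ∈ I.pos → x ∈ I.nonneg) ∧
        (∀ x y : A, x ∈ I.pos → y ∈ I.nonneg → x + y ∈ I.pos) ∧
        (∀ x y : A, x ∈ I.pos → y ∈ I.pos → x * y ∈ I.pos) ∧ (0 ∈ I.pos → (1 : A) = 0)) ∧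
      (∀ x y : A, x * y = 1 → x * x ∈ I.pos) ∧
      (∀ x y : A, x ∈ I.pos → x * y ∈ I.nonneg → y ∈ I.nonneg) ∧
      (∀ x y : A, x ∈ I.nonneg → x * y ∈ I.pos → y ∈ I.pos) ∧ I.IsSup := by
  simp only [Asrnz, Asr, Afrnz, models_union, models_sup]
  simp only [models_insert, models_singleton, models_aso1, models_aso2, models_aso3, models_aso4,
    models_col, models_Iv, models_Aso1, models_Aso2]
  tauto

theorem Interp.models_CoMinus (hp : S.pos = true) (hs : S.sup = true) :
    I.Models (CoMinus S hp hs) ↔ I.Models (Asonz S hp) ∧ (∀ x y : A, x * y = 1 → x * x ∈ I.pos) ∧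
      (∀ x : A, x * x = 0 → x = 0) ∧ (∀ x y : A, x + y ∈ I.pos → x ∈ I.pos ∨ y ∈ I.pos) ∧ I.IsSup ∧
      (∀ x y z : A, x + I.sup y z = I.sup (x + y) (x + z)) ∧
      ∀ x y z : A, I.sup x 0 * I.sup y z = I.sup (I.sup x 0 * y) (I.sup x 0 * z) := by
  simp only [CoMinus, models_union, models_insert, models_singleton, models_Iv, models_Anz,
    models_IVpos, models_OTF, models_sup1, models_sup2, models_Sup, models_grl, models_afr, IsSup,
    true_and, and_assoc]

theorem Interp.models_Co (hp : S.pos = true) (hs : S.sup = true) (hf : S.frac = true) :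
    I.Models (Co S hp hs hf) ↔ I.Models (CoMinus S hp hs) ∧ I.IsFrac := by
  rw [Co, models_union, models_fr]

theorem Interp.models_Aftr (hp : S.pos = true) (hs : S.sup = true) (hf : S.frac = true) :
    I.Models (Aftr S hp hs hf) ↔ I.Models (Afrnz S hs) ∧
      ((∀ x : A, x ∈ I.pos → x ∈ I.nonneg) ∧
        ∀ x z : A, x ∈ I.nonneg → x * z = 1 → x ∈ I.pos) ∧ I.IsFrac := by
  simp only [Aftr, models_union, models_fr, and_assoc]
  simp only [models_insert, models_singleton, models_aso2, models_IVpos, models_posOfUnit,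
    true_and, and_assoc]

theorem Interp.models_Apo_congr (h : I.Models (Apo S)) : I.Models (Apo S') := by
  rwa [models_Apo] at h ⊢

/-- The interpretation is trivial, or it is the standard one in an ordered integral domain. -/
def Interp.IsLinear (I : Interp A) : Prop :=
  (Subsingleton A ∧ (∀ x, x ∈ I.nonneg) ∧ ∀ x, x ∈ I.pos) ∨
    ∃ (_ : LinearOrder A) (_ : IsStrictOrderedRing A),
      (∀ x, x ∈ I.nonneg ↔ 0 ≤ x) ∧ ∀ x, x ∈ I.pos ↔ 0 < x

-- Inverses are an existential axiom and may be missing, so `A` need not be a field. Decidability of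
-- `x = 0` together with `col` still makes it a domain, unless `1 = 0`.
open Classical in
theorem Interp.Models.isLinear {hp : S.pos = true} (h : I.Models (Cod S hp)) : I.IsLinear := by
  simp only [models_Cod, models_Apro, models_Apo] at h
  obtain ⟨⟨⟨zero, add, sq, mul⟩, pos1, posle, posadd, posmul, col⟩, anti, -, tot, ed⟩ := h
  by_cases h1 : (1 : A) = 0
  · have hA : Subsingleton A := subsingleton_of_zero_eq_one h1.symm
    exact .inl ⟨hA, fun x => by rwa [Subsingleton.elim x 0],
      fun x => by rwa [Subsingleton.elim x 1]⟩
  right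
  let O : PartialOrder A := partialOrderOfCone I.nonneg zero add anti
  have hn : ∀ x : A, x ∈ I.nonneg ↔ (0 : A) ≤ x := fun x => by
    change _ ↔ x - 0 ∈ I.nonneg
    rw [sub_zero]
  have hle : ∀ x y : A, x ≤ y ↔ y - x ∈ I.nonneg := fun _ _ => Iff.rfl
  let L : LinearOrder A :=
    { O with
      le_total := fun x y => by
        rw [hle, hle, ← neg_sub y x]
        exact tot _
      toDecidableLE := inferInstance }
  have hadd : ∀ a b : A, a ≤ b → ∀ c, c + a ≤ c + b := fun a b hab c => by
    rw [hle] at hab ⊢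
    rwa [add_sub_add_left_eq_sub]
  have h2 : IsOrderedAddMonoid A :=
    ⟨fun a b hab c => by simpa only [add_comm] using hadd a b hab c, hadd⟩
  have h3 : ZeroLEOneClass A := ⟨(hn 1).1 (posle 1 pos1)⟩
  have h4 : Nontrivial A := ⟨1, 0, h1⟩
  have h5 : IsOrderedRing A := .of_mul_nonneg fun x y hx hy => by
    rw [← hn] at hx hy ⊢
    exact mul _ _ hx hy
  have h6 : NoZeroDivisors A := ⟨fun {x y} hxy => by
    by_contra! hn
    have := posmul _ _ ((ed x).resolve_left hn.1) ((ed y).resolve_left hn.2)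
    rw [mul_mul_mul_comm, hxy, mul_zero] at this
    exact h1 (col this)⟩
  have h7 : IsDomain A := NoZeroDivisors.to_isDomain A
  have h8 : IsStrictOrderedRing A := IsOrderedRing.toIsStrictOrderedRing A
  refine ⟨L, h8, hn, fun x => ⟨fun hx => ?_, fun hx => ?_⟩⟩
  · refine lt_of_le_of_ne ((hn x).1 (posle x hx)) ?_
    rintro rfl
    exact h1 (col hx)
  -- Only `x² > 0` is given. Below `1` use `x = x² + x (1 - x)`, above `1` use `x = 1 + (x - 1)`.
  · rcases le_total x 1 with hx1 | hx1
    · have := posadd _ _ ((ed x).resolve_left hx.ne')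
        ((hn _).2 (mul_nonneg hx.le (sub_nonneg.2 hx1)))
      rwa [show x * x + x * (1 - x) = x by ring] at this
    · have := posadd _ _ pos1 ((hn _).2 (sub_nonneg.2 hx1))
      rwa [add_sub_cancel] at this

namespace Interp.IsLinear

theorem models_Asonz (h : I.IsLinear) (hp : S.pos = true) : I.Models (Asonz S hp) := by
  rw [Interp.models_Asonz, models_Apro, models_Apo]
  rcases h with ⟨_, hn, hp⟩ | ⟨_, _, hn, hp⟩
  · simp [hn, hp, eq_iff_true_of_subsingleton]
  · simp only [hn, hp]
    refine ⟨⟨⟨le_rfl, fun _ _ => add_nonneg, mul_self_nonneg, fun _ _ => mul_nonneg⟩, one_pos,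
      fun _ => le_of_lt, fun _ _ => add_pos_of_pos_of_nonneg, fun _ _ => mul_pos,
      fun h => absurd h (lt_irrefl _)⟩, fun x h1 h2 => le_antisymm (neg_nonneg.1 h2) h1,
      fun x y hx hxy => nonneg_of_mul_nonneg_right hxy hx,
      fun x y hx hxy => pos_of_mul_pos_right hxy hx, fun x y hy hxy => ?_⟩
    by_contra hx
    have hx := not_le.1 hx
    exact absurd hxy (not_le.2 (mul_neg_of_neg_of_pos hx
      (add_pos_of_pos_of_nonneg (mul_pos_of_neg_of_neg hx hx) hy)))

theorem anz (h : I.IsLinear) (x : A) (hx : x * x = 0) : x = 0 := by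
  rcases h with ⟨_, -⟩ | ⟨_, _, -⟩
  · exact Subsingleton.elim _ _
  · exact mul_self_eq_zero.1 hx

theorem otf (h : I.IsLinear) (x y : A) (hxy : x + y ∈ I.pos) : x ∈ I.pos ∨ y ∈ I.pos := by
  rcases h with ⟨-, -, hp⟩ | ⟨_, _, -, hp⟩
  · exact .inl (hp x)
  · simp only [hp] at hxy ⊢
    by_contra! hn
    exact absurd hxy (not_lt.2 (add_nonpos hn.1 hn.2))

theorem models_Atonz (h : I.IsLinear) (S : Signature) : I.Models (Atonz S) := by
  have h1 := h.models_Asonz (S := sigAso) rfl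
  rw [Interp.models_Asonz, models_Apro] at h1
  refine Interp.models_Atonz.2 ⟨models_Apo_congr h1.1.1, h1.2.1, fun x => ?_, h.anz⟩
  rcases h with ⟨-, hn, -⟩ | ⟨_, _, hn, -⟩
  · exact .inl (hn x)
  · simp only [hn, neg_nonneg]
    exact le_total _ _

theorem sup_distrib (h : I.IsLinear) (hs : I.IsSup) :
    (∀ x y z : A, x + I.sup y z = I.sup (x + y) (x + z)) ∧
      ∀ x y z : A, I.sup x 0 * I.sup y z = I.sup (I.sup x 0 * y) (I.sup x 0 * z) := by
  rcases h with ⟨_, -, -⟩ | ⟨_, _, hn, -⟩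
  · exact ⟨fun _ _ _ => Subsingleton.elim _ _, fun _ _ _ => Subsingleton.elim _ _⟩
  · have hmax : ∀ x y, I.sup x y = max x y := by
      intro x y
      have h1 := hs.1 x y
      have h2 := hs.2.1 x y
      have h3 := hs.2.2 x y (max x y) ((hn _).2 (sub_nonneg.2 (le_max_left x y)))
        ((hn _).2 (sub_nonneg.2 (le_max_right x y)))
      rw [hn, sub_nonneg] at h1 h2 h3
      exact le_antisymm h3 (max_le h1 h2)
    simp only [hmax]
    exact ⟨fun x y z => (max_add_add_left x y z).symm,
      fun x y z => mul_max_of_nonneg _ _ (le_max_right _ _)⟩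

theorem models_Afrnz (h : I.IsLinear) (hsup : I.IsSup) (hs : S.sup = true) :
    I.Models (Afrnz S hs) := by
  have h1 := h.models_Asonz (S := sigAso) rfl
  rw [Interp.models_Asonz, models_Apro] at h1
  exact models_Afrnz_of_sup hs (models_Apo_congr h1.1.1) h1.2.1 hsup.1 hsup.2.1 hsup.2.2
    (h.sup_distrib hsup).1 (h.sup_distrib hsup).2 h.anz

end Interp.IsLinear

namespace Interp.Models

theorem aonz_of_asonz {hp : S.pos = true} (h : I.Models (Asonz S hp)) (S' : Signature) :
    I.Models (Aonz S') := by
  rw [models_Asonz, models_Apro] at h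
  exact models_Aonz.2 ⟨models_Apo_congr h.1.1, h.2.1, h.2.2.2.2⟩

/-- If `x ≤ 0`, then `x (x² + c)` is also nonpositive, hence zero. So `x⁴ = -c x² ≤ 0`, and
reducedness gives `x = 0`. -/
theorem aonz_of_atonz (h : I.Models (Atonz S)) : I.Models (Aonz S) := by
  obtain ⟨h1, anti, tot, anz⟩ := models_Atonz.1 h
  refine models_Aonz.2 ⟨h1, anti, fun x c hc hx => ?_⟩
  obtain ⟨zero, add, sq, mul⟩ := models_Apo.1 h1
  rcases tot x with hx' | hx'
  · exact hx'
  have h2 : x * (x * x + c) = 0 := by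
    refine anti _ hx ?_
    rw [← neg_mul]
    exact mul _ _ hx' (add _ _ (sq x) hc)
  have h3 : x * x * (x * x) = 0 := by
    refine anti _ (sq _) ?_
    rw [show -(x * x * (x * x)) = c * (x * x) by linear_combination -x * h2]
    exact mul _ _ hc (sq x)
  rwa [anz _ (anz _ h3)]

theorem afrnz_of_coMinus {hp : S.pos = true} {hs : S.sup = true} (h : I.Models (CoMinus S hp hs)) :
    I.Models (Afrnz S hs) := by
  obtain ⟨h1, -, anz, -, hsup, grl, afr⟩ := (models_CoMinus hp hs).1 h
  rw [models_Asonz, models_Apro] at h1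
  exact models_Afrnz_of_sup hs h1.1.1 h1.2.1 hsup.1 hsup.2.1 hsup.2.2 grl afr anz

theorem afrnz_congr {hs : S.sup = true} (h : I.Models (Afrnz S hs)) (hs' : S'.sup = true) :
    I.Models (Afrnz S' hs') := by
  rwa [models_Afrnz] at h ⊢

theorem asonz_of_asrnz {hp : S.pos = true} {hs : S.sup = true} (h : I.Models (Asrnz S hp hs))
    (hp' : S'.pos = true) : I.Models (Asonz S' hp') := by
  obtain ⟨h1, h2, -, h3, h4, -⟩ := (models_Asrnz hp hs).1 h
  obtain ⟨h5, h6, h7⟩ := models_Aonz.1 (h1.aonz_of_afrnz S')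
  exact (models_Asonz hp').2 ⟨(models_Apro hp').2 ⟨h5, h2⟩, h6, h3, h4, h7⟩

theorem asrnz_of_coMinus {hp : S.pos = true} {hs : S.sup = true} (h : I.Models (CoMinus S hp hs))
    (hp' : S'.pos = true) (hs' : S'.sup = true) : I.Models (Asrnz S' hp' hs') := by
  have h0 := h.afrnz_of_coMinus.afrnz_congr hs'
  obtain ⟨h1, h2, -, -, hsup, -⟩ := (models_CoMinus hp hs).1 h
  rw [models_Asonz, models_Apro] at h1
  exact (models_Asrnz hp' hs').2 ⟨h0, h1.1.2, h2, h1.2.2.1, h1.2.2.2.1, hsup⟩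

/-- A nonnegative invertible `x` has `x² > 0` by `Iv`, and Aso2 applied to `x · x` gives `x > 0`. -/
theorem aftr_of_co {hp : S.pos = true} {hs : S.sup = true} {hf : S.frac = true}
    (h : I.Models (Co S hp hs hf)) : I.Models (Aftr S hp hs hf) := by
  obtain ⟨h1, hfr⟩ := (models_Co hp hs hf).1 h
  have h2 := h1.afrnz_of_coMinus
  obtain ⟨h3, h4, -⟩ := (models_CoMinus hp hs).1 h1
  rw [models_Asonz, models_Apro] at h3
  exact (models_Aftr hp hs hf).2 ⟨h2, ⟨h3.1.2.2.1, fun x z hx hxz =>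
    h3.2.2.2.1 x x hx (h4 x z hxz)⟩, hfr⟩

theorem coMinus_of_cod {hp : S.pos = true} (h : I.Models (Cod S hp)) (hsup : I.IsSup)
    (hp' : S'.pos = true) (hs' : S'.sup = true) : I.Models (CoMinus S' hp' hs') :=
  (models_CoMinus hp' hs').2 ⟨h.isLinear.models_Asonz hp', ((models_Cod hp).1 h).2.2.1,
    h.isLinear.anz, h.isLinear.otf, hsup, h.isLinear.sup_distrib hsup⟩

end Interp.Models

end TheoryModels

/-! ### Extensions and conservativity -/

section ExistentialAxioms

variable {S S' : Signature}

/-- The axioms with existential variables satisfy `q`. -/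
def Theory.ExistSatisfy (T : Theory S) (q : DynRule S ℕ → Prop) : Prop :=
  ∀ r ∈ T, r.ExistFree ∨ q r

variable {q : DynRule S ℕ → Prop}

theorem existSatisfy_union (T T' : Theory S) :
    Theory.ExistSatisfy (T ∪ T') q ↔ T.ExistSatisfy q ∧ T'.ExistSatisfy q := by
  simp [Theory.ExistSatisfy, or_imp, forall_and]

theorem existSatisfy_insert (r : DynRule S ℕ) (T : Theory S) :
    Theory.ExistSatisfy (insert r T) q ↔ (r.ExistFree ∨ q r) ∧ T.ExistSatisfy q := by
  simp [Theory.ExistSatisfy]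

theorem existSatisfy_singleton (r : DynRule S ℕ) :
    Theory.ExistSatisfy {r} q ↔ r.ExistFree ∨ q r := by
  simp [Theory.ExistSatisfy]

theorem existSatisfy_Ac : (Ac S).ExistSatisfy q := by
  rintro r (((⟨t, ht, rfl⟩ | hr)) | hr) <;> left
  · exact horn_existFree _ _
  · rcases hr with ((((rfl | rfl) | ⟨h, rfl⟩) | ⟨h, rfl⟩) | ⟨h, rfl⟩) <;> exact horn_existFree _ _
  · rcases hr with (rfl | rfl | rfl) <;> exact horn_existFree _ _

theorem existSatisfy_RCF (hp : S.pos = true) (h : ∀ n, q (RCF S hp n)) :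
    Theory.ExistSatisfy {r | ∃ n : ℕ, r = RCF S hp n} q := by
  rintro r ⟨n, rfl⟩
  exact .inr (h n)

theorem existSatisfy_Apo : (Apo S).ExistSatisfy q := by
  simp only [Apo, existSatisfy_union, existSatisfy_insert, existSatisfy_singleton,
    existSatisfy_Ac,
    gao0, gao1, ao1, ao2, horn_existFree,
    true_or, and_self]

theorem existSatisfy_Aonz : (Aonz S).ExistSatisfy q := by
  simp only [Aonz, Ao, existSatisfy_union, existSatisfy_singleton,
    existSatisfy_Apo, Gao,
    AonzRule, horn_existFree,
    true_or, and_self]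

theorem existSatisfy_Atonz : (Atonz S).ExistSatisfy q := by
  simp only [Atonz, Ato, Ao, existSatisfy_union, existSatisfy_singleton,
    existSatisfy_Apo, Gao,
    OT, Anz, horn_existFree, disj_existFree,
    true_or, and_self]

theorem existSatisfy_Apro (hp : S.pos = true) : (Apro S hp).ExistSatisfy q := by
  simp only [Apro, existSatisfy_union, existSatisfy_insert, existSatisfy_singleton,
    existSatisfy_Apo,
    aso1, aso2, aso3, aso4, col, horn_existFree,
    true_or, and_self]

theorem existSatisfy_Asonz (hp : S.pos = true) : (Asonz S hp).ExistSatisfy q := by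
  simp only [Asonz, Aso, existSatisfy_union, existSatisfy_insert, existSatisfy_singleton,
    existSatisfy_Apro, Gao,
    Aso1, Aso2, AonzRule, horn_existFree,
    true_or, and_self]

theorem existSatisfy_Cod (hp : S.pos = true) (h : q (IVne S hp)) : (Cod S hp).ExistSatisfy q := by
  simp only [Cod, existSatisfy_union, existSatisfy_insert, existSatisfy_singleton,
    existSatisfy_Apro, Gao,
    Iv, OT, ED, horn_existFree, disj_existFree, h, or_true,
    true_or, and_self]

theorem existSatisfy_sup (hs : S.sup = true) :
    Theory.ExistSatisfy {sup1 S hs, sup2 S hs, Sup S hs} q := by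
  simp [existSatisfy_insert, existSatisfy_singleton, sup1, sup2, Sup, horn_existFree]

theorem existSatisfy_fr (hs : S.sup = true) (hf : S.frac = true) :
    Theory.ExistSatisfy {fr1 S hs hf, fr2 S hs hf} q := by
  simp [existSatisfy_insert, existSatisfy_singleton, fr1, fr2, horn_existFree]

theorem existSatisfy_Codsup (hp : S.pos = true) (hs : S.sup = true) (h : q (IVne S hp)) :
    (Codsup S hp hs).ExistSatisfy q :=
  (existSatisfy_union _ _).2 ⟨existSatisfy_Cod hp h, existSatisfy_sup hs⟩

theorem existSatisfy_Crcdsup (hp : S.pos = true) (hs : S.sup = true) (h : q (IVne S hp))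
    (h' : ∀ n, q (RCF S hp n)) : (Crcdsup S hp hs).ExistSatisfy q :=
  (existSatisfy_union _ _).2 ⟨(existSatisfy_union _ _).2
    ⟨existSatisfy_Cod hp h, existSatisfy_RCF hp h'⟩, existSatisfy_sup hs⟩

theorem existSatisfy_CodsupFr (hp : S.pos = true) (hs : S.sup = true) (hf : S.frac = true)
    (h : q (IVne S hp)) : (CodsupFr S hp hs hf).ExistSatisfy q :=
  (existSatisfy_union _ _).2 ⟨existSatisfy_Codsup hp hs h, existSatisfy_fr hs hf⟩

theorem existSatisfy_CrcdsupFr (hp : S.pos = true) (hs : S.sup = true) (hf : S.frac = true)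
    (h : q (IVne S hp)) (h' : ∀ n, q (RCF S hp n)) : (CrcdsupFr S hp hs hf).ExistSatisfy q :=
  (existSatisfy_union _ _).2 ⟨existSatisfy_Crcdsup hp hs h h', existSatisfy_fr hs hf⟩

theorem existSatisfy_Afrnz (hs : S.sup = true) : (Afrnz S hs).ExistSatisfy q := by
  simp only [Afrnz, Afr, existSatisfy_union, existSatisfy_insert, existSatisfy_singleton,
    existSatisfy_Ac, supEq,
    sdt1, sdt2, sdt3, grl, afr, Anz, horn_existFree,
    true_or, and_self]

theorem existSatisfy_Asrnz (hp : S.pos = true) (hs : S.sup = true) :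
    (Asrnz S hp hs).ExistSatisfy q := by
  simp only [Asrnz, Asr, Afr, existSatisfy_union, existSatisfy_insert, existSatisfy_singleton,
    existSatisfy_Ac,
    supEq, sdt1, sdt2, sdt3, grl, afr, Anz, sup1, sup2, Sup, aso1, aso2, aso3, aso4, col, Iv, Aso1,
    Aso2, horn_existFree,
    true_or, and_self]

theorem existSatisfy_CoMinus (hp : S.pos = true) (hs : S.sup = true) (h : q (IVpos S hp)) :
    (CoMinus S hp hs).ExistSatisfy q := by
  simp only [CoMinus, existSatisfy_union, existSatisfy_insert, existSatisfy_singleton,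
    existSatisfy_Asonz, Iv,
    Anz, OTF, sup1, sup2, Sup, grl, afr, horn_existFree, disj_existFree, h, or_true,
    true_or, and_self]

theorem existSatisfy_Co (hp : S.pos = true) (hs : S.sup = true) (hf : S.frac = true)
    (h : q (IVpos S hp)) : (Co S hp hs hf).ExistSatisfy q :=
  (existSatisfy_union _ _).2 ⟨existSatisfy_CoMinus hp hs h, existSatisfy_fr hs hf⟩

theorem existSatisfy_Aftr (hp : S.pos = true) (hs : S.sup = true) (hf : S.frac = true)
    (h : q (IVpos S hp)) : (Aftr S hp hs hf).ExistSatisfy q := by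
  simp only [Aftr, existSatisfy_union, existSatisfy_insert, existSatisfy_singleton,
    existSatisfy_Afrnz, fr1, fr2,
    aso2, horn_existFree, h, or_true,
    true_or, and_self]

theorem Ac_subset_Apo : Ac S ⊆ Apo S := Set.subset_union_left

theorem Ac_subset_Aonz : Ac S ⊆ Aonz S := fun _ h => .inl (.inl (Ac_subset_Apo h))

theorem Ac_subset_Atonz : Ac S ⊆ Atonz S := fun _ h => .inl (.inl (.inl (Ac_subset_Apo h)))

theorem Ac_subset_Asonz (hp : S.pos = true) : Ac S ⊆ Asonz S hp :=
  fun _ h => .inl (.inl (.inl (Ac_subset_Apo h)))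

theorem Ac_subset_Cod (hp : S.pos = true) : Ac S ⊆ Cod S hp :=
  fun _ h => .inl (.inl (Ac_subset_Apo h))

theorem Ac_subset_Codsup (hp : S.pos = true) (hs : S.sup = true) : Ac S ⊆ Codsup S hp hs :=
  fun _ h => .inl (Ac_subset_Cod hp h)

theorem Cod_subset_Crcdsup (hp : S.pos = true) (hs : S.sup = true) : Cod S hp ⊆ Crcdsup S hp hs :=
  fun _ h => .inl (.inl h)

theorem Cod_subset_CodsupFr (hp : S.pos = true) (hs : S.sup = true) (hf : S.frac = true) :
    Cod S hp ⊆ CodsupFr S hp hs hf := fun _ h => .inl (.inl h)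

theorem Cod_subset_CrcdsupFr (hp : S.pos = true) (hs : S.sup = true) (hf : S.frac = true) :
    Cod S hp ⊆ CrcdsupFr S hp hs hf := fun _ h => .inl (Cod_subset_Crcdsup hp hs h)

theorem Ac_subset_Afrnz (hs : S.sup = true) : Ac S ⊆ Afrnz S hs :=
  fun _ h => .inl (.inl (.inl h))

theorem Ac_subset_Asrnz (hp : S.pos = true) (hs : S.sup = true) : Ac S ⊆ Asrnz S hp hs :=
  fun _ h => .inl (.inl (.inl (.inl (.inl h))))

theorem Ac_subset_CoMinus (hp : S.pos = true) (hs : S.sup = true) : Ac S ⊆ CoMinus S hp hs :=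
  fun _ h => .inl (.inl (Ac_subset_Asonz hp h))

theorem Ac_subset_Co (hp : S.pos = true) (hs : S.sup = true) (hf : S.frac = true) :
    Ac S ⊆ Co S hp hs hf := fun _ h => .inl (Ac_subset_CoMinus hp hs h)

theorem Ac_subset_Aftr (hp : S.pos = true) (hs : S.sup = true) (hf : S.frac = true) :
    Ac S ⊆ Aftr S hp hs hf := fun _ h => .inl (.inl (Ac_subset_Afrnz hs h))

/-- A theory extends another one if its models are models of the other one and it proves the
existential axioms. -/
theorem Theory.extends_of_models {T' : Theory S'} {T : Theory S} (hS : S ≤ S') (hAc : Ac S' ⊆ T')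
    (h : ∀ (A : Type) [CommRing A] (I : Interp A), I.Models T' → I.Models T)
    (hex : T.ExistSatisfy fun r => T'.Proves (r.lift hS)) : T'.Extends T := by
  refine ⟨hS, fun r hr => (hex r hr).elim (fun hfree => ?_) id⟩
  refine Theory.proves_of_valid hAc fun A _ I hI => ?_
  rw [DynRule.valid_lift]
  exact h A I hI r hr hfree

theorem Term.lift_pow {V : Type u} (hS : S ≤ S') (t : Term S V) (n : ℕ) :
    (t ^ n).lift hS = t.lift hS ^ n := by
  induction n with
  | zero => rfl
  | succ n ih => exact congrArg (· * t.lift hS) ih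

theorem Term.lift_polyEval {V : Type u} (hS : S ≤ S') (c : ℕ → Term S V) (t : Term S V) (n : ℕ) :
    (Term.polyEval c t n).lift hS = Term.polyEval (fun k => (c k).lift hS) (t.lift hS) n := by
  induction n with
  | zero => rfl
  | succ n ih =>
    rw [Term.polyEval, Term.polyEval, ← ih, ← Term.lift_pow]
    rfl

theorem RCF_lift (hS : S ≤ S') (hp : S.pos = true) (n : ℕ) :
    (RCF S hp n).lift hS = RCF S' (hS.1 hp) n := by
  have h1 : ∀ (c : ℕ → Term S ℕ) (s t a b : Term S ℕ),
      [Atom.gt hp a b, Atom.gt hp 0 (s * t)].map (Atom.lift hS) =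
        [Atom.gt (hS.1 hp) (a.lift hS) (b.lift hS), Atom.gt (hS.1 hp) 0 (s.lift hS * t.lift hS)] :=
    fun _ _ _ _ _ => rfl
  have h2 : ∀ (Γ : List (Atom S ℕ)) (t : Term S (ℕ ⊕ Fin 1)) (b c : Atom S (ℕ ⊕ Fin 1)),
      (exist Γ [Atom.isZero t, b, c]).lift hS =
        exist (Γ.map (Atom.lift hS)) [Atom.isZero (t.lift hS), b.lift hS, c.lift hS] :=
    fun _ _ _ _ => rfl
  rw [RCF, h2, h1 (fun _ => 0), Term.lift_polyEval, Term.lift_polyEval, Term.lift_polyEval]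
  rfl

/-- Inverses of positive elements in discrete ordered fields. -/
theorem proves_IVpos {T : Theory S} (hp : S.pos = true) (hT : Cod S hp ⊆ T) :
    T.Proves (IVpos S hp) := by
  have h4 : T.Proves (aso4 S hp) :=
    Theory.proves_of_mem (hT (.inl (.inr (.inr (.inr (.inr (.inl rfl)))))))
  have hi : T.Proves (IVne S hp) := Theory.proves_of_mem (hT (.inr (.inr (.inr (.inl rfl)))))
  -- From `x > 0` one has `x x > 0`, to which the axiom on inverses of nonzero elements applies.
  have h1 : Derives T {a | a ∈ (IVpos S hp).prem}
      [⟨0, [.pos hp (Term.var (.inl 0) * Term.var (.inl 0))]⟩] := by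
    exact h4.subst (fun _ => Term.var 0)
      (List.forall_mem_cons.2 ⟨.head _, List.forall_mem_singleton.2 (.head _)⟩)
      (List.forall_mem_singleton.2 (.head _))
  refine h1.cut (List.forall_mem_singleton.2 ?_)
  exact hi.subst (fun _ => Term.var (.inl 0))
    (List.forall_mem_singleton.2 (.inr (List.mem_singleton.2 rfl)))
    (List.forall_mem_singleton.2 (List.mem_singleton.2 rfl))

end ExistentialAxioms

/-! ### Strongly real rings -/

section StronglyReal

variable {S : Signature}

theorem Derives.of_valid {T : Theory S} (hAc : Ac S ⊆ T) {V : Type u} {Γ : Set (Atom S V)}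
    {C : List (ExConj S V)}
    (h : ∀ (A : Type u) [CommRing A] (I : Interp A) (ν : V → A), I.Models T →
      (∀ a ∈ Γ, a.Holds I ν) → ∃ d ∈ C, d.Holds I ν) : Derives T Γ C := by
  by_contra hn
  obtain ⟨A, _, I, ν, hΓ, hC, hI⟩ := Derives.exists_interp hAc hn
  obtain ⟨d, hd, hdν⟩ := h A I ν (fun r hr hfree => hI r (Theory.proves_of_mem hr) hfree) hΓ
  exact hC d hd hdν

/-- If positive elements have inverses, one can assume that finitely many terms known to be positive
are invertible. -/
theorem Derives.of_valid_of_inverses {T : Theory S} (hAc : Ac S ⊆ T) {hp : S.pos = true}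
    (hIV : IVpos S hp ∈ T) {V : Type u} {Γ : Set (Atom S V)} {C : List (ExConj S V)}
    (ts : List (Term S V)) (hts : ∀ t ∈ ts, .pos hp t ∈ Γ)
    (h : ∀ (A : Type u) [CommRing A] (I : Interp A) (ν : V → A), I.Models T →
      (∀ a ∈ Γ, a.Holds I ν) → (∀ t ∈ ts, ∃ z, t.eval I ν * z = 1) → ∃ d ∈ C, d.Holds I ν) :
    Derives T Γ C := by
  -- Induction on the length: each inverse adds a fresh variable, so the remaining terms are renamed
  -- and the tail of the list is not literally reused.
  obtain ⟨n, hn⟩ : ∃ n, ts.length = n := ⟨_, rfl⟩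
  induction n generalizing V with
  | zero =>
    obtain rfl := List.length_eq_zero_iff.1 hn
    exact Derives.of_valid hAc fun A _ I ν hI hΓ => h A I ν hI hΓ (by simp)
  | succ n ih =>
    obtain ⟨t, ts, rfl⟩ := List.exists_cons_of_length_eq_add_one hn
    have hts := List.forall_mem_cons.1 hts
    refine .step _ hIV (fun _ => t) (List.forall_mem_singleton.2 hts.1)
      (List.forall_mem_singleton.2 ?_)
    refine ih (ts.map fun s => s.subst fun x => Term.var (Sum.inl x)) ?_ ?_ (by simpa using hn)
    · exact List.forall_mem_map.2 fun s hs => .inl ⟨_, hts.2 s hs, rfl⟩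
    · intro A _ I ν hI hΓ hinv
      have h1 : t.eval I (ν ∘ Sum.inl) * ν (.inr 0) = 1 := by
        have := hΓ _ (.inr ⟨_, List.mem_singleton_self _, rfl⟩)
        rw [Atom.holds_subst] at this
        simpa [sub_eq_zero, Term.eval_subst, Function.comp_def] using this
      obtain ⟨d, hd, hdν⟩ := h A I (ν ∘ Sum.inl) hI (fun a ha => by
        have := hΓ _ (.inl ⟨a, ha, rfl⟩)
        rwa [Atom.rename, Atom.holds_subst] at this)
        (List.forall_mem_cons.2 ⟨⟨_, h1⟩, fun s hs => by
          have := hinv _ (List.mem_map_of_mem hs)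
          rwa [Term.eval_subst] at this⟩)
      exact ⟨_, List.mem_map_of_mem hd, (ExConj.holds_rename _ _ _).2 hdν⟩

theorem Theory.proves_horn_of_inverses {T : Theory S} (hAc : Ac S ⊆ T) {hp : S.pos = true}
    (hIV : IVpos S hp ∈ T) {Γ Θ : List (Atom S ℕ)} (ts : List (Term S ℕ))
    (hts : ∀ t ∈ ts, .pos hp t ∈ Γ)
    (h : ∀ (A : Type) [CommRing A] (I : Interp A) (ν : ℕ → A), I.Models T →
      (∀ a ∈ Γ, a.Holds I ν) → (∀ t ∈ ts, ∃ z, t.eval I ν * z = 1) → ∀ a ∈ Θ, a.Holds I ν) :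
    T.Proves (horn Γ Θ) :=
  Derives.of_valid_of_inverses hAc hIV ts hts fun A _ I ν hI hΓ hinv =>
    ⟨_, List.mem_singleton_self _, Fin.elim0, List.forall_mem_map.2 fun a ha =>
      (Atom.holds_subst _ _ a).2 (h A I ν hI hΓ hinv a ha)⟩

/-- For `u ≥ 1` one has `|1| ∧ |u| = 1`, so the product axiom reads `Fr(1, u) u = 1`. This is where
`Fr` produces inverses without an existential axiom. -/
theorem Interp.Models.exists_inverse {A : Type v} [CommRing A] {I : Interp A} {hp : S.pos = true}
    {hs : S.sup = true} {hf : S.frac = true} (h : I.Models (Aftr S hp hs hf)) {u : A}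
    (hu : u - 1 ∈ I.nonneg) : ∃ z, u * z = 1 := by
  obtain ⟨h1, -, hfr, -⟩ := (models_Aftr hp hs hf).1 h
  obtain ⟨_, _, hr, hsup, hn⟩ := h1.exists_lattice
  rw [hn, sub_nonneg] at hu
  have h10 := hr.one_nonneg
  have key : ∀ x : A, 0 ≤ x → I.sup x (-x) = x := fun x hx => by
    rw [hsup, sup_eq_left]
    exact (neg_nonpos.2 hx).trans hx
  have h2 := hfr 1 u
  rw [key _ h10, key _ (h10.trans hu), hsup, sup_eq_left.2 (neg_le_neg hu), neg_neg, mul_one] at h2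
  exact ⟨I.frac 1 u, by rw [mul_comm, h2]⟩

section

variable (hp : S.pos = true) (hs : S.sup = true) (hf : S.frac = true)

theorem IVpos_mem_Aftr : IVpos S hp ∈ Aftr S hp hs hf := .inl (.inr (.inr (.inl rfl)))

theorem Aftr_proves_aso1 : (Aftr S hp hs hf).Proves (aso1 S hp) := by
  refine Theory.proves_of_valid (Ac_subset_Aftr hp hs hf) fun A _ I hI =>
    (models_aso1 hp).2 ?_ (horn_existFree _ _)
  obtain ⟨h1, h2, -⟩ := (Interp.models_Aftr hp hs hf).1 hI
  have h3 := (Interp.models_Apo.1 (Interp.models_Aonz.1 (h1.aonz_of_afrnz S)).1).2.2.1 1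
  rw [one_mul] at h3
  exact h2.2 1 1 h3 (one_mul 1)

theorem Aftr_proves_aso3 : (Aftr S hp hs hf).Proves (aso3 S hp) := by
  refine Theory.proves_horn_of_inverses (Ac_subset_Aftr hp hs hf) (IVpos_mem_Aftr hp hs hf) [vx S]
    (by simp) fun A _ I ν hI hΓ hinv => ?_
  obtain ⟨h1, h2, -⟩ := (Interp.models_Aftr hp hs hf).1 hI
  obtain ⟨zero, add, sq, mul⟩ := Interp.models_Apo.1 (Interp.models_Aonz.1 (h1.aonz_of_afrnz S)).1
  simp at hΓ hinv ⊢
  obtain ⟨z, hz⟩ := hinv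
  have hx := h2.1 _ hΓ.1
  have hz0 : z ∈ I.nonneg := by
    have := mul _ _ (sq z) hx
    rwa [show z * z * ν 0 = z by linear_combination z * hz] at this
  -- With `z` inverse to `x`, write `x + y = x (1 + y z)`; the second factor is at least `1`, hence
  -- invertible.
  obtain ⟨y, hy⟩ := hI.exists_inverse (u := 1 + ν 1 * z) (by
    rw [add_sub_cancel_left]
    exact mul _ _ hΓ.2 hz0)
  exact h2.2 _ (z * y) (add _ _ hx hΓ.2) (by linear_combination hy + y * hz)

theorem Aftr_proves_aso4 : (Aftr S hp hs hf).Proves (aso4 S hp) := by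
  refine Theory.proves_horn_of_inverses (Ac_subset_Aftr hp hs hf) (IVpos_mem_Aftr hp hs hf)
    [vx S, vy S] (by simp) fun A _ I ν hI hΓ hinv => ?_
  obtain ⟨h1, h2, -⟩ := (Interp.models_Aftr hp hs hf).1 hI
  obtain ⟨zero, add, sq, mul⟩ := Interp.models_Apo.1 (Interp.models_Aonz.1 (h1.aonz_of_afrnz S)).1
  simp at hΓ hinv ⊢
  obtain ⟨⟨a, ha⟩, b, hb⟩ := hinv
  exact h2.2 _ (a * b) (mul _ _ (h2.1 _ hΓ.1) (h2.1 _ hΓ.2))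
    (by linear_combination ha * ν 1 * b + hb)

theorem Aftr_proves_Aso1 : (Aftr S hp hs hf).Proves (Aso1 S hp) := by
  refine Theory.proves_horn_of_inverses (Ac_subset_Aftr hp hs hf) (IVpos_mem_Aftr hp hs hf) [vx S]
    (by simp) fun A _ I ν hI hΓ hinv => ?_
  obtain ⟨h1, h2, -⟩ := (Interp.models_Aftr hp hs hf).1 hI
  obtain ⟨zero, add, sq, mul⟩ := Interp.models_Apo.1 (Interp.models_Aonz.1 (h1.aonz_of_afrnz S)).1
  simp at hΓ hinv ⊢
  obtain ⟨z, hz⟩ := hinv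
  -- The factor `z² x` is a nonnegative form of the inverse `z`, and it recovers `y` from `x y`.
  have := mul _ _ (mul _ _ (sq z) (h2.1 _ hΓ.1)) hΓ.2
  rwa [show z * z * ν 0 * (ν 0 * ν 1) = ν 1 by
    linear_combination (z * ν 0 * ν 1 + ν 1) * hz] at this

theorem Aftr_proves_Aso2 : (Aftr S hp hs hf).Proves (Aso2 S hp) := by
  refine Theory.proves_horn_of_inverses (Ac_subset_Aftr hp hs hf) (IVpos_mem_Aftr hp hs hf)
    [vx S * vy S] (by simp) fun A _ I ν hI hΓ hinv => ?_
  obtain ⟨h1, h2, -⟩ := (Interp.models_Aftr hp hs hf).1 hI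
  obtain ⟨zero, add, sq, mul⟩ := Interp.models_Apo.1 (Interp.models_Aonz.1 (h1.aonz_of_afrnz S)).1
  simp at hΓ hinv ⊢
  obtain ⟨z, hz⟩ := hinv
  have hxy := h2.1 _ hΓ.2
  -- With `z` inverse to `x y`, the element `y = z² (x y) x y²` is nonnegative, and `x z` is its
  -- inverse.
  have h3 := mul _ _ (mul _ _ (mul _ _ (sq z) hxy) hΓ.1) (sq (ν 1))
  exact h2.2 _ (ν 0 * z) (by
    rwa [show z * z * (ν 0 * ν 1) * ν 0 * (ν 1 * ν 1) = ν 1 by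
      linear_combination (z * ν 0 * ν 1 * ν 1 + ν 1) * hz] at h3) (by linear_combination hz)

end

end StronglyReal

/-! ### Conservativity -/

section Conservativity

variable {S S' : Signature}

section Good

variable {A : Type v} [CommRing A] {I : Interp A}

/-- The properties of strictly positive elements in reduced strictly ordered rings. -/
structure Interp.IsStrict (I : Interp A) : Prop where
  one : 1 ∈ I.pos
  nonneg : ∀ x, x ∈ I.pos → x ∈ I.nonneg
  add : ∀ x y, x ∈ I.pos → y ∈ I.nonneg → x + y ∈ I.pos
  mul : ∀ x y, x ∈ I.pos → y ∈ I.pos → x * y ∈ I.pos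
  aso1 : ∀ x y, x ∈ I.pos → x * y ∈ I.nonneg → y ∈ I.nonneg
  aso2 : ∀ x y, x ∈ I.nonneg → x * y ∈ I.pos → y ∈ I.pos

theorem Interp.Models.isStrict {hp : S.pos = true} (h : I.Models (Asonz S hp)) : I.IsStrict := by
  rw [models_Asonz, models_Apro] at h
  obtain ⟨⟨-, h1, h2, h3, h4, -⟩, -, h5, h6, -⟩ := h
  exact ⟨h1, h2, h3, h4, h5, h6⟩

theorem Interp.isGood_of_models (h : I.Models (Aonz S))
    (hpos : S.pos = true → I.IsStrict) (hsup : ∀ hs : S.sup = true, I.Models (Afrnz S hs))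
    (hfrac : S.frac = true → S.sup = true ∧ I.IsFrac) : I.IsGood S := by
  obtain ⟨h1, anti, aonz⟩ := models_Aonz.1 h
  obtain ⟨zero, add, sq, mul⟩ := models_Apo.1 h1
  refine ⟨⟨add, mul, sq⟩, anti, aonz, fun hs x y => ?_, fun hs x y => ?_, fun hs x y => ?_,
    fun hf => (hfrac hf).1, fun hf => (hfrac hf).2.1, fun hf x y => ((hfrac hf).2.2 x y).1,
    fun hf x y => ((hfrac hf).2.2 x y).2, fun hp => (hpos hp).one, fun hp => (hpos hp).mul,
    fun hp => (hpos hp).nonneg, fun hp => (hpos hp).add, fun hp => (hpos hp).aso1,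
    fun hp => (hpos hp).aso2⟩ <;> obtain ⟨_, _, hr, hsup, hn⟩ := (hsup hs).exists_lattice
  · rw [hn, hsup, sub_nonneg]
    exact le_sup_left
  · rw [hn, hsup, sub_nonneg]
    exact le_sup_right
  · rw [hsup]
    exact hr.sup_sub_mul_sup_sub x y

theorem Interp.isGood_of_Aonz (h : I.Models (Aonz sigAo)) : I.IsGood sigAo :=
  isGood_of_models h (by simp) (by simp) (by simp)

theorem Interp.isGood_of_Asonz (h : I.Models (Asonz sigAso rfl)) : I.IsGood sigAso :=
  isGood_of_models (h.aonz_of_asonz _) (fun _ => h.isStrict) (by simp) (by simp)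

theorem Interp.isGood_of_Afrnz (h : I.Models (Afrnz sigAfr rfl)) : I.IsGood sigAfr :=
  isGood_of_models (h.aonz_of_afrnz _) (by simp) (fun _ => h) (by simp)

theorem Interp.isGood_of_Asrnz (h : I.Models (Asrnz sigAsr rfl rfl)) : I.IsGood sigAsr :=
  have h' := h.asonz_of_asrnz (S' := sigAsr) rfl
  isGood_of_models (h'.aonz_of_asonz _) (fun _ => h'.isStrict)
    (fun _ => ((models_Asrnz rfl rfl).1 h).1) (by simp)

/-- Most strict-order rules are theorems here rather than axioms, with derivations through the
existential axiom. Hence the hypothesis covers all provable rules and not only `Interp.Models`. -/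
theorem Interp.isGood_of_Aftr
    (h : ∀ r : DynRule sigCo ℕ, (Aftr sigCo rfl rfl rfl).Proves r → r.ExistFree → r.Valid I) :
    I.IsGood sigCo := by
  obtain ⟨h1, h2, h3⟩ := (models_Aftr rfl rfl rfl).1 fun r hr => h r (Theory.proves_of_mem hr)
  exact isGood_of_models (h1.aonz_of_afrnz _)
    (fun _ => ⟨(models_aso1 rfl).1 (h _ (Aftr_proves_aso1 _ _ _)), h2.1,
      (models_aso3 rfl).1 (h _ (Aftr_proves_aso3 _ _ _)),
      (models_aso4 rfl).1 (h _ (Aftr_proves_aso4 _ _ _)),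
      (models_Aso1 rfl).1 (h _ (Aftr_proves_Aso1 _ _ _)),
      (models_Aso2 rfl).1 (h _ (Aftr_proves_Aso2 _ _ _))⟩)
    (fun _ => h1) (fun _ => ⟨rfl, h3⟩)

end Good

section Real

variable {K : Type v} [Field K] [LinearOrder K] [IsStrictOrderedRing K]

theorem realInterp_models : (realInterp K).Models (CrcdsupFr sigCo rfl rfl rfl) := by
  rw [Interp.models_CrcdsupFr, Interp.models_Cod, Interp.models_Apro, Interp.models_Apo]
  have hmm : ∀ x y : K, -(realInterp K).sup (-(realInterp K).sup x (-x))
      (-(realInterp K).sup y (-y)) = min |x| |y| := max_neg_max_neg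
  refine ⟨⟨⟨⟨le_refl (0 : K), fun x y => add_nonneg, mul_self_nonneg, fun x y => mul_nonneg⟩,
    one_pos, fun x => le_of_lt, fun x y => add_pos_of_pos_of_nonneg, fun x y => mul_pos,
    fun h => absurd h (lt_irrefl (0 : K))⟩, fun x h1 h2 => le_antisymm (neg_nonneg.1 h2) h1,
    fun x y h => mul_self_pos.2 (left_ne_zero_of_mul_eq_one h), fun x => ?_, fun x => ?_⟩,
    ⟨fun x y => sub_nonneg.2 (le_max_left x y), fun x y => sub_nonneg.2 (le_max_right x y),
      fun x y z h1 h2 => sub_nonneg.2 (max_le (sub_nonneg.1 h1) (sub_nonneg.1 h2))⟩,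
    fun x y => ?_, fun x y => ?_⟩
  · exact (le_total 0 x).imp id neg_nonneg.2
  · exact (eq_or_ne x 0).imp id mul_self_pos.2
  · rw [hmm]
    change min |x| |y| * min |x| |y| / |y| * |y| = _
    by_cases hy : y = 0
    · simp [hy]
    · rw [div_mul_cancel₀ _ (abs_ne_zero.2 hy)]
  · rw [hmm]
    have h0 : 0 ≤ min |x| |y| := le_min (abs_nonneg x) (abs_nonneg y)
    refine ⟨div_nonneg (mul_nonneg h0 h0) (abs_nonneg y), sub_nonneg.2 ?_⟩
    exact div_le_of_le_mul₀ (abs_nonneg y) h0 (mul_le_mul_of_nonneg_left (min_le_right _ _) h0)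

/-- Soundness also needs the existential axioms: field inverses give one, and the intermediate value
property gives the others. -/
theorem realInterp_valid (hK : PolynomialIVT K) :
    ∀ r ∈ CrcdsupFr sigCo rfl rfl rfl, r.Valid (realInterp K) := by
  intro r hr
  have hex : Theory.ExistSatisfy (CrcdsupFr sigCo rfl rfl rfl)
      fun r => r.Valid (realInterp K) := by
    refine existSatisfy_CrcdsupFr _ _ _ ((valid_IVne _).2 fun x hx => ?_) fun n =>
      valid_RCF _ n fun c a b hab h => ?_
    · exact ⟨x⁻¹, mul_inv_cancel₀ (mul_self_pos.1 hx)⟩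
    · have heval : ∀ x, (∑ k ∈ Finset.range (n + 1), Polynomial.C (c k) * Polynomial.X ^ k).eval x =
          ∑ k ∈ Finset.range (n + 1), c k * x ^ k := fun x => by
        simp [Polynomial.eval_finsetSum]
      obtain ⟨x, hx, hax, hxb⟩ := hK (∑ k ∈ Finset.range (n + 1), Polynomial.C (c k) *
        Polynomial.X ^ k) a b (sub_pos.1 hab) (by
          rw [heval, heval]
          exact neg_pos.1 h)
      exact ⟨x, by rw [← heval, hx], sub_pos.2 hax, sub_pos.2 hxb⟩
  exact (hex r hr).elim (realInterp_models r hr) id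

end Real

/-- Horn rules go from `W` up to `T` by translation of proofs. They come back through truth in real
closed fields and the completeness of `W` for these. -/
theorem sameHorn_of_isIntermediate {W : Theory S} {T : Theory S'} (hAc : Ac S ⊆ W)
    (hW : ∀ (A : Type u) [CommRing A] (I : Interp A),
      (∀ r : DynRule S ℕ, W.Proves r → r.ExistFree → r.Valid I) → I.IsGood S)
    (h : IsIntermediate W T) : SameHorn.{u} S W T := by
  obtain ⟨⟨h1, hT⟩, h2, hR⟩ := h
  refine ⟨⟨id, id, id⟩, h1, fun G R r ⟨Δ, hΔ⟩ => ?_⟩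
  have key : ∀ (S' : Signature) (h : S ≤ S'),
      Atom.lift h '' (Atom.rename Sum.inl '' R ∪ {a | a ∈ r.prem}) =
        Atom.rename Sum.inl '' (Atom.lift h '' R) ∪ {a | a ∈ (r.lift h).prem} := by
    intro S' h
    rw [Set.image_union, Set.image_image, Set.image_image]
    congr 1
    · exact Set.image_congr fun a _ => Atom.lift_subst h _ a
    · ext a
      simp [DynRule.lift]
  have hrefl : W.PresProves (Atom.lift ⟨id, id, id⟩ '' R) (r.lift ⟨id, id, id⟩) ↔
      Derives W (Atom.rename Sum.inl '' R ∪ {a | a ∈ r.prem}) r.concl := by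
    rw [Theory.PresProves, ← key, Set.image_congr fun a _ => Atom.lift_refl _ a, Set.image_id',
      DynRule.lift, List.map_id'' (ExConj.lift_refl _)]
  rw [hrefl]
  refine ⟨fun hd => ?_, fun hd => ?_⟩
  · have := hd.lift h1 hT
    rwa [key] at this
  · rw [hΔ]
    refine Derives.of_real hAc hW fun K _ _ _ μ hK hμ => ?_
    -- The proof in `T` is read in the theory of real closed fields, which is sound in `K`.
    have hd2 := hd.lift h2 hR
    obtain ⟨d, hd, hdμ⟩ := hd2.sound (realInterp_valid hK) μ (by
      rw [← key]
      rintro _ ⟨_, ⟨a, ha, rfl⟩, rfl⟩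
      rw [Atom.holds_lift, Atom.holds_lift]
      exact hμ a ha)
    rw [DynRule.lift, hΔ, List.map_singleton, List.map_singleton, List.mem_singleton] at hd
    rwa [hd, ExConj.holds_lift, ExConj.holds_lift] at hdμ

end Conservativity

/-! ### Comparison of the intermediate theories. -/

section Extensions

variable {S S' : Signature} {A : Type v} [CommRing A] {I : Interp A}

theorem Interp.Models.cod_congr {hp : S.pos = true} (h : I.Models (Cod S hp))
    (hp' : S'.pos = true) : I.Models (Cod S' hp') := by
  rwa [models_Cod, models_Apro, models_Apo] at h ⊢

theorem Interp.Models.asonz_of_cod {hp : S.pos = true} (h : I.Models (Cod S hp))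
    (hp' : S'.pos = true) : I.Models (Asonz S' hp') := h.isLinear.models_Asonz hp'

theorem Interp.Models.aonz_of_cod {hp : S.pos = true} (h : I.Models (Cod S hp)) (S' : Signature) :
    I.Models (Aonz S') := (h.asonz_of_cod hp).aonz_of_asonz S'

theorem Interp.Models.afrnz_of_cod {hp : S.pos = true} (h : I.Models (Cod S hp)) (hsup : I.IsSup)
    (hs' : S'.sup = true) : I.Models (Afrnz S' hs') := h.isLinear.models_Afrnz hsup hs'

theorem Interp.Models.asrnz_of_cod {hp : S.pos = true} (h : I.Models (Cod S hp)) (hsup : I.IsSup)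
    (hp' : S'.pos = true) (hs' : S'.sup = true) : I.Models (Asrnz S' hp' hs') :=
  (h.coMinus_of_cod hsup hp' hs').asrnz_of_coMinus hp' hs'

theorem Interp.Models.co_of_cod {hp : S.pos = true} (h : I.Models (Cod S hp)) (hsup : I.IsSup)
    (hfr : I.IsFrac) (hp' : S'.pos = true) (hs' : S'.sup = true) (hf' : S'.frac = true) :
    I.Models (Co S' hp' hs' hf') :=
  (models_Co hp' hs' hf').2 ⟨h.coMinus_of_cod hsup hp' hs', hfr⟩

/-- Real closedness consists of existential axioms only. So for the other axioms of `T` it suffices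
to look at models of discrete ordered fields with `∨` and `Fr`. -/
theorem CrcdsupFr_extends {T : Theory S} (hS : S ≤ sigCo)
    (h : ∀ (A : Type) [CommRing A] (I : Interp A), I.Models (Cod sigCo rfl) → I.IsSup → I.IsFrac →
      I.Models T)
    (hex : T.ExistSatisfy fun r => (CrcdsupFr sigCo rfl rfl rfl).Proves (r.lift hS)) :
    (CrcdsupFr sigCo rfl rfl rfl).Extends T := by
  refine Theory.extends_of_models hS ((Ac_subset_Cod rfl).trans (Cod_subset_CrcdsupFr _ _ _))
    (fun A _ I hI => ?_) hex
  obtain ⟨h1, h2, h3⟩ := (Interp.models_CrcdsupFr _ _ _).1 hI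
  exact h A I h1 h2 h3

theorem le_sigCo (S : Signature) : S ≤ sigCo := ⟨fun _ => rfl, fun _ => rfl, fun _ => rfl⟩

theorem CrcdsupFr_proves_IVne (hp : S.pos = true) :
    (CrcdsupFr sigCo rfl rfl rfl).Proves ((IVne S hp).lift (le_sigCo S)) :=
  Theory.proves_of_mem (Cod_subset_CrcdsupFr _ _ _ (.inr (.inr (.inr (.inl rfl)))))

theorem CrcdsupFr_proves_IVpos (hp : S.pos = true) :
    (CrcdsupFr sigCo rfl rfl rfl).Proves ((IVpos S hp).lift (le_sigCo S)) :=
  proves_IVpos rfl (Cod_subset_CrcdsupFr _ _ _)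

theorem CrcdsupFr_proves_RCF (hp : S.pos = true) (n : ℕ) :
    (CrcdsupFr sigCo rfl rfl rfl).Proves ((RCF S hp n).lift (le_sigCo S)) := by
  rw [RCF_lift]
  exact Theory.proves_of_mem (.inl (.inl (.inr ⟨n, rfl⟩)))

theorem CrcdsupFr_extends_Atonz : (CrcdsupFr sigCo rfl rfl rfl).Extends (Atonz sigAo) :=
  CrcdsupFr_extends (le_sigCo _) (fun _ _ _ h _ _ => h.isLinear.models_Atonz _) existSatisfy_Atonz

theorem CrcdsupFr_extends_Cod : (CrcdsupFr sigCo rfl rfl rfl).Extends (Cod sigAso rfl) :=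
  CrcdsupFr_extends (le_sigCo _) (fun _ _ _ h _ _ => h.cod_congr rfl)
    (existSatisfy_Cod _ (CrcdsupFr_proves_IVne _))

theorem CrcdsupFr_extends_Afrnz : (CrcdsupFr sigCo rfl rfl rfl).Extends (Afrnz sigAfr rfl) :=
  CrcdsupFr_extends (le_sigCo _) (fun _ _ _ h hs _ => h.afrnz_of_cod hs rfl) (existSatisfy_Afrnz _)

theorem CrcdsupFr_extends_Asrnz : (CrcdsupFr sigCo rfl rfl rfl).Extends (Asrnz sigAsr rfl rfl) :=
  CrcdsupFr_extends (le_sigCo _) (fun _ _ _ h hs _ => h.asrnz_of_cod hs rfl rfl)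
    (existSatisfy_Asrnz _ _)

theorem CrcdsupFr_extends_CoMinus :
    (CrcdsupFr sigCo rfl rfl rfl).Extends (CoMinus sigAsr rfl rfl) :=
  CrcdsupFr_extends (le_sigCo _) (fun _ _ _ h hs _ => h.coMinus_of_cod hs rfl rfl)
    (existSatisfy_CoMinus _ _ (CrcdsupFr_proves_IVpos _))

theorem CrcdsupFr_extends_Co : (CrcdsupFr sigCo rfl rfl rfl).Extends (Co sigCo rfl rfl rfl) :=
  CrcdsupFr_extends (le_sigCo _) (fun _ _ _ h hs hf => h.co_of_cod hs hf rfl rfl rfl)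
    (existSatisfy_Co _ _ _ (CrcdsupFr_proves_IVpos _))

theorem CrcdsupFr_extends_Codsup : (CrcdsupFr sigCo rfl rfl rfl).Extends (Codsup sigAsr rfl rfl) :=
  CrcdsupFr_extends (le_sigCo _)
    (fun _ _ _ h hs _ => (Interp.models_Codsup _ _).2 ⟨h.cod_congr rfl, hs⟩)
    (existSatisfy_Codsup _ _ (CrcdsupFr_proves_IVne _))

theorem CrcdsupFr_extends_Crcdsup :
    (CrcdsupFr sigCo rfl rfl rfl).Extends (Crcdsup sigAsr rfl rfl) :=
  CrcdsupFr_extends (le_sigCo _)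
    (fun _ _ _ h hs _ => (Interp.models_Crcdsup _ _).2 ⟨h.cod_congr rfl, hs⟩)
    (existSatisfy_Crcdsup _ _ (CrcdsupFr_proves_IVne _) (CrcdsupFr_proves_RCF _))

theorem CrcdsupFr_extends_CodsupFr :
    (CrcdsupFr sigCo rfl rfl rfl).Extends (CodsupFr sigCo rfl rfl rfl) :=
  CrcdsupFr_extends (le_sigCo _)
    (fun _ _ _ h hs hf => (Interp.models_CodsupFr _ _ _).2 ⟨h, hs, hf⟩)
    (existSatisfy_CodsupFr _ _ _ (CrcdsupFr_proves_IVne _))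

theorem CrcdsupFr_extends_CrcdsupFr :
    (CrcdsupFr sigCo rfl rfl rfl).Extends (CrcdsupFr sigCo rfl rfl rfl) :=
  CrcdsupFr_extends (le_sigCo _)
    (fun _ _ _ h hs hf => (Interp.models_CrcdsupFr _ _ _).2 ⟨h, hs, hf⟩)
    (existSatisfy_CrcdsupFr _ _ _ (CrcdsupFr_proves_IVne _) (CrcdsupFr_proves_RCF _))

theorem extends_Aonz (hS : S ≤ S') {T' : Theory S'} (hAc : Ac S' ⊆ T')
    (h : ∀ (A : Type) [CommRing A] (I : Interp A), I.Models T' → I.Models (Aonz S)) :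
    T'.Extends (Aonz S) := Theory.extends_of_models hS hAc h existSatisfy_Aonz

theorem extends_Asonz (hS : S ≤ S') (hp : S.pos = true) {T' : Theory S'} (hAc : Ac S' ⊆ T')
    (h : ∀ (A : Type) [CommRing A] (I : Interp A), I.Models T' → I.Models (Asonz S hp)) :
    T'.Extends (Asonz S hp) := Theory.extends_of_models hS hAc h (existSatisfy_Asonz hp)

theorem extends_Afrnz (hS : S ≤ S') (hs : S.sup = true) {T' : Theory S'} (hAc : Ac S' ⊆ T')
    (h : ∀ (A : Type) [CommRing A] (I : Interp A), I.Models T' → I.Models (Afrnz S hs)) :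
    T'.Extends (Afrnz S hs) := Theory.extends_of_models hS hAc h (existSatisfy_Afrnz hs)

theorem extends_Asrnz (hS : S ≤ S') (hp : S.pos = true) (hs : S.sup = true) {T' : Theory S'}
    (hAc : Ac S' ⊆ T')
    (h : ∀ (A : Type) [CommRing A] (I : Interp A), I.Models T' → I.Models (Asrnz S hp hs)) :
    T'.Extends (Asrnz S hp hs) := Theory.extends_of_models hS hAc h (existSatisfy_Asrnz hp hs)

end Extensions

end DynTheory

/-! ### The theorem for the five signatures. -/

theorem mainTheorem1 :
    -- strictly reduced ordered rings
    (SameHorn.{u} sigAo (Aonz sigAo) (Crcdsup sigAsr rfl rfl) ∧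
      (∀ (S : Signature) (T : Theory S), IsIntermediate (Aonz sigAo) T →
        SameHorn.{u} sigAo (Aonz sigAo) T) ∧
      IsIntermediate (Aonz sigAo) (Afrnz sigAfr rfl) ∧
      IsIntermediate (Aonz sigAo) (Atonz sigAo) ∧
      IsIntermediate (Aonz sigAo) (Cod sigAso rfl) ∧
      IsIntermediate (Aonz sigAo) (CoMinus sigAsr rfl rfl)) ∧
    -- reduced strictly ordered rings
    (SameHorn.{u} sigAso (Asonz sigAso rfl) (Crcdsup sigAsr rfl rfl) ∧
      (∀ (S : Signature) (T : Theory S), IsIntermediate (Asonz sigAso rfl) T →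
        SameHorn.{u} sigAso (Asonz sigAso rfl) T) ∧
      IsIntermediate (Asonz sigAso rfl) (Asrnz sigAsr rfl rfl) ∧
      IsIntermediate (Asonz sigAso rfl) (Cod sigAso rfl) ∧
      IsIntermediate (Asonz sigAso rfl) (CoMinus sigAsr rfl rfl)) ∧
    -- reduced f-rings
    (SameHorn.{u} sigAfr (Afrnz sigAfr rfl) (Crcdsup sigAsr rfl rfl) ∧
      (∀ (S : Signature) (T : Theory S), IsIntermediate (Afrnz sigAfr rfl) T →
        SameHorn.{u} sigAfr (Afrnz sigAfr rfl) T) ∧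
      IsIntermediate (Afrnz sigAfr rfl) (Asrnz sigAsr rfl rfl) ∧
      IsIntermediate (Afrnz sigAfr rfl) (Codsup sigAsr rfl rfl) ∧
      IsIntermediate (Afrnz sigAfr rfl) (CoMinus sigAsr rfl rfl)) ∧
    -- reduced strict f-rings
    (SameHorn.{u} sigAsr (Asrnz sigAsr rfl rfl) (Crcdsup sigAsr rfl rfl) ∧
      (∀ (S : Signature) (T : Theory S), IsIntermediate (Asrnz sigAsr rfl rfl) T →
        SameHorn.{u} sigAsr (Asrnz sigAsr rfl rfl) T) ∧
      IsIntermediate (Asrnz sigAsr rfl rfl) (Co sigCo rfl rfl rfl) ∧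
      IsIntermediate (Asrnz sigAsr rfl rfl) (Codsup sigAsr rfl rfl)) ∧
    -- strongly real rings
    (SameHorn.{u} sigCo (Aftr sigCo rfl rfl rfl) (CrcdsupFr sigCo rfl rfl rfl) ∧
      (∀ (S : Signature) (T : Theory S), IsIntermediate (Aftr sigCo rfl rfl rfl) T →
        SameHorn.{u} sigCo (Aftr sigCo rfl rfl rfl) T) ∧
      IsIntermediate (Aftr sigCo rfl rfl rfl) (Co sigCo rfl rfl rfl) ∧
      IsIntermediate (Aftr sigCo rfl rfl rfl) (CodsupFr sigCo rfl rfl rfl)) := by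
  have le1 : sigAo ≤ sigAso := by simp [LE.le]
  have le2 : sigAo ≤ sigAsr := by simp [LE.le]
  have le3 : sigAo ≤ sigAfr := by simp [LE.le]
  have le4 : sigAso ≤ sigAsr := by simp [LE.le]
  have le5 : sigAfr ≤ sigAsr := by simp [LE.le]
  have crcdsup : ∀ {A : Type} [CommRing A] {I : Interp A}, I.Models (Crcdsup sigAsr rfl rfl) →
      I.Models (Cod sigAsr rfl) ∧ I.IsSup := fun h => (Interp.models_Crcdsup _ _).1 h
  have codsup : ∀ {A : Type} [CommRing A] {I : Interp A}, I.Models (Codsup sigAsr rfl rfl) →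
      I.Models (Cod sigAsr rfl) ∧ I.IsSup := fun h => (Interp.models_Codsup _ _).1 h
  have asonz_coMinus : ∀ {A : Type} [CommRing A] {I : Interp A},
      I.Models (CoMinus sigAsr rfl rfl) → I.Models (Asonz sigAsr rfl) := fun h =>
    ((Interp.models_CoMinus _ _).1 h).1
  have ac_crcdsup : Ac sigAsr ⊆ Crcdsup sigAsr rfl rfl :=
    (Ac_subset_Cod rfl).trans (Cod_subset_Crcdsup _ _)
  have ac_codsup : Ac sigAsr ⊆ Codsup sigAsr rfl rfl := Ac_subset_Codsup _ _
  refine ⟨?_, ?_, ?_, ?_, ?_⟩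
  · have key : ∀ (S : Signature) (T : Theory S), IsIntermediate (Aonz sigAo) T →
        SameHorn.{u} sigAo (Aonz sigAo) T := fun S T =>
      sameHorn_of_isIntermediate Ac_subset_Aonz fun A _ I hI =>
        I.isGood_of_Aonz fun r hr => hI r (Theory.proves_of_mem hr)
    refine ⟨key _ _ ⟨?_, CrcdsupFr_extends_Crcdsup⟩, key, ⟨?_, CrcdsupFr_extends_Afrnz⟩,
      ⟨?_, CrcdsupFr_extends_Atonz⟩, ⟨?_, CrcdsupFr_extends_Cod⟩, ⟨?_, CrcdsupFr_extends_CoMinus⟩⟩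
    · exact extends_Aonz le2 ac_crcdsup fun _ _ _ h => (crcdsup h).1.aonz_of_cod _
    · exact extends_Aonz le3 (Ac_subset_Afrnz _) fun _ _ _ h => h.aonz_of_afrnz _
    · exact extends_Aonz ⟨id, id, id⟩ Ac_subset_Atonz fun _ _ _ h => h.aonz_of_atonz
    · exact extends_Aonz le1 (Ac_subset_Cod _) fun _ _ _ h => h.aonz_of_cod _
    · exact extends_Aonz le2 (Ac_subset_CoMinus _ _) fun _ _ _ h =>
        (asonz_coMinus h).aonz_of_asonz _
  · have key : ∀ (S : Signature) (T : Theory S), IsIntermediate (Asonz sigAso rfl) T →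
        SameHorn.{u} sigAso (Asonz sigAso rfl) T := fun S T =>
      sameHorn_of_isIntermediate (Ac_subset_Asonz _) fun A _ I hI =>
        I.isGood_of_Asonz fun r hr => hI r (Theory.proves_of_mem hr)
    refine ⟨key _ _ ⟨?_, CrcdsupFr_extends_Crcdsup⟩, key, ⟨?_, CrcdsupFr_extends_Asrnz⟩,
      ⟨?_, CrcdsupFr_extends_Cod⟩, ⟨?_, CrcdsupFr_extends_CoMinus⟩⟩
    · exact extends_Asonz le4 _ ac_crcdsup fun _ _ _ h => (crcdsup h).1.asonz_of_cod _
    · exact extends_Asonz le4 _ (Ac_subset_Asrnz _ _) fun _ _ _ h => h.asonz_of_asrnz _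
    · exact extends_Asonz ⟨id, id, id⟩ _ (Ac_subset_Cod _) fun _ _ _ h => h.asonz_of_cod _
    · exact extends_Asonz le4 _ (Ac_subset_CoMinus _ _) fun _ _ _ h =>
        (h.asrnz_of_coMinus (S' := sigAsr) rfl rfl).asonz_of_asrnz _
  · have key : ∀ (S : Signature) (T : Theory S), IsIntermediate (Afrnz sigAfr rfl) T →
        SameHorn.{u} sigAfr (Afrnz sigAfr rfl) T := fun S T =>
      sameHorn_of_isIntermediate (Ac_subset_Afrnz _) fun A _ I hI =>
        I.isGood_of_Afrnz fun r hr => hI r (Theory.proves_of_mem hr)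
    refine ⟨key _ _ ⟨?_, CrcdsupFr_extends_Crcdsup⟩, key, ⟨?_, CrcdsupFr_extends_Asrnz⟩,
      ⟨?_, CrcdsupFr_extends_Codsup⟩, ⟨?_, CrcdsupFr_extends_CoMinus⟩⟩
    · exact extends_Afrnz le5 _ ac_crcdsup fun _ _ _ h => (crcdsup h).1.afrnz_of_cod (crcdsup h).2 _
    · exact extends_Afrnz le5 _ (Ac_subset_Asrnz _ _) fun _ _ _ h =>
        ((Interp.models_Asrnz _ _).1 h).1.afrnz_congr _
    · exact extends_Afrnz le5 _ ac_codsup fun _ _ _ h => (codsup h).1.afrnz_of_cod (codsup h).2 _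
    · exact extends_Afrnz le5 _ (Ac_subset_CoMinus _ _) fun _ _ _ h =>
        h.afrnz_of_coMinus.afrnz_congr _
  · have key : ∀ (S : Signature) (T : Theory S), IsIntermediate (Asrnz sigAsr rfl rfl) T →
        SameHorn.{u} sigAsr (Asrnz sigAsr rfl rfl) T := fun S T =>
      sameHorn_of_isIntermediate (Ac_subset_Asrnz _ _) fun A _ I hI =>
        I.isGood_of_Asrnz fun r hr => hI r (Theory.proves_of_mem hr)
    refine ⟨key _ _ ⟨?_, CrcdsupFr_extends_Crcdsup⟩, key, ⟨?_, CrcdsupFr_extends_Co⟩,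
      ⟨?_, CrcdsupFr_extends_Codsup⟩⟩
    · exact extends_Asrnz ⟨id, id, id⟩ _ _ ac_crcdsup fun _ _ _ h =>
        (crcdsup h).1.asrnz_of_cod (crcdsup h).2 _ _
    · exact extends_Asrnz (le_sigCo _) _ _ (Ac_subset_Co _ _ _) fun _ _ _ h =>
        ((Interp.models_Co _ _ _).1 h).1.asrnz_of_coMinus _ _
    · exact extends_Asrnz ⟨id, id, id⟩ _ _ ac_codsup fun _ _ _ h =>
        (codsup h).1.asrnz_of_cod (codsup h).2 _ _
  · have key : ∀ (S : Signature) (T : Theory S), IsIntermediate (Aftr sigCo rfl rfl rfl) T →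
        SameHorn.{u} sigCo (Aftr sigCo rfl rfl rfl) T := fun S T =>
      sameHorn_of_isIntermediate (Ac_subset_Aftr _ _ _) fun A _ I hI => I.isGood_of_Aftr hI
    refine ⟨key _ _ ⟨?_, CrcdsupFr_extends_CrcdsupFr⟩, key, ⟨?_, CrcdsupFr_extends_Co⟩,
      ⟨?_, CrcdsupFr_extends_CodsupFr⟩⟩
    · exact CrcdsupFr_extends (le_sigCo _)
        (fun _ _ _ h hs hf => (h.co_of_cod hs hf rfl rfl rfl).aftr_of_co)
        (existSatisfy_Aftr _ _ _ (CrcdsupFr_proves_IVpos _))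
    · exact Theory.extends_of_models (le_sigCo _) (Ac_subset_Co _ _ _) (fun _ _ _ h => h.aftr_of_co)
        (existSatisfy_Aftr _ _ _ (Theory.proves_of_mem
          (.inl (.inl (.inr (.inr (.inr (.inl rfl))))))))
    -- Discrete ordered fields postulate inverses when `x² > 0`, so the axiom for `x > 0` has to be
    -- derived by `proves_IVpos`.
    · refine Theory.extends_of_models (le_sigCo _) (Ac_subset_Cod rfl |>.trans
        (Cod_subset_CodsupFr _ _ _)) (fun _ _ _ h => ?_)
        (existSatisfy_Aftr _ _ _ (proves_IVpos rfl (Cod_subset_CodsupFr _ _ _)))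
      obtain ⟨h1, h2, h3⟩ := (Interp.models_CodsupFr _ _ _).1 h
      exact (h1.co_of_cod h2 h3 rfl rfl rfl).aftr_of_co
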